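/- Let $\mathrm{vol}$ be Lebesgue measure on $\mathbb R^3$ and let $B_\varepsilon(x)$ be the ball of radius $\varepsilon$ centered at $x$. A *lattice polytope* is a convex polytope all of whose vertices lie in $\mathbb Z^3$. For such a polytope $P\subset\mathbb R^3$ and $x\in P$, the *solid angle* of $P$ at $x$ is $\omega_P(x)=\mathrm{vol}(B_\varepsilon(x)\cap P)/\mathrm{vol}(B_\varepsilon(x))$ for all sufficiently small $\varepsilon>0$. Call $P$ *concrete* if $\sum_{x\in P\cap\mathbb Z^3}\omega_P(x)=\mathrm{vol}(P)$. Say that $P$ *multitiles* $\mathbb R^3$ if there are an integer $k\ge 1$ and an infinite family $\mathcal P$ (repetitions allowed) of congruent copies of $P$, i.e. images of $P$ under arbitrary isometries of $\mathbb R^3$, reflections included, such that almost every point of $\mathbb R^3$ belongs to exactly $k$ members of $\mathcal P$. A *zonotope* is a translate of a Minkowski sum of finitely many line segments, and a *lattice zonotope* is a zonotope that is a lattice polytope. **Theorem.** There is a full-dimensional concrete lattice polytope $P\subset\mathbb R^3$ that does not multitile $\mathbb R^3$. Moreover, $P$ can be chosen so that for every $N\in\mathbb N$ there is a lattice zonotope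 $Q\subset\mathbb R^3$ for which the Minkowski sum $P+Q$ is again a full-dimensional concrete lattice polytope that does not multitile $\mathbb R^3$, and $P+Q$ has more than $N$ vertices. -/

import Mathlib

open MeasureTheory Filter Topology
open scoped Pointwise

/-- Euclidean space `ℝ^d`, with the Euclidean distance and Lebesgue measure. -/
abbrev Euc (d : ℕ) : Type := EuclideanSpace ℝ (Fin d)

/-- The integer lattice `ℤ^d ⊂ ℝ^d`. -/
def integerLattice (d : ℕ) : Set (Euc d) := {x | ∀ i, ∃ n : ℤ, x i = n}

/-- A convex polytope: the convex hull of finitely many points.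
It need not be full-dimensional. -/
def IsConvexPolytope {d : ℕ} (P : Set (Euc d)) : Prop :=
  ∃ s : Set (Euc d), s.Finite ∧ P = convexHull ℝ s

/-- The vertices of a convex polytope are its extreme points. -/
def polytopeVertices {d : ℕ} (P : Set (Euc d)) : Set (Euc d) := P.extremePoints ℝ

/-- A lattice polytope: a convex polytope all of whose vertices are integer points. -/
def IsLatticePolytope {d : ℕ} (P : Set (Euc d)) : Prop :=
  IsConvexPolytope P ∧ polytopeVertices P ⊆ integerLattice d

/-- The proportion `vol (B_ε(x) ∩ P) / vol (B_ε(x))`. -/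
noncomputable def ballRatio {d : ℕ} (P : Set (Euc d)) (x : Euc d) (ε : ℝ) : ℝ :=
  volume.real (Metric.ball x ε ∩ P) / volume.real (Metric.ball x ε)

/-- The solid angle `ω_P(x)`: the value of `vol (B_ε(x) ∩ P) / vol (B_ε(x))` for all sufficiently
small `ε > 0`, written as the limit for `ε → 0+`. For a polytope the ratio is eventually constant,
so that the limit is this value; that the limit exists for convex `P` and `x ∈ P` is proved
in `tendsto_ballRatio`. -/
noncomputable def solidAngle {d : ℕ} (P : Set (Euc d)) (x : Euc d) : ℝ :=
  limUnder (𝓝[>] (0 : ℝ)) (ballRatio P x)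

/-- The solid angle is the eventual value of the ratio, whenever there is one. -/
theorem solidAngle_eq_of_eventually {d : ℕ} {P : Set (Euc d)} {x : Euc d} {w : ℝ}
    (h : ∀ᶠ ε in 𝓝[>] (0 : ℝ), ballRatio P x ε = w) : solidAngle P x = w :=
  (tendsto_const_nhds.congr' (h.mono fun _ hε => hε.symm)).limUnder_eq

theorem tendsto_ballRatio {d : ℕ} {P : Set (Euc d)} (hP : Convex ℝ P) {x : Euc d} (hx : x ∈ P) :
    Tendsto (ballRatio P x) (𝓝[>] (0 : ℝ)) (𝓝 (solidAngle P x)) := by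
  have hfin : ∀ ε : ℝ, volume (Metric.ball x ε) ≠ ⊤ := fun ε => measure_ball_lt_top.ne
  have hmono : AntitoneOn (ballRatio P x) (Set.Ioi 0) := by
    intro a ha b hb hab
    have ha' : (0 : ℝ) < a := ha
    have hb' : (0 : ℝ) < b := hb
    set c : ℝ := a / b with hc
    have hc0 : 0 < c := div_pos ha' hb'
    have hc1 : c ≤ 1 := (div_le_one hb').2 hab
    have key : ∀ s : Set (Euc d), volume.real (AffineMap.homothety x c '' s)
        = c ^ d * volume.real s := by
      intro s
      simp only [Measure.real, Measure.addHaar_image_homothety, finrank_euclideanSpace_fin,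
        ENNReal.toReal_mul]
      rw [ENNReal.toReal_ofReal (abs_nonneg _), abs_of_pos (pow_pos hc0 d)]
    have hball : volume.real (Metric.ball x a) = c ^ d * volume.real (Metric.ball x b) := by
      rw [← key]
      congr 1
      ext y
      simp only [Set.mem_image, Metric.mem_ball]
      constructor
      · intro hy
        refine ⟨AffineMap.homothety x c⁻¹ y, ?_, ?_⟩
        · rw [dist_homothety_center, norm_inv, Real.norm_of_nonneg hc0.le, dist_comm,
            inv_mul_lt_iff₀ hc0, hc, div_mul_cancel₀ _ hb'.ne']
          exact hy
        · rw [← AffineMap.homothety_mul_apply, mul_inv_cancel₀ hc0.ne']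
          simp
      · rintro ⟨z, hz, rfl⟩
        rw [dist_homothety_center, Real.norm_of_nonneg hc0.le, dist_comm, hc]
        calc a / b * dist z x < a / b * b := by gcongr
          _ = a := div_mul_cancel₀ _ hb'.ne'
    have hsub : AffineMap.homothety x c '' (Metric.ball x b ∩ P) ⊆ Metric.ball x a ∩ P := by
      rintro _ ⟨z, ⟨hz, hzP⟩, rfl⟩
      refine ⟨?_, ?_⟩
      · rw [Metric.mem_ball] at hz ⊢
        rw [dist_homothety_center, Real.norm_of_nonneg hc0.le, dist_comm, hc]
        calc a / b * dist z x < a / b * b := by gcongr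
          _ = a := div_mul_cancel₀ _ hb'.ne'
      · rw [AffineMap.homothety_eq_lineMap]
        exact hP.lineMap_mem hx hzP ⟨hc0.le, hc1⟩
    have hle : c ^ d * volume.real (Metric.ball x b ∩ P) ≤ volume.real (Metric.ball x a ∩ P) := by
      rw [← key]
      exact measureReal_mono hsub (measure_ne_top_of_subset Set.inter_subset_left (hfin a))
    have hpos : 0 < volume.real (Metric.ball x b) :=
      ENNReal.toReal_pos (Metric.measure_ball_pos volume x hb').ne' (hfin b)
    unfold ballRatio
    rw [hball, div_le_div_iff₀ hpos (mul_pos (pow_pos hc0 d) hpos)]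
    nlinarith
  have hbdd : BddAbove (ballRatio P x '' Set.Ioi 0) := by
    refine ⟨1, ?_⟩
    rintro _ ⟨ε, -, rfl⟩
    exact div_le_one_of_le₀ (measureReal_mono Set.inter_subset_left (hfin ε)) measureReal_nonneg
  exact tendsto_nhds_limUnder ⟨_, hmono.tendsto_nhdsGT hbdd⟩

/-- The discrete volume `χ(P)`: the sum of the solid angles over the integer points of `P`
(finitely many when `P` is a polytope). -/
noncomputable def discreteVolume {d : ℕ} (P : Set (Euc d)) : ℝ :=
  ∑ᶠ x ∈ P ∩ integerLattice d, solidAngle P x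

/-- A set, in practice a lattice polytope, is concrete if `χ(P) = vol(P)`. -/
def IsConcrete {d : ℕ} (P : Set (Euc d)) : Prop := discreteVolume P = volume.real P

/-- `Q` is a congruent copy of `P`: its image under an isometry of `ℝ^d` onto itself
(reflections are allowed). -/
def IsCongruentCopy {d : ℕ} (P Q : Set (Euc d)) : Prop :=
  ∃ g : Euc d ≃ᵢ Euc d, Q = g '' P

/-- `P` multitiles `ℝ^d`: for some integer `k ≥ 1` there is an infinite family of congruent copies
of `P`, in which a copy may occur more than once, such that every generic point of `ℝ^d`,
that is, almost every point, belongs to exactly `k` members of the family. For a countable family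
of copies of a polytope this is the same as asking it of every point which is on no boundary
of a member, and such a family of full-dimensional copies is automatically countable. -/
def Multitiles {d : ℕ} (P : Set (Euc d)) : Prop :=
  ∃ k : ℕ, 1 ≤ k ∧ ∃ (ι : Type) (F : ι → Set (Euc d)), Infinite ι ∧
    (∀ i, IsCongruentCopy P (F i)) ∧
    ∀ᵐ x : Euc d, {i | x ∈ F i}.encard = k

/-- A zonotope: a translate of the Minkowski sum of finitely many segments `[0, v i]`. -/
def IsZonotope {d : ℕ} (Q : Set (Euc d)) : Prop :=
  ∃ (n : ℕ) (a : Euc d) (v : Fin n → Euc d),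
    Q = {a} + ∑ i, segment ℝ (0 : Euc d) (v i)

/-- A lattice zonotope: a zonotope which is a lattice polytope. -/
def IsLatticeZonotope {d : ℕ} (Q : Set (Euc d)) : Prop :=
  IsZonotope Q ∧ IsLatticePolytope Q

/-- A counterexample to the claim that concrete lattice polytopes multitile: a full-dimensional
concrete lattice polytope which does not multitile `ℝ^d`. -/
def IsConcreteNonMultitiler {d : ℕ} (P : Set (Euc d)) : Prop :=
  IsLatticePolytope P ∧ (interior P).Nonempty ∧ IsConcrete P ∧ ¬ Multitiles P

/-! Let `f : ℝ → ℝ` be `ℚ`-linear with `f 1 = 0`. For a polyhedron in `ℝ³`, the integral of `f` of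
the solid angle with respect to the one-dimensional Hausdorff measure sees only the edges, and it is
the image of the Dehn invariant. In a multitiling the solid angles of the copies add up to `k` at
every point, which `f` kills. Summed over the copies that meet a large ball, the integrals therefore
cancel up to the copies that cross the sphere, which are of lower order, so the integral vanishes
for a multitiler.

The pyramid is the difference of two tetrahedra. Gram's relation expresses the sum of the vertex
angles of a tetrahedron by the dihedral angles, and the irrational terms of the two solid angle sums
cancel, so that the solid angle sum of the pyramid is its volume `13 / 2`. Its Dehn functional is
`2 √6 f(β) + 8 f(α)` for two dihedral angles `α` and `β`, measured as fractions of the full angle.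
As `α` is irrational, `f` can be chosen with rational values and `f α ≠ 0`, and then the functional
is not zero because `√6` is irrational.

Adding the segment `[0, v]` to a set `S` adds `(S + [0, v]) \ S`, which tiles the space as soon as
the projection of `S` along `v` tiles the plane. For the sums in question this projection is a
trapezoid, and the tiling uses lattice translations and point reflections that preserve the lattice.
So the added set has a solid angle sum equal to its volume and contributes nothing to the Dehn
functional, and the properties of the pyramid pass on to the sums. -/

open scoped RealInnerProductSpace ENNReal

/-- `A` has the solid angle `w` at `x`. Unlike `solidAngle A x = w`, this asserts that the limit
exists, and it is meaningful for non-convex `A`. -/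
def HasSolidAngle {d : ℕ} (A : Set (Euc d)) (x : Euc d) (w : ℝ) : Prop :=
  Tendsto (ballRatio A x) (𝓝[>] (0 : ℝ)) (𝓝 w)

section HasSolidAngle

variable {d : ℕ} {A B : Set (Euc d)} {x : Euc d} {w w' : ℝ}

theorem HasSolidAngle.solidAngle_eq (h : HasSolidAngle A x w) : solidAngle A x = w := h.limUnder_eq

theorem HasSolidAngle.congr_ae {δ : ℝ} (hδ : 0 < δ)
    (hAB : ∀ᵐ y : Euc d, y ∈ Metric.ball x δ → (y ∈ A ↔ y ∈ B)) (h : HasSolidAngle A x w) :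
    HasSolidAngle B x w := by
  refine Tendsto.congr' ?_ h
  filter_upwards [Ioo_mem_nhdsGT hδ] with ε hε
  unfold ballRatio
  congr 1
  refine measureReal_congr ?_
  filter_upwards [hAB] with y hy
  exact propext (and_congr_right fun hyε => hy (Metric.ball_subset_ball hε.2.le hyε))

theorem HasSolidAngle.congr {δ : ℝ} (hδ : 0 < δ) (hAB : ∀ y ∈ Metric.ball x δ, (y ∈ A ↔ y ∈ B))
    (h : HasSolidAngle A x w) : HasSolidAngle B x w :=
  h.congr_ae hδ (Eventually.of_forall hAB)

theorem HasSolidAngle.of_eventually (h : ∀ᶠ ε in 𝓝[>] (0 : ℝ), ballRatio A x ε = w) :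
    HasSolidAngle A x w :=
  tendsto_const_nhds.congr' (h.mono fun _ hε => hε.symm)

theorem volume_real_ball_pos (x : Euc d) {ε : ℝ} (hε : 0 < ε) :
    0 < volume.real (Metric.ball x ε) :=
  ENNReal.toReal_pos (Metric.measure_ball_pos volume x hε).ne' measure_ball_lt_top.ne

theorem hasSolidAngle_univ (x : Euc d) : HasSolidAngle (Set.univ : Set (Euc d)) x 1 := by
  refine .of_eventually ?_
  filter_upwards [self_mem_nhdsWithin] with ε hε
  simp [ballRatio, div_self (volume_real_ball_pos x hε).ne']

theorem hasSolidAngle_of_notMem_closure (h : x ∉ closure A) : HasSolidAngle A x 0 := by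
  obtain ⟨δ, hδ, hb⟩ := Metric.mem_nhds_iff.1 (isClosed_closure.isOpen_compl.mem_nhds h)
  have hempty : HasSolidAngle (∅ : Set (Euc d)) x 0 :=
    .of_eventually (Eventually.of_forall fun ε => by simp [ballRatio])
  exact hempty.congr hδ fun y hy =>
    ⟨fun h => h.elim, fun hyA => (hb hy (subset_closure hyA)).elim⟩

theorem solidAngle_eq_zero_of_notMem (hA : IsClosed A) (hx : x ∉ A) : solidAngle A x = 0 :=
  (hasSolidAngle_of_notMem_closure (by rwa [hA.closure_eq])).solidAngle_eq

theorem hasSolidAngle_of_convex (hA : Convex ℝ A) (hc : IsClosed A) (x : Euc d) :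
    HasSolidAngle A x (solidAngle A x) := by
  by_cases hx : x ∈ A
  · exact tendsto_ballRatio hA hx
  · rw [solidAngle_eq_zero_of_notMem hc hx]
    exact hasSolidAngle_of_notMem_closure (by rwa [hc.closure_eq])

theorem HasSolidAngle.nonneg (hw : HasSolidAngle A x w) : 0 ≤ w :=
  ge_of_tendsto' hw fun _ => div_nonneg measureReal_nonneg measureReal_nonneg

theorem sum_mul_eq_of_hasSolidAngle {ι : Type*} (s : Finset ι) (A : ι → Set (Euc d))
    (c w : ι → ℝ) (C : ℝ) {δ : ℝ} (hδ : 0 < δ) (hA : ∀ i ∈ s, MeasurableSet (A i))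
    (hw : ∀ i ∈ s, HasSolidAngle (A i) x (w i))
    (h : ∀ᵐ y : Euc d, y ∈ Metric.ball x δ → ∑ i ∈ s, c i * (A i).indicator 1 y = C) :
    ∑ i ∈ s, c i * w i = C := by
  have hlim : Tendsto (fun ε => ∑ i ∈ s, c i * ballRatio (A i) x ε) (𝓝[>] (0 : ℝ))
      (𝓝 (∑ i ∈ s, c i * w i)) :=
    tendsto_finsetSum _ fun i hi => (hw i hi).const_mul _
  refine tendsto_nhds_unique hlim (tendsto_const_nhds.congr' ?_)
  filter_upwards [Ioo_mem_nhdsGT hδ] with ε hε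
  have hterm : ∀ i ∈ s, c i * ballRatio (A i) x ε =
      (∫ y in Metric.ball x ε, c i * (A i).indicator 1 y) / volume.real (Metric.ball x ε) := by
    intro i hi
    rw [integral_const_mul, integral_indicator_one (hA i hi), ballRatio, mul_div_assoc,
      measureReal_restrict_apply (hA i hi), Set.inter_comm]
  have hInt : ∀ i ∈ s, IntegrableOn (fun y => c i * (A i).indicator 1 y) (Metric.ball x ε) := by
    intro i hi
    have hconst : IntegrableOn (fun _ : Euc d => (1 : ℝ)) (Metric.ball x ε) :=
      integrableOn_const measure_ball_lt_top.ne
    exact (Integrable.indicator (f := fun _ => (1 : ℝ)) hconst (hA i hi)).const_mul _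
  rw [Finset.sum_congr rfl hterm, ← Finset.sum_div, ← integral_finsetSum s hInt,
    eq_div_iff (volume_real_ball_pos x hε.1).ne',
    setIntegral_congr_ae (g := fun _ => C) measurableSet_ball]
  · simp [mul_comm]
  · filter_upwards [h] with y hy hyε
    exact hy (Metric.ball_subset_ball hε.2.le hyε)

theorem HasSolidAngle.sdiff (hA : MeasurableSet A) (hAB : A ⊆ B)
    (hw : HasSolidAngle A x w) (hw' : HasSolidAngle B x w') :
    HasSolidAngle (B \ A) x (w' - w) := by
  refine (hw'.sub hw).congr fun ε => ?_
  unfold ballRatio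
  rw [← sub_div, Set.inter_sdiff_distrib_left, measureReal_sdiff
    (Set.inter_subset_inter_right _ hAB) (measurableSet_ball.inter hA)
    (measure_ne_top_of_subset Set.inter_subset_left measure_ball_lt_top.ne)]

theorem measurePreserving_isometryEquiv (g : Euc d ≃ᵢ Euc d) :
    MeasurePreserving g (volume : Measure (Euc d)) volume := by
  simpa only [EuclideanSpace.euclideanHausdorffMeasure_eq_volume] using
    g.measurePreserving_euclideanHausdorffMeasure d

theorem volume_image_isometryEquiv (g : Euc d ≃ᵢ Euc d) (s : Set (Euc d)) :
    volume (g '' s) = volume s := by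
  rw [show g '' s = g.symm ⁻¹' s from g.toEquiv.image_eq_preimage_symm s]
  exact (measurePreserving_isometryEquiv g.symm).measure_preimage_emb
    g.symm.toHomeomorph.measurableEmbedding s

theorem volume_real_image_isometryEquiv (g : Euc d ≃ᵢ Euc d) (s : Set (Euc d)) :
    volume.real (g '' s) = volume.real s :=
  congrArg ENNReal.toReal (volume_image_isometryEquiv g s)

theorem measurableSet_image_isometryEquiv (hm : MeasurableSet A) (g : Euc d ≃ᵢ Euc d) :
    MeasurableSet (g '' A) :=
  g.toHomeomorph.measurableEmbedding.measurableSet_image.2 hm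

theorem HasSolidAngle.image_isometryEquiv (h : HasSolidAngle A x w) (g : Euc d ≃ᵢ Euc d) :
    HasSolidAngle (g '' A) (g x) w := by
  refine Tendsto.congr (fun ε => ?_) h
  unfold ballRatio
  rw [← g.image_ball, ← Set.image_inter g.injective, volume_real_image_isometryEquiv,
    volume_real_image_isometryEquiv]

theorem HasSolidAngle.neg (h : HasSolidAngle A x w) : HasSolidAngle (-A) (-x) w := by
  rw [← Set.image_neg_eq_neg]
  exact h.image_isometryEquiv (IsometryEquiv.neg (Euc d))

end HasSolidAngle

section HalfSpace

theorem ae_linearMap_ne {E : Type*} [NormedAddCommGroup E] [NormedSpace ℝ E]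
    [FiniteDimensional ℝ E] [MeasurableSpace E] [BorelSpace E] (μ : Measure E)
    [μ.IsAddHaarMeasure] {L : E →ₗ[ℝ] ℝ} (hL : L ≠ 0) (c : ℝ) : ∀ᵐ x ∂μ, L x ≠ c := by
  obtain ⟨y, hy⟩ : ∃ y, L y ≠ 0 := by simpa [LinearMap.ext_iff] using hL
  set H : AffineSubspace ℝ E := (AffineSubspace.mk' c ⊥).comap L.toAffineMap with hH
  have hmem : ∀ x, x ∈ H ↔ L x = c := fun x => by simp [hH, sub_eq_zero]
  have hne : H ≠ ⊤ := fun htop => by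
    have h0 := (hmem 0).1 (htop ▸ AffineSubspace.mem_top ..)
    have hy' := (hmem y).1 (htop ▸ AffineSubspace.mem_top ..)
    exact hy (by rw [hy', ← h0, map_zero])
  simpa [ae_iff, ← hmem] using Measure.addHaar_affineSubspace μ H hne

variable {d : ℕ} {n : Euc d}

theorem ae_inner_ne (hn : n ≠ 0) (c : ℝ) : ∀ᵐ x : Euc d, ⟪n, x⟫ ≠ c :=
  ae_linearMap_ne volume (L := innerₛₗ ℝ n)
    (fun h => hn (inner_self_eq_zero (𝕜 := ℝ).1 (LinearMap.congr_fun h n))) c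

theorem hasSolidAngle_halfSpace (hn : n ≠ 0) :
    HasSolidAngle {x : Euc d | 0 ≤ ⟪n, x⟫} 0 (1 / 2) := by
  set H : Set (Euc d) := {x | 0 ≤ ⟪n, x⟫} with hH
  have hclosed : IsClosed H := isClosed_le continuous_const (by fun_prop)
  have hangle := hasSolidAngle_of_convex (A := H) (convex_halfSpace_ge (innerₛₗ ℝ n).isLinear 0)
    hclosed 0
  have hneg : HasSolidAngle (-H) 0 (solidAngle H 0) := by simpa only [neg_zero] using hangle.neg
  have hsum := sum_mul_eq_of_hasSolidAngle (x := (0 : Euc d)) (Finset.univ : Finset Bool)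
    (fun b => bif b then H else -H) (fun _ => 1) (fun _ => solidAngle H 0) 1 one_pos
    (by rintro (_ | _) _; exacts [hclosed.measurableSet.neg, hclosed.measurableSet])
    (by rintro (_ | _) _; exacts [hneg, hangle])
    (by
      filter_upwards [ae_inner_ne hn 0] with y hy _
      rcases lt_or_gt_of_ne hy with h | h <;> simp [hH, h.le, not_le.2 h])
  convert hangle using 1
  norm_num at hsum
  linarith

end HalfSpace

section Wedge

open Real InnerProductGeometry

theorem volume_disc_inter_sector (c : ℝ) {A : Set (ℝ × ℝ)} {J : Set ℝ} (hA : MeasurableSet A)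
    (hJ : MeasurableSet J)
    (h : ∀ r > 0, ∀ φ ∈ Set.Ioo (-π) π, (r * cos φ, r * sin φ) ∈ A ↔ φ ∈ J) :
    volume ({p : ℝ × ℝ | p.1 ^ 2 + p.2 ^ 2 < c} ∩ A) =
      (∫⁻ r in Set.Ioi (0 : ℝ), ENNReal.ofReal r * {r : ℝ | r ^ 2 < c}.indicator 1 r) *
        volume (J ∩ Set.Ioo (-π) π) := by
  classical
  have hD : MeasurableSet {p : ℝ × ℝ | p.1 ^ 2 + p.2 ^ 2 < c} :=
    measurableSet_lt (by fun_prop) (by fun_prop)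
  have hr : MeasurableSet {r : ℝ | r ^ 2 < c} := measurableSet_lt (by fun_prop) (by fun_prop)
  rw [← lintegral_indicator_one (hD.inter hA), ← lintegral_comp_polarCoord_symm,
    polarCoord_target, ← Measure.restrict_apply' measurableSet_Ioo,
    ← lintegral_indicator_one hJ, Measure.volume_eq_prod, ← Measure.prod_restrict,
    ← lintegral_prod_mul, Measure.prod_restrict]
  · refine setLIntegral_congr_fun (measurableSet_Ioi.prod measurableSet_Ioo) ?_
    rintro ⟨r, φ⟩ ⟨hr0, hφ⟩
    have hmem : (polarCoord.symm (r, φ) ∈ ({p : ℝ × ℝ | p.1 ^ 2 + p.2 ^ 2 < c} ∩ A)) ↔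
        (r ^ 2 < c ∧ φ ∈ J) := by
      have hnorm : (r * cos φ) ^ 2 + (r * sin φ) ^ 2 = r ^ 2 := by
        nlinarith [sin_sq_add_cos_sq φ]
      rw [polarCoord_symm_apply, Set.mem_inter_iff, h r hr0 φ hφ, Set.mem_ofPred_eq, hnorm]
    simp only [Set.indicator_apply, hmem]
    by_cases a : r ^ 2 < c <;> by_cases b : φ ∈ J <;> simp [a, b]
  · exact (ENNReal.measurable_ofReal.mul (measurable_one.indicator hr)).aemeasurable
  · exact (measurable_one.indicator hJ).aemeasurable

theorem exists_measurePreserving_euc_three :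
    ∃ Φ : Euc 3 ≃ᵐ ℝ × (ℝ × ℝ), MeasurePreserving Φ volume volume ∧
      ∀ x, Φ x = (x 2, (x 0, x 1)) := by
  refine ⟨(MeasurableEquiv.toLp 2 (Fin 3 → ℝ)).symm.trans
    ((MeasurableEquiv.piFinSuccAbove (fun _ => ℝ) 2).trans
      ((MeasurableEquiv.refl ℝ).prodCongr MeasurableEquiv.finTwoArrow)), ?_, fun _ => rfl⟩
  refine (EuclideanSpace.volume_preserving_symm_measurableEquiv_toLp (Fin 3)).trans
    ((volume_preserving_piFinSuccAbove (fun _ : Fin 3 => ℝ) 2).trans ?_)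
  exact (MeasurePreserving.id _).prod (volume_preserving_finTwoArrow ℝ)

theorem exists_volume_ball_inter_sector {ε : ℝ} (hε : 0 < ε) : ∃ G : ℝ≥0∞,
    ∀ (A : Set (ℝ × ℝ)) (J : Set ℝ), MeasurableSet A → MeasurableSet J →
    (∀ r > 0, ∀ φ ∈ Set.Ioo (-π) π, (r * cos φ, r * sin φ) ∈ A ↔ φ ∈ J) →
    volume (Metric.ball (0 : Euc 3) ε ∩ {x | (x 0, x 1) ∈ A}) =
      G * volume (J ∩ Set.Ioo (-π) π) := by
  refine ⟨∫⁻ t : ℝ, ∫⁻ r in Set.Ioi (0 : ℝ),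
    ENNReal.ofReal r * {r : ℝ | r ^ 2 < ε ^ 2 - t ^ 2}.indicator 1 r, fun A J hA hJ h => ?_⟩
  obtain ⟨Φ, hΦ, hΦx⟩ := exists_measurePreserving_euc_three
  set T : Set (ℝ × (ℝ × ℝ)) := {p | p.2.1 ^ 2 + p.2.2 ^ 2 < ε ^ 2 - p.1 ^ 2} ∩ Prod.snd ⁻¹' A
  have hpre : Metric.ball (0 : Euc 3) ε ∩ {x | (x 0, x 1) ∈ A} = Φ ⁻¹' T := by
    ext x
    rw [Set.mem_inter_iff, mem_ball_zero_iff, Set.mem_preimage, hΦx]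
    refine and_congr_left fun _ => ?_
    rw [EuclideanSpace.norm_eq, Real.sqrt_lt' hε, Fin.sum_univ_three, Set.mem_ofPred_eq,
      lt_sub_iff_add_lt]
    simp only [Real.norm_eq_abs, sq_abs]
  have hT : MeasurableSet T :=
    (measurableSet_lt (by fun_prop) (by fun_prop)).inter (measurable_snd hA)
  have hslice : ∀ t : ℝ, Prod.mk t ⁻¹' T =
      {p : ℝ × ℝ | p.1 ^ 2 + p.2 ^ 2 < ε ^ 2 - t ^ 2} ∩ A := fun t => rfl
  rw [hpre, hΦ.measure_preimage_equiv, Measure.volume_eq_prod, Measure.prod_apply hT]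
  simp only [hslice, volume_disc_inter_sector _ hA hJ h]
  exact lintegral_mul_const' _ _ (measure_lt_top_of_subset Set.inter_subset_right (by simp)).ne

theorem hasSolidAngle_sector {A : Set (ℝ × ℝ)} {J : Set ℝ} (hA : MeasurableSet A)
    (hJ : MeasurableSet J)
    (h : ∀ r > 0, ∀ φ ∈ Set.Ioo (-π) π, (r * cos φ, r * sin φ) ∈ A ↔ φ ∈ J) :
    HasSolidAngle {x : Euc 3 | (x 0, x 1) ∈ A} 0
      (volume.real (J ∩ Set.Ioo (-π) π) / (2 * π)) := by
  refine .of_eventually ?_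
  filter_upwards [self_mem_nhdsWithin] with ε hε
  obtain ⟨G, hG⟩ := exists_volume_ball_inter_sector hε
  have hball : volume.real (Metric.ball (0 : Euc 3) ε) = G.toReal * (2 * π) := by
    have := hG Set.univ Set.univ MeasurableSet.univ MeasurableSet.univ (by simp)
    simp only [Set.mem_univ, Set.ofPred_true, Set.inter_univ, Set.univ_inter, volume_Ioo] at this
    rw [Measure.real, this, ENNReal.toReal_mul, ENNReal.toReal_ofReal (by linarith [pi_pos])]
    ring
  have hG0 : G.toReal ≠ 0 := by
    rintro h0
    simpa [hball, h0] using volume_real_ball_pos (0 : Euc 3) hε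
  rw [ballRatio, hball, Measure.real, hG A J hA hJ h, ENNReal.toReal_mul, ← Measure.real,
    mul_div_mul_left _ _ hG0]

theorem mem_wedge_iff_le_angle {r ψ φ : ℝ} (hr : 0 < r) (h0 : 0 < ψ) (hπ : ψ < π)
    (hφ : φ ∈ Set.Ioo (-π) π) :
    (0 ≤ r * sin φ ∧ 0 ≤ cos ψ * (r * sin φ) - sin ψ * (r * cos φ)) ↔ ψ ≤ φ := by
  have hsub : cos ψ * (r * sin φ) - sin ψ * (r * cos φ) = r * sin (φ - ψ) := by
    rw [sin_sub]; ring
  rw [hsub, mul_nonneg_iff_of_pos_left hr, mul_nonneg_iff_of_pos_left hr]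
  refine ⟨fun ⟨hsin, hsin'⟩ => ?_, fun hle => ?_⟩
  · have hφ0 : 0 ≤ φ := by
      by_contra! hneg
      exact absurd (sin_neg_of_neg_of_neg_pi_lt hneg hφ.1) hsin.not_gt
    by_contra! hlt
    exact absurd (sin_neg_of_neg_of_neg_pi_lt (by linarith) (by linarith)) hsin'.not_gt
  · exact ⟨sin_nonneg_of_nonneg_of_le_pi (by linarith) hφ.2.le,
      sin_nonneg_of_nonneg_of_le_pi (by linarith) (by linarith [hφ.2])⟩

theorem hasSolidAngle_standard_wedge {ψ : ℝ} (h0 : 0 < ψ) (hπ : ψ < π) :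
    HasSolidAngle {x : Euc 3 | 0 ≤ x 1 ∧ 0 ≤ cos ψ * x 1 - sin ψ * x 0} 0
      ((π - ψ) / (2 * π)) := by
  have hJ : Set.Ici ψ ∩ Set.Ioo (-π) π = Set.Ico ψ π := by
    ext φ
    simp only [Set.mem_inter_iff, Set.mem_Ici, Set.mem_Ioo, Set.mem_Ico]
    exact ⟨fun h => ⟨h.1, h.2.2⟩, fun h => ⟨h.1, by linarith [h.1], h.2⟩⟩
  have hvol : volume.real (Set.Ici ψ ∩ Set.Ioo (-π) π) = π - ψ := by
    rw [hJ, volume_real_Ico_of_le hπ.le]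
  have hA : MeasurableSet {p : ℝ × ℝ | 0 ≤ p.2 ∧ 0 ≤ cos ψ * p.2 - sin ψ * p.1} :=
    (measurableSet_le (f := fun _ => (0 : ℝ)) (by fun_prop) (by fun_prop)).inter
      (measurableSet_le (f := fun _ => (0 : ℝ)) (by fun_prop) (by fun_prop))
  simpa only [hvol] using! hasSolidAngle_sector hA measurableSet_Ici fun r hr φ hφ =>
    mem_wedge_iff_le_angle hr h0 hπ hφ

theorem exists_orthonormalBasis_of_angle {m n : Euc 3} (hm : m ≠ 0) (hn : n ≠ 0)
    (h : sin (angle m n) ≠ 0) : ∃ b : OrthonormalBasis (Fin 3) ℝ (Euc 3),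
      ∀ x, ⟪m, x⟫ = ‖m‖ * b.repr x 1 ∧
        ⟪n, x⟫ = ‖n‖ * (cos (angle m n) * b.repr x 1 - sin (angle m n) * b.repr x 0) := by
  set ψ := angle m n with hψ
  have hm' : ‖m‖ ≠ 0 := norm_ne_zero_iff.2 hm
  have hn' : ‖n‖ ≠ 0 := norm_ne_zero_iff.2 hn
  set u : Euc 3 := ‖m‖⁻¹ • m with hu
  set v : Euc 3 := (sin ψ)⁻¹ • (cos ψ • u - ‖n‖⁻¹ • n) with hv
  have hvx : ∀ x, ⟪v, x⟫ = (sin ψ)⁻¹ * (cos ψ * ⟪u, x⟫ - ‖n‖⁻¹ * ⟪n, x⟫) := fun x => by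
    rw [hv, real_inner_smul_left, inner_sub_left, real_inner_smul_left, real_inner_smul_left n]
  have huu : ⟪u, u⟫ = 1 := by
    rw [hu, real_inner_smul_left, real_inner_smul_right, real_inner_self_eq_norm_sq]; field_simp
  have hun : ⟪u, n⟫ = cos ψ * ‖n‖ := by
    rw [hu, real_inner_smul_left, ← cos_angle_mul_norm_mul_norm m n, ← hψ]; field_simp
  have hvu : ⟪v, u⟫ = 0 := by
    rw [hvx, huu, real_inner_comm, hun]
    field_simp; ring
  have hvv : ⟪v, v⟫ = 1 := by
    rw [hvx, real_inner_comm, hvu, real_inner_comm, hvx, hun, real_inner_self_eq_norm_sq]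
    field_simp
    nlinarith [sin_sq_add_cos_sq ψ]
  have hon : Orthonormal ℝ (({0, 1} : Set (Fin 3)).domRestrict ![v, u, 0]) := by
    have huv : ⟪u, v⟫ = 0 := (real_inner_comm _ _).trans hvu
    rw [orthonormal_iff_ite]
    rintro ⟨i, rfl | rfl⟩ ⟨j, rfl | rfl⟩ <;>
      simp [-inner_self_eq_norm_sq_to_K, Subtype.ext_iff, huu, hvv, huv, hvu]
  obtain ⟨b, hb⟩ := hon.exists_orthonormalBasis_extension_of_card_eq (by simp)
  have hb0 : b 0 = v := by simpa using hb 0 (by simp)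
  have hb1 : b 1 = u := by simpa using hb 1 (by simp)
  refine ⟨b, fun x => ?_⟩
  rw [b.repr_apply_apply, b.repr_apply_apply, hb0, hb1, hvx, hu, real_inner_smul_left]
  constructor <;> field_simp
  ring

theorem hasSolidAngle_wedge {m n : Euc 3} (hm : m ≠ 0) (hn : n ≠ 0)
    (h0 : 0 < angle m n) (hπ : angle m n < π) :
    HasSolidAngle {x : Euc 3 | 0 ≤ ⟪m, x⟫ ∧ 0 ≤ ⟪n, x⟫} 0 ((π - angle m n) / (2 * π)) := by
  obtain ⟨b, hb⟩ := exists_orthonormalBasis_of_angle hm hn (sin_pos_of_pos_of_lt_pi h0 hπ).ne'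
  have himage :=
    (hasSolidAngle_standard_wedge h0 hπ).image_isometryEquiv b.repr.symm.toIsometryEquiv
  rw [show b.repr.symm.toIsometryEquiv 0 = 0 from map_zero b.repr.symm] at himage
  refine himage.congr one_pos fun y _ => ?_
  rw [Set.mem_ofPred_eq, (hb y).1, (hb y).2, mul_nonneg_iff_of_pos_left (norm_pos_iff.2 hm),
    mul_nonneg_iff_of_pos_left (norm_pos_iff.2 hn)]
  constructor
  · rintro ⟨z, hz, rfl⟩
    rwa [show b.repr (b.repr.symm.toIsometryEquiv z) = z from b.repr.apply_symm_apply z]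
  · exact fun hy => ⟨b.repr y, hy, b.repr.symm_apply_apply y⟩

end Wedge

section Averaging

variable {d : ℕ} {A : Set (Euc d)} {ι : Type*} {g : ι → Euc d ≃ᵢ Euc d} {k : ℕ}

/-- The copies `g i '' A` cover almost every point exactly `k` times. -/
def IsMultitiling (A : Set (Euc d)) (g : ι → Euc d ≃ᵢ Euc d) (k : ℕ) : Prop :=
  ∀ᵐ x : Euc d, {i | x ∈ g i '' A}.encard = k

/-- The Dehn functional: a `ℚ`-linear function of the solid angle, integrated over the points of the
space with respect to the one-dimensional measure. For a polyhedron and `f 1 = 0` only the edges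
contribute, and the value is the image of the Dehn invariant. -/
noncomputable def dehnIntegral (f : ℝ →ₗ[ℚ] ℝ) (A : Set (Euc d)) : ℝ :=
  ∫ x, f (solidAngle A x) ∂μH[1]

theorem sum_indicator_eq_ncard (J : Finset ι) (F : ι → Set (Euc d)) (x : Euc d) :
    ∑ i ∈ J, (F i).indicator (1 : Euc d → ℝ) x = ({i | i ∈ J ∧ x ∈ F i} : Set ι).ncard := by
  classical
  have hfilter : ({i | i ∈ J ∧ x ∈ F i} : Set ι) = (J.filter fun i => x ∈ F i : Finset ι) := by
    ext i; simp
  rw [hfilter, Set.ncard_coe_finset, Finset.card_filter]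
  push_cast
  exact Finset.sum_congr rfl fun i _ => by simp [Set.indicator_apply]

theorem IsMultitiling.sum_indicator_le (ht : IsMultitiling A g k) (J : Finset ι) :
    ∀ᵐ x : Euc d, ∑ i ∈ J, (g i '' A).indicator (1 : Euc d → ℝ) x ≤ k := by
  filter_upwards [ht] with x hx
  have hle : ({i | i ∈ J ∧ x ∈ g i '' A} : Set ι).ncard ≤ {i | x ∈ g i '' A}.ncard :=
    Set.ncard_le_ncard (fun i hi => hi.2) (Set.finite_of_encard_eq_coe hx)
  rw [sum_indicator_eq_ncard]
  exact_mod_cast hle.trans_eq (congrArg ENat.toNat hx)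

theorem IsMultitiling.sum_indicator_eq (ht : IsMultitiling A g k) {J : Finset ι} {B : Set (Euc d)}
    (hJ : ∀ i, (g i '' A ∩ B).Nonempty → i ∈ J) :
    ∀ᵐ x : Euc d, x ∈ B → ∑ i ∈ J, (g i '' A).indicator (1 : Euc d → ℝ) x = k := by
  filter_upwards [ht] with x hx hxB
  have hset : ({i | i ∈ J ∧ x ∈ g i '' A} : Set ι) = {i | x ∈ g i '' A} :=
    Set.ext fun i => ⟨fun h => h.2, fun h => ⟨hJ i ⟨x, h, hxB⟩, h⟩⟩
  rw [sum_indicator_eq_ncard, hset]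
  exact_mod_cast congrArg ENat.toNat hx

theorem setIntegral_sum_indicator (hm : MeasurableSet A) (hA : volume A ≠ ⊤) (J : Finset ι)
    (g : ι → Euc d ≃ᵢ Euc d) (B : Set (Euc d)) :
    ∫ x in B, ∑ i ∈ J, (g i '' A).indicator (1 : Euc d → ℝ) x =
      ∑ i ∈ J, volume.real (g i '' A ∩ B) := by
  have hmi := fun i => measurableSet_image_isometryEquiv hm (g i)
  rw [integral_finsetSum]
  · refine Finset.sum_congr rfl fun i _ => ?_
    rw [integral_indicator_one (hmi i), measureReal_restrict_apply (hmi i)]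
  · refine fun i _ => Integrable.integrableOn ((integrable_indicator_iff (hmi i)).2 ?_)
    exact integrableOn_const (by rwa [volume_image_isometryEquiv])

theorem IsMultitiling.card_mul_volume_le (ht : IsMultitiling A g k) (hm : MeasurableSet A)
    (hA : volume A ≠ ⊤) {x : Euc d} {r : ℝ} {J : Finset ι}
    (hJ : ∀ i ∈ J, g i '' A ⊆ Metric.ball x r) :
    J.card * volume.real A ≤ k * volume.real (Metric.ball x r) := by
  calc J.card * volume.real A = ∑ i ∈ J, volume.real (g i '' A ∩ Metric.ball x r) := by
        rw [Finset.sum_congr rfl fun i hi => by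
          rw [Set.inter_eq_left.2 (hJ i hi), volume_real_image_isometryEquiv], Finset.sum_const,
          nsmul_eq_mul]
    _ = ∫ y in Metric.ball x r, ∑ i ∈ J, (g i '' A).indicator (1 : Euc d → ℝ) y :=
        (setIntegral_sum_indicator hm hA J g _).symm
    _ ≤ ∫ _y in Metric.ball x r, (k : ℝ) :=
        integral_mono_of_nonneg (Eventually.of_forall fun y => Finset.sum_nonneg fun i _ =>
          Set.indicator_nonneg (fun _ _ => zero_le_one) _)
          (integrableOn_const measure_ball_lt_top.ne) (ae_restrict_of_ae (ht.sum_indicator_le J))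
    _ = k * volume.real (Metric.ball x r) := by simp [mul_comm]

theorem IsMultitiling.le_card_mul_volume (ht : IsMultitiling A g k) (hm : MeasurableSet A)
    (hA : volume A ≠ ⊤) {x : Euc d} {r : ℝ} {J : Finset ι}
    (hJ : ∀ i, (g i '' A ∩ Metric.ball x r).Nonempty → i ∈ J) :
    k * volume.real (Metric.ball x r) ≤ J.card * volume.real A := by
  calc k * volume.real (Metric.ball x r) = ∫ _y in Metric.ball x r, (k : ℝ) := by simp [mul_comm]
    _ = ∫ y in Metric.ball x r, ∑ i ∈ J, (g i '' A).indicator (1 : Euc d → ℝ) y :=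
        (setIntegral_congr_ae measurableSet_ball (ht.sum_indicator_eq hJ)).symm
    _ = ∑ i ∈ J, volume.real (g i '' A ∩ Metric.ball x r) := setIntegral_sum_indicator hm hA J g _
    _ ≤ ∑ _i ∈ J, volume.real A := Finset.sum_le_sum fun i _ => by
        rw [← volume_real_image_isometryEquiv (g i) A]
        exact measureReal_mono Set.inter_subset_left (by rwa [volume_image_isometryEquiv])
    _ = J.card * volume.real A := by rw [Finset.sum_const, nsmul_eq_mul]

theorem closure_image_subset_ball (hb : Bornology.IsBounded A) {g : Euc d ≃ᵢ Euc d} {x : Euc d}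
    {r : ℝ} (h : (g '' A ∩ Metric.ball x r).Nonempty) :
    closure (g '' A) ⊆ Metric.ball x (r + (Metric.diam A + 1)) := by
  obtain ⟨y, hyA, hyx⟩ := h
  have hbg : Bornology.IsBounded (closure (g '' A)) :=
    (g.isometry.lipschitz.isBounded_image hb).closure
  intro z hz
  have hzy : dist z y ≤ Metric.diam A := by
    rw [← g.isometry.diam_image, ← Metric.diam_closure]
    exact Metric.dist_le_diam_of_mem hbg hz (subset_closure hyA)
  rw [Metric.mem_ball] at hyx ⊢
  linarith [dist_triangle z y x]

theorem IsMultitiling.finite_setOf_meets_ball (ht : IsMultitiling A g k) (hm : MeasurableSet A)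
    (hb : Bornology.IsBounded A) (hv : volume A ≠ 0) (x : Euc d) (r : ℝ) :
    {i | (g i '' A ∩ Metric.ball x r).Nonempty}.Finite := by
  have hA : volume A ≠ ⊤ := hb.measure_lt_top.ne
  by_contra hinf
  obtain ⟨n, hn⟩ := exists_nat_gt
    (k * volume.real (Metric.ball x (r + (Metric.diam A + 1))) / volume.real A)
  obtain ⟨J, hJ, rfl⟩ := Set.Infinite.exists_subset_card_eq hinf n
  have hle := ht.card_mul_volume_le hm hA fun i hi =>
    subset_closure.trans (closure_image_subset_ball hb (hJ hi))
  exact hn.not_ge ((le_div_iff₀ (ENNReal.toReal_pos hv hA)).2 hle)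

theorem IsMultitiling.sum_solidAngle_eq (ht : IsMultitiling A g k) (hm : MeasurableSet A)
    (hw : ∀ x, HasSolidAngle A x (solidAngle A x)) {x : Euc d} {r : ℝ} (hr : 0 < r) {J : Finset ι}
    (hJ : ∀ i, (g i '' A ∩ Metric.ball x r).Nonempty → i ∈ J) :
    ∑ i ∈ J, solidAngle A ((g i).symm x) = k := by
  simpa only [one_mul] using sum_mul_eq_of_hasSolidAngle (x := x) J (fun i => g i '' A) (fun _ => 1)
    (fun i => solidAngle A ((g i).symm x)) k hr
    (fun i _ => measurableSet_image_isometryEquiv hm (g i))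
    (fun i _ => by simpa using (hw ((g i).symm x)).image_isometryEquiv (g i))
    (by simpa only [one_mul] using ht.sum_indicator_eq hJ)

theorem solidAngle_symm_eq_zero (hw : ∀ x, HasSolidAngle A x (solidAngle A x))
    {g : Euc d ≃ᵢ Euc d} {x : Euc d} (hx : x ∉ closure (g '' A)) :
    solidAngle A (g.symm x) = 0 := by
  have himage := (hw (g.symm x)).image_isometryEquiv g
  rw [g.apply_symm_apply] at himage
  exact tendsto_nhds_unique himage (hasSolidAngle_of_notMem_closure hx)

theorem integrable_comp_symm_isometryEquiv {h : Euc d → ℝ} (hInt : Integrable h μH[1])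
    (g : Euc d ≃ᵢ Euc d) : Integrable (fun x => h (g.symm x)) μH[1] :=
  ((g.symm.measurePreserving_hausdorffMeasure 1).integrable_comp_emb
    g.symm.toHomeomorph.measurableEmbedding).2 hInt

theorem integral_comp_symm_isometryEquiv (h : Euc d → ℝ) (g : Euc d ≃ᵢ Euc d) :
    ∫ x, h (g.symm x) ∂μH[1] = ∫ x, h x ∂μH[1] :=
  (g.symm.measurePreserving_hausdorffMeasure 1).integral_comp
    g.symm.toHomeomorph.measurableEmbedding h

/-- Inside the ball the angles of the copies in `I` add up to `k`, which `f` kills; outside of it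
only the copies that cross the sphere contribute. -/
theorem IsMultitiling.card_mul_abs_dehnIntegral_le (ht : IsMultitiling A g k)
    (hm : MeasurableSet A) (hw : ∀ x, HasSolidAngle A x (solidAngle A x)) {f : ℝ →ₗ[ℚ] ℝ}
    (hf : f 1 = 0) (hInt : Integrable (fun x => f (solidAngle A x)) μH[1]) {R : ℝ}
    {I J : Finset ι} (hI : ∀ i, (g i '' A ∩ Metric.ball 0 R).Nonempty → i ∈ I) (hJI : J ⊆ I)
    (hJ : ∀ i ∈ J, closure (g i '' A) ⊆ Metric.ball 0 R) :
    I.card * |dehnIntegral f A| ≤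
      ((I.card : ℝ) - J.card) * ∫ x, |f (solidAngle A x)| ∂μH[1] := by
  classical
  set h : ι → Euc d → ℝ := fun i x => f (solidAngle A ((g i).symm x))
  have hi : ∀ i, Integrable (h i) μH[1] := fun i => integrable_comp_symm_isometryEquiv hInt (g i)
  have hinside : ∀ x ∈ Metric.ball (0 : Euc d) R, ∑ i ∈ I, h i x = 0 := by
    intro x hx
    obtain ⟨r, hr, hrR⟩ := Metric.isOpen_iff.1 Metric.isOpen_ball x hx
    rw [← map_sum, ht.sum_solidAngle_eq hm hw hr fun i hne =>
      hI i (hne.mono (Set.inter_subset_inter_right _ hrR)), ← nsmul_one, map_nsmul, hf, smul_zero]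
  have hpoint : ∀ x, |∑ i ∈ I, h i x| ≤ ∑ i ∈ I \ J, |h i x| := by
    intro x
    by_cases hx : x ∈ Metric.ball (0 : Euc d) R
    · rw [hinside x hx, abs_zero]
      exact Finset.sum_nonneg fun i _ => abs_nonneg _
    · have houtside : ∑ i ∈ J, h i x = 0 := Finset.sum_eq_zero fun i hiJ => by
        simp only [h, solidAngle_symm_eq_zero hw fun hxi => hx (hJ i hiJ hxi), map_zero]
      rw [← Finset.sum_sdiff hJI, houtside, add_zero]
      exact Finset.abs_sum_le_sum_abs _ _
  calc I.card * |dehnIntegral f A| = |∑ i ∈ I, ∫ x, h i x ∂μH[1]| := by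
        rw [Finset.sum_congr rfl fun i _ =>
          integral_comp_symm_isometryEquiv (fun x => f (solidAngle A x)) (g i), Finset.sum_const,
          nsmul_eq_mul, abs_mul, Nat.abs_cast, dehnIntegral]
    _ = |∫ x, ∑ i ∈ I, h i x ∂μH[1]| := by rw [integral_finsetSum I fun i _ => hi i]
    _ ≤ ∫ x, |∑ i ∈ I, h i x| ∂μH[1] := abs_integral_le_integral_abs
    _ ≤ ∫ x, ∑ i ∈ I \ J, |h i x| ∂μH[1] := integral_mono
        (integrable_finsetSum I fun i _ => hi i).abs
        (integrable_finsetSum _ fun i _ => (hi i).abs) hpoint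
    _ = ∑ i ∈ I \ J, ∫ x, |h i x| ∂μH[1] := integral_finsetSum _ fun i _ => (hi i).abs
    _ = ((I.card : ℝ) - J.card) * ∫ x, |f (solidAngle A x)| ∂μH[1] := by
        rw [Finset.sum_congr rfl fun i _ =>
          integral_comp_symm_isometryEquiv (fun x => |f (solidAngle A x)|) (g i), Finset.sum_const,
          nsmul_eq_mul, Finset.card_sdiff_of_subset hJI, Nat.cast_sub (Finset.card_le_card hJI)]

theorem volume_real_ball_zero {r : ℝ} (hr : 0 < r) : volume.real (Metric.ball (0 : Euc d) r) =
    r ^ d * volume.real (Metric.ball (0 : Euc d) 1) := by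
  rw [Measure.real, Measure.addHaar_ball_of_pos _ _ hr, ENNReal.toReal_mul,
    ENNReal.toReal_ofReal (by positivity), finrank_euclideanSpace_fin, Measure.real]

theorem tendsto_add_pow_sub_sub_pow_div (δ : ℝ) (d : ℕ) :
    Tendsto (fun R : ℝ => ((R + δ) ^ d - (R - δ) ^ d) / R ^ d) atTop (𝓝 0) := by
  have hδ : Tendsto (fun R : ℝ => δ / R) atTop (𝓝 0) := tendsto_const_nhds.div_atTop tendsto_id
  have hlim : Tendsto (fun R : ℝ => (1 + δ / R) ^ d - (1 - δ / R) ^ d) atTop (𝓝 0) := by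
    simpa using ((hδ.const_add 1).pow d).sub ((hδ.const_sub 1).pow d)
  refine hlim.congr' ?_
  filter_upwards [eventually_gt_atTop 0] with R hR
  rw [sub_div, ← div_pow, ← div_pow, add_div, sub_div, div_self hR.ne']

theorem nonpos_of_pow_growth {n : ℝ → ℝ} {a D M δ : ℝ} (ha : 0 < a) (hδ : 0 ≤ δ) (hD : 0 ≤ D)
    (hM : 0 ≤ M) (hlower : ∀ R, 0 < R → a * R ^ d ≤ n R)
    (hupper : ∀ R, 0 < R → n R ≤ a * (R + δ) ^ d)
    (hcross : ∀ R, δ < R → n R * D ≤ (n R - n (R - δ)) * M) : D ≤ 0 := by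
  have hlim := (tendsto_add_pow_sub_sub_pow_div δ d).mul_const M
  rw [zero_mul] at hlim
  refine ge_of_tendsto hlim ((eventually_gt_atTop δ).mono fun R hR => ?_)
  have hR0 : 0 < R := hδ.trans_lt hR
  rw [div_mul_eq_mul_div, le_div_iff₀ (by positivity)]
  refine le_of_mul_le_mul_left ?_ ha
  calc a * (D * R ^ d) = a * R ^ d * D := by ring
    _ ≤ n R * D := mul_le_mul_of_nonneg_right (hlower R hR0) hD
    _ ≤ (n R - n (R - δ)) * M := hcross R hR
    _ ≤ (a * (R + δ) ^ d - a * (R - δ) ^ d) * M := mul_le_mul_of_nonneg_right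
        (sub_le_sub (hupper R hR0) (hlower _ (sub_pos.2 hR))) hM
    _ = a * (((R + δ) ^ d - (R - δ) ^ d) * M) := by ring

theorem IsMultitiling.dehnIntegral_eq_zero (ht : IsMultitiling A g k) (hk : 1 ≤ k)
    (hm : MeasurableSet A) (hb : Bornology.IsBounded A) (hv : volume A ≠ 0)
    (hw : ∀ x, HasSolidAngle A x (solidAngle A x)) {f : ℝ →ₗ[ℚ] ℝ} (hf : f 1 = 0)
    (hInt : Integrable (fun x => f (solidAngle A x)) μH[1]) : dehnIntegral f A = 0 := by
  set δ := Metric.diam A + 1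
  have hδ : 0 ≤ δ := add_nonneg Metric.diam_nonneg zero_le_one
  have hA : volume A ≠ ⊤ := hb.measure_lt_top.ne
  have hkc : 0 < k * volume.real (Metric.ball (0 : Euc d) 1) :=
    mul_pos (by exact_mod_cast hk) (volume_real_ball_pos 0 one_pos)
  set I : ℝ → Finset ι := fun R => (ht.finite_setOf_meets_ball hm hb hv 0 R).toFinset
  have hI : ∀ R i, i ∈ I R ↔ (g i '' A ∩ Metric.ball 0 R).Nonempty := fun R i => by simp [I]
  have hsub : ∀ R, ∀ i ∈ I R, closure (g i '' A) ⊆ Metric.ball 0 (R + δ) := fun R i hi =>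
    closure_image_subset_ball hb ((hI R i).1 hi)
  refine abs_nonpos_iff.1 <| nonpos_of_pow_growth (d := d)
    (n := fun R => volume.real A * (I R).card) hkc hδ (abs_nonneg _)
    (integral_nonneg (μ := μH[1]) fun x => abs_nonneg (f (solidAngle A x)))
    (fun R hR => ?_) (fun R hR => ?_) fun R _ => ?_
  · have h := ht.le_card_mul_volume hm hA fun i => (hI R i).2
    rw [volume_real_ball_zero hR] at h
    linarith
  · have h := ht.card_mul_volume_le hm hA fun i hi => subset_closure.trans (hsub R i hi)
    rw [volume_real_ball_zero (add_pos_of_pos_of_nonneg hR hδ)] at h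
    linarith
  · have h := ht.card_mul_abs_dehnIntegral_le hm hw hf hInt (fun i => (hI R i).2)
      (J := I (R - δ)) (fun i hi => (hI R i).2 (((hI _ i).1 hi).mono
        (Set.inter_subset_inter_right _ (Metric.ball_subset_ball (by linarith)))))
      (fun i hi => by simpa using hsub (R - δ) i hi)
    rw [← mul_sub, mul_assoc, mul_assoc]
    exact mul_le_mul_of_nonneg_left h measureReal_nonneg

end Averaging

theorem map_ratCast_eq_zero {f : ℝ →ₗ[ℚ] ℝ} (hf : f 1 = 0) (q : ℚ) : f q = 0 := by
  rw [show (q : ℝ) = q • (1 : ℝ) by simp [Rat.smul_def], map_smul, hf, smul_zero]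

section Polyhedron

variable {d : ℕ} {ι : Type*}

/-- The polyhedron with the inequalities `0 ≤ ⟪n i, x⟫ + c i`. -/
def polyhedron (n : ι → Euc d) (c : ι → ℝ) : Set (Euc d) := {x | ∀ i, 0 ≤ ⟪n i, x⟫ + c i}

/-- The cone with the inequalities `0 ≤ ⟪n i, x⟫`, `i ∈ I`: the tangent cone of a polyhedron at
a point where exactly the inequalities in `I` are tight. -/
def tangentCone (n : ι → Euc d) (I : Set ι) : Set (Euc d) := {x | ∀ i ∈ I, 0 ≤ ⟪n i, x⟫}

/-- The relatively open face of `polyhedron n c` on which exactly the inequalities in `I` are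
tight. -/
def polyhedronFace (n : ι → Euc d) (c : ι → ℝ) (I : Set ι) : Set (Euc d) :=
  {x | x ∈ polyhedron n c ∧ ∀ i, ⟪n i, x⟫ + c i = 0 ↔ i ∈ I}

variable (n : ι → Euc d) (c : ι → ℝ)

theorem convex_polyhedron : Convex ℝ (polyhedron n c) := by
  have hhalf : ∀ i, Convex ℝ {x : Euc d | 0 ≤ ⟪n i, x⟫ + c i} := fun i => by
    have hset : {x : Euc d | 0 ≤ ⟪n i, x⟫ + c i} = {x | -c i ≤ innerₛₗ ℝ (n i) x} :=
      Set.ext fun x => (neg_le_iff_add_nonneg (a := c i) (b := ⟪n i, x⟫)).symm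
    exact hset ▸ convex_halfSpace_ge (innerₛₗ ℝ (n i)).isLinear (-c i)
  rw [polyhedron, Set.ofPred_forall]
  exact convex_iInter hhalf

theorem isClosed_polyhedron : IsClosed (polyhedron n c) := by
  rw [polyhedron, Set.ofPred_forall]
  exact isClosed_iInter fun i => isClosed_le continuous_const (by fun_prop)

theorem hasSolidAngle_tangentCone (I : Set ι) :
    HasSolidAngle (tangentCone n I) 0 (solidAngle (tangentCone n I) 0) := by
  have hcone : tangentCone n I = polyhedron (fun i : I => n i) fun _ => 0 := by
    ext x; simp [tangentCone, polyhedron]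
  rw [hcone]
  exact hasSolidAngle_of_convex (convex_polyhedron _ _) (isClosed_polyhedron _ _) 0

theorem eventually_mem_polyhedron_iff [Finite ι] {x : Euc d} {I : Set ι}
    (hx : x ∈ polyhedronFace n c I) :
    ∀ᶠ y in 𝓝 x, (y ∈ polyhedron n c ↔ y - x ∈ tangentCone n I) := by
  have hslack : ∀ᶠ y in 𝓝 x, ∀ i, i ∉ I → 0 < ⟪n i, y⟫ + c i := by
    refine eventually_all.2 fun i => ?_
    by_cases hi : i ∈ I
    · simp [hi]
    have hpos : 0 < ⟪n i, x⟫ + c i := (hx.1 i).lt_of_ne' (mt (hx.2 i).1 hi)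
    have hcont : Continuous fun y => ⟪n i, y⟫ + c i := by fun_prop
    filter_upwards [hcont.continuousAt.eventually_const_lt hpos] with y hy _ using hy
  filter_upwards [hslack] with y hy
  have htight : ∀ i ∈ I, ⟪n i, y⟫ + c i = ⟪n i, y - x⟫ := fun i hi => by
    rw [inner_sub_right]; linarith [(hx.2 i).2 hi]
  refine ⟨fun h i hi => htight i hi ▸ h i, fun h i => ?_⟩
  by_cases hi : i ∈ I
  · exact (htight i hi).symm ▸ h i hi
  · exact (hy i hi).le

theorem solidAngle_polyhedron [Finite ι] {x : Euc d} {I : Set ι} (hx : x ∈ polyhedronFace n c I) :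
    solidAngle (polyhedron n c) x = solidAngle (tangentCone n I) 0 := by
  have htranslate := (hasSolidAngle_tangentCone n I).image_isometryEquiv (IsometryEquiv.addRight x)
  rw [IsometryEquiv.addRight_apply, zero_add] at htranslate
  obtain ⟨δ, hδ, hball⟩ := Metric.eventually_nhds_iff_ball.1 (eventually_mem_polyhedron_iff n c hx)
  refine (htranslate.congr hδ fun y hy => ?_).solidAngle_eq
  rw [hball y hy]
  exact ⟨by rintro ⟨z, hz, rfl⟩; simpa using hz, fun h => ⟨y - x, h, by simp⟩⟩

variable {n} in
theorem tangentCone_cases_of_forall_smul {I : Set ι} {m : Euc d}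
    (h : ∀ i ∈ I, ∃ t : ℝ, n i = t • m) :
    tangentCone n I = Set.univ ∨ tangentCone n I = {x | 0 ≤ ⟪m, x⟫} ∨
      tangentCone n I = {x | 0 ≤ ⟪-m, x⟫} ∨ tangentCone n I ⊆ {x | ⟪m, x⟫ = 0} := by
  choose! t ht using h
  have hmem : ∀ x, x ∈ tangentCone n I ↔ ∀ i ∈ I, 0 ≤ t i * ⟪m, x⟫ := fun x =>
    forall₂_congr fun i hi => by rw [ht i hi, real_inner_smul_left]
  by_cases hpos : ∃ i ∈ I, 0 < t i <;> by_cases hneg : ∃ j ∈ I, t j < 0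
  · obtain ⟨i, hi, hti⟩ := hpos
    obtain ⟨j, hj, htj⟩ := hneg
    refine .inr (.inr (.inr fun x hx => ?_))
    exact le_antisymm (nonpos_of_mul_nonneg_right ((hmem x).1 hx j hj) htj)
      (nonneg_of_mul_nonneg_right ((hmem x).1 hx i hi) hti)
  · obtain ⟨i, hi, hti⟩ := hpos
    push Not at hneg
    refine .inr (.inl (Set.ext fun x => (hmem x).trans ⟨fun h => ?_, fun h j hj => ?_⟩))
    · exact nonneg_of_mul_nonneg_right (h i hi) hti
    · exact mul_nonneg (hneg j hj) h
  · obtain ⟨j, hj, htj⟩ := hneg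
    push Not at hpos
    refine .inr (.inr (.inl (Set.ext fun x => (hmem x).trans ?_)))
    rw [Set.mem_ofPred_eq, inner_neg_left, neg_nonneg]
    exact ⟨fun h => nonpos_of_mul_nonneg_right (h j hj) htj,
      fun h i hi => mul_nonneg_of_nonpos_of_nonpos (hpos i hi) h⟩
  · push Not at hpos hneg
    refine .inl (Set.eq_univ_of_forall fun x => (hmem x).2 fun i hi => ?_)
    rw [le_antisymm (hpos i hi) (hneg i hi), zero_mul]

variable {n} in
theorem map_solidAngle_tangentCone_eq_zero {I : Set ι} {m : Euc d}
    (h : ∀ i ∈ I, ∃ t : ℝ, n i = t • m) {f : ℝ →ₗ[ℚ] ℝ} (hf : f 1 = 0) :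
    f (solidAngle (tangentCone n I) 0) = 0 := by
  have hhalf : f (1 / 2) = 0 := by simpa using map_ratCast_eq_zero hf (1 / 2)
  rcases eq_or_ne m 0 with rfl | hm
  · have huniv : tangentCone n I = Set.univ := Set.eq_univ_of_forall fun x i hi => by
      obtain ⟨t, ht⟩ := h i hi
      simp [ht]
    rw [huniv, (hasSolidAngle_univ 0).solidAngle_eq, hf]
  rcases tangentCone_cases_of_forall_smul h with hI | hI | hI | hI
  · rw [hI, (hasSolidAngle_univ 0).solidAngle_eq, hf]
  · rw [hI, (hasSolidAngle_halfSpace hm).solidAngle_eq, hhalf]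
  · rw [hI, (hasSolidAngle_halfSpace (neg_ne_zero.2 hm)).solidAngle_eq, hhalf]
  · have hnull : HasSolidAngle (tangentCone n I) 0 0 := by
      refine (hasSolidAngle_of_notMem_closure (A := ∅) (by simp)).congr_ae one_pos ?_
      filter_upwards [ae_inner_ne hm 0] with y hy _
      exact ⟨False.elim, fun h => hy (hI h)⟩
    rw [hnull.solidAngle_eq, map_zero]

theorem measurableSet_polyhedronFace [Finite ι] (I : Set ι) :
    MeasurableSet (polyhedronFace n c I) := by
  have htight : ∀ i, MeasurableSet {x : Euc d | ⟪n i, x⟫ + c i = 0 ↔ i ∈ I} := fun i => by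
    have hm : MeasurableSet {x : Euc d | ⟪n i, x⟫ + c i = 0} :=
      (isClosed_eq (by fun_prop) continuous_const).measurableSet
    by_cases hi : i ∈ I
    · simpa only [hi, iff_true] using hm
    · simpa only [hi, iff_false] using! hm.compl
  have hall := MeasurableSet.iInter htight
  rw [← Set.ofPred_forall] at hall
  exact (isClosed_polyhedron n c).measurableSet.inter hall

theorem map_solidAngle_polyhedron_eq_sum [Finite ι] (f : ℝ →ₗ[ℚ] ℝ) (x : Euc d) :
    f (solidAngle (polyhedron n c) x) = ∑ᶠ I : Set ι,
      (polyhedronFace n c I).indicator (fun _ => f (solidAngle (tangentCone n I) 0)) x := by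
  by_cases hx : x ∈ polyhedron n c
  · have hface : x ∈ polyhedronFace n c {i | ⟪n i, x⟫ + c i = 0} := ⟨hx, fun i => Iff.rfl⟩
    rw [finsum_eq_single _ {i | ⟪n i, x⟫ + c i = 0}, Set.indicator_of_mem hface,
      solidAngle_polyhedron n c hface]
    exact fun I hI => Set.indicator_of_notMem
      (fun hxI => hI (Set.ext fun i => (hxI.2 i).symm)) _
  · rw [solidAngle_eq_zero_of_notMem (isClosed_polyhedron n c) hx, map_zero,
      finsum_eq_zero_of_forall_eq_zero fun I => Set.indicator_of_notMem (fun hxI => hx hxI.1) _]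

end Polyhedron

section Edges

variable {ι : Type*}

theorem exists_forall_eq_smul_of_linearIndependent {m n : Euc 3}
    (h : LinearIndependent ℝ ![m, n]) :
    ∃ u : Euc 3, u ≠ 0 ∧ ∀ y, ⟪m, y⟫ = 0 → ⟪n, y⟫ = 0 → ∃ t : ℝ, y = t • u := by
  set W := Submodule.span ℝ (Set.range ![m, n])
  have hW : Module.finrank ℝ W = 2 := (finrank_span_eq_card h).trans (Fintype.card_fin 2)
  have hsum := W.finrank_add_finrank_orthogonal
  rw [hW, finrank_euclideanSpace_fin] at hsum
  obtain ⟨u, hu0, hu⟩ := finrank_eq_one_iff'.1 (Nat.add_left_cancel hsum : Module.finrank ℝ Wᗮ = 1)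
  refine ⟨u, fun h0 => hu0 (Subtype.ext h0), fun y hm hn => ?_⟩
  have hy : y ∈ Wᗮ := by
    rw [← Submodule.span_singleton_le_iff_mem, ← Submodule.isOrtho_iff_le,
      Submodule.isOrtho_comm, Submodule.isOrtho_span]
    rintro _ ⟨i, rfl⟩ _ rfl
    fin_cases i
    exacts [hm, hn]
  obtain ⟨t, ht⟩ := hu ⟨y, hy⟩
  exact ⟨t, (congrArg Subtype.val ht).symm⟩

theorem hausdorffMeasure_lt_top_of_subset_line {d : ℕ} {T : Set (Euc d)}
    (hT : Bornology.IsBounded T) {u : Euc d} (hu : u ≠ 0)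
    (h : ∀ x ∈ T, ∀ y ∈ T, ∃ t : ℝ, y - x = t • u) : μH[1] T < ⊤ := by
  rcases T.eq_empty_or_nonempty with rfl | ⟨x, hx⟩
  · simp
  obtain ⟨R, hR⟩ := hT.subset_ball x
  have hlip : LipschitzWith ‖u‖₊ fun t : ℝ => x + t • u := .of_dist_le_mul fun s t => by
    rw [dist_add_left, dist_eq_norm, ← sub_smul, norm_smul, mul_comm, coe_nnnorm, dist_eq_norm]
  have hsub : T ⊆ (fun t : ℝ => x + t • u) '' Set.Icc (-(R / ‖u‖)) (R / ‖u‖) := by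
    intro y hy
    obtain ⟨t, ht⟩ := h x hx y hy
    refine ⟨t, abs_le.1 ?_, by simp only [← ht, add_sub_cancel]⟩
    rw [le_div_iff₀ (norm_pos_iff.2 hu), ← Real.norm_eq_abs, ← norm_smul, ← ht]
    exact (mem_ball_iff_norm.1 (hR hy)).le
  refine (measure_mono hsub).trans_lt ((hlip.hausdorffMeasure_image_le zero_le_one _).trans_lt ?_)
  rw [hausdorffMeasure_real, Real.volume_Icc]
  exact ENNReal.mul_lt_top (by simp) ENNReal.ofReal_lt_top

theorem hausdorffMeasure_polyhedronFace_lt_top {n : ι → Euc 3} {c : ι → ℝ}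
    (hb : Bornology.IsBounded (polyhedron n c)) {I : Set ι} {i j : ι} (hi : i ∈ I) (hj : j ∈ I)
    (hij : LinearIndependent ℝ ![n i, n j]) : μH[1] (polyhedronFace n c I) < ⊤ := by
  obtain ⟨u, hu0, hu⟩ := exists_forall_eq_smul_of_linearIndependent hij
  have htight : ∀ l ∈ I, ∀ x ∈ polyhedronFace n c I, ∀ y ∈ polyhedronFace n c I,
      ⟪n l, y - x⟫ = 0 := fun l hl x hx y hy => by
    rw [inner_sub_right]; linarith [(hx.2 l).2 hl, (hy.2 l).2 hl]
  exact hausdorffMeasure_lt_top_of_subset_line (hb.subset fun x hx => hx.1) hu0 fun x hx y hy =>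
    hu _ (htight i hi x hx y hy) (htight j hj x hx y hy)

theorem integrable_map_solidAngle_polyhedron [Finite ι] {n : ι → Euc 3} {c : ι → ℝ}
    (hb : Bornology.IsBounded (polyhedron n c)) {f : ℝ →ₗ[ℚ] ℝ} (hf : f 1 = 0) :
    Integrable (fun x => f (solidAngle (polyhedron n c) x)) (μH[1] : Measure (Euc 3)) := by
  have := Fintype.ofFinite (Set ι)
  simp only [map_solidAngle_polyhedron_eq_sum n c f, finsum_eq_sum_of_fintype]
  refine integrable_finsetSum _ fun I _ => ?_
  by_cases hz : f (solidAngle (tangentCone n I) 0) = 0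
  · simp [hz]
  obtain ⟨i, hi, hi0⟩ : ∃ i ∈ I, n i ≠ 0 := by
    by_contra! hall
    exact hz (map_solidAngle_tangentCone_eq_zero (m := 0) (fun i hi => ⟨0, by simp [hall i hi]⟩) hf)
  obtain ⟨j, hj, hij⟩ : ∃ j ∈ I, ∀ t : ℝ, n j ≠ t • n i := by
    by_contra! hall
    exact hz (map_solidAngle_tangentCone_eq_zero hall hf)
  rw [integrable_indicator_iff (measurableSet_polyhedronFace n c I)]
  exact integrableOn_const (hausdorffMeasure_polyhedronFace_lt_top hb hi hj
    ((LinearIndependent.pair_iff' hi0).2 fun t => (hij t).symm)).ne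

end Edges

section Elimination

variable {d : ℕ} {S : Set (Euc d)}

/-- A finite intersection of half-spaces. -/
def IsPolyhedron (S : Set (Euc d)) : Prop :=
  ∃ (ι : Type) (_ : Finite ι) (n : ι → Euc d) (c : ι → ℝ), S = polyhedron n c

theorem IsPolyhedron.convex (h : IsPolyhedron S) : Convex ℝ S := by
  obtain ⟨ι, _, n, c, rfl⟩ := h
  exact convex_polyhedron n c

theorem IsPolyhedron.isClosed (h : IsPolyhedron S) : IsClosed S := by
  obtain ⟨ι, _, n, c, rfl⟩ := h
  exact isClosed_polyhedron n c

theorem IsPolyhedron.hasSolidAngle (h : IsPolyhedron S) (x : Euc d) :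
    HasSolidAngle S x (solidAngle S x) :=
  hasSolidAngle_of_convex h.convex h.isClosed x

theorem IsPolyhedron.integrable {S : Set (Euc 3)} (h : IsPolyhedron S)
    (hb : Bornology.IsBounded S) {f : ℝ →ₗ[ℚ] ℝ} (hf : f 1 = 0) :
    Integrable (fun x => f (solidAngle S x)) (μH[1] : Measure (Euc 3)) := by
  obtain ⟨ι, _, n, c, rfl⟩ := h
  exact integrable_map_solidAngle_polyhedron hb hf

theorem mem_add_segment_iff {v x : Euc d} :
    x ∈ S + segment ℝ 0 v ↔ ∃ t : ℝ, 0 ≤ t ∧ t ≤ 1 ∧ x - t • v ∈ S := by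
  rw [Set.mem_add]
  simp only [segment_eq_image', sub_zero, zero_add, Set.mem_image, Set.mem_Icc]
  constructor
  · rintro ⟨s, hs, _, ⟨t, ht, rfl⟩, rfl⟩
    exact ⟨t, ht.1, ht.2, by simpa using hs⟩
  · rintro ⟨t, h0, h1, ht⟩
    exact ⟨_, ht, _, ⟨t, ⟨h0, h1⟩, rfl⟩, by simp⟩

theorem exists_forall_nonneg_mul_add {J : Type*} [Finite J] (a b : J → ℝ)
    (h0 : ∀ j, a j = 0 → 0 ≤ b j)
    (h1 : ∀ j k, 0 < a j → a k < 0 → 0 ≤ a j * b k - a k * b j) :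
    ∃ t : ℝ, ∀ j, 0 ≤ a j * t + b j := by
  set L : Set ℝ := (fun j => -b j / a j) '' {j | 0 < a j}
  set U : Set ℝ := (fun j => -b j / a j) '' {j | a j < 0}
  have hLU : ∀ l ∈ L, ∀ u ∈ U, l ≤ u := by
    rintro _ ⟨j, hj, rfl⟩ _ ⟨k, hk, rfl⟩
    have hjk := h1 j k hj hk
    rw [Set.mem_ofPred_eq] at hj hk
    beta_reduce
    rw [← neg_div_neg_eq (-b k), div_le_div_iff₀ hj (neg_pos.2 hk)]
    linarith
  obtain ⟨t, htL, htU⟩ : ∃ t, (∀ l ∈ L, l ≤ t) ∧ ∀ u ∈ U, t ≤ u := by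
    rcases L.eq_empty_or_nonempty with hL | hL
    · obtain ⟨t, ht⟩ := (Set.toFinite U).bddBelow
      exact ⟨t, by simp [hL], fun u hu => ht hu⟩
    · exact ⟨sSup L, fun l hl => le_csSup (Set.toFinite L).bddAbove hl,
        fun u hu => csSup_le hL fun l hl => hLU l hl u hu⟩
  refine ⟨t, fun j => ?_⟩
  rcases lt_trichotomy (a j) 0 with hj | hj | hj
  · have hle : t ≤ -b j / a j := htU _ ⟨j, hj, rfl⟩
    rw [le_div_iff_of_neg hj] at hle
    linarith
  · rw [hj]; simpa using h0 j hj
  · have hle : -b j / a j ≤ t := htL _ ⟨j, hj, rfl⟩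
    rw [div_le_iff₀ hj] at hle
    linarith

/-- Fourier–Motzkin elimination of `t`. -/
theorem isPolyhedron_of_exists {J : Type} [Finite J] (a e : J → ℝ) (m : J → Euc d)
    (h : ∀ x, x ∈ S ↔ ∃ t : ℝ, ∀ j, 0 ≤ a j * t + (⟪m j, x⟫ + e j)) : IsPolyhedron S := by
  refine ⟨{j // a j = 0} ⊕ ({j // 0 < a j} × {k // a k < 0}), inferInstance,
    Sum.elim (fun j => m j) (fun p => a p.1 • m p.2 - a p.2 • m p.1),
    Sum.elim (fun j => e j) (fun p => a p.1 * e p.2 - a p.2 * e p.1), ?_⟩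
  ext x
  rw [h]
  simp only [polyhedron, Set.mem_ofPred_eq, Sum.forall, Sum.elim_inl, Sum.elim_inr, Prod.forall,
    Subtype.forall, inner_sub_left, real_inner_smul_left]
  constructor
  · rintro ⟨t, ht⟩
    refine ⟨fun j hj => by simpa [hj] using ht j, fun j hj k hk => ?_⟩
    linarith [mul_nonneg hj.le (ht k), mul_nonneg (neg_nonneg.2 hk.le) (ht j)]
  · rintro ⟨h0, h1⟩
    exact exists_forall_nonneg_mul_add a _ h0 fun j k hj hk => by linarith [h1 j hj k hk]

theorem IsPolyhedron.add_segment (h : IsPolyhedron S) (v : Euc d) :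
    IsPolyhedron (S + segment ℝ 0 v) := by
  obtain ⟨ι, _, n, c, rfl⟩ := h
  refine isPolyhedron_of_exists (J := ι ⊕ Bool)
    (Sum.elim (fun i => -⟪n i, v⟫) fun b => bif b then 1 else -1)
    (Sum.elim c fun b => bif b then 0 else 1) (Sum.elim n fun _ => 0) fun x => ?_
  rw [mem_add_segment_iff]
  refine exists_congr fun t => ?_
  simp only [Sum.forall, Bool.forall_bool, Sum.elim_inl, Sum.elim_inr, cond_true,
    cond_false, inner_zero_left, polyhedron, Set.mem_ofPred_eq, inner_sub_right,
    real_inner_smul_right]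
  constructor
  · rintro ⟨h0, h1, h2⟩
    exact ⟨fun i => by linarith [h2 i], by linarith, by linarith⟩
  · rintro ⟨h2, h1, h0⟩
    exact ⟨by linarith, by linarith, fun i => by linarith [h2 i]⟩

end Elimination

section Lattice

theorem tsum_eq_tsum_quotient {G K : Type*} [AddCommGroup G] [AddCommGroup K] {φ : K →+ G}
    (hφ : Function.Injective φ) {h : G → ℝ≥0∞} (hh : ∀ r, ∑' k, h (r + φ k) = 1) :
    ∑' z, h z = ∑' _ : G ⧸ φ.range, 1 := by
  rw [← ENNReal.tsum_fiberwise h (QuotientAddGroup.mk : G → G ⧸ φ.range)]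
  refine tsum_congr fun q => ?_
  obtain ⟨r, rfl⟩ := QuotientAddGroup.mk_surjective q
  have hfiber : (QuotientAddGroup.mk : G → G ⧸ φ.range) ⁻¹' {QuotientAddGroup.mk r} =
      Set.range fun k => r + φ k := by
    ext z
    rw [Set.mem_preimage, Set.mem_singleton_iff, eq_comm, QuotientAddGroup.eq]
    exact exists_congr fun k => eq_neg_add_iff_add_eq
  have hinj : Function.Injective fun k => r + φ k := (add_right_injective r).comp hφ
  rw [hfiber, tsum_range h hinj, hh r]

/-- The integer lattice as a group. -/
abbrev latticeGroup (d : ℕ) : AddSubgroup (Euc d) :=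
  (Submodule.span ℤ (Set.range (EuclideanSpace.basisFun (Fin d) ℝ).toBasis)).toAddSubgroup

variable {d : ℕ}

theorem mem_latticeGroup {x : Euc d} : x ∈ latticeGroup d ↔ x ∈ integerLattice d := by
  rw [latticeGroup, Submodule.mem_toAddSubgroup, Module.Basis.mem_span_iff_repr_mem]
  exact forall_congr' fun i => by simp [eq_comm]

instance : Countable (latticeGroup d) := inferInstanceAs (Countable
  (Submodule.span ℤ (Set.range (EuclideanSpace.basisFun (Fin d) ℝ).toBasis)))

theorem lintegral_eq_setLIntegral_tsum_latticeGroup {f : Euc d → ℝ≥0∞} (hf : Measurable f) :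
    ∫⁻ x, f x = ∫⁻ x in ZSpan.fundamentalDomain (EuclideanSpace.basisFun (Fin d) ℝ).toBasis,
      ∑' z : latticeGroup d, f (z + x) := by
  rw [(ZSpan.isAddFundamentalDomain' (EuclideanSpace.basisFun (Fin d) ℝ).toBasis
    volume).lintegral_eq_tsum'', ← lintegral_tsum]
  · rfl
  · exact fun z => (hf.comp (measurable_const_add _)).aemeasurable

theorem volume_fundamentalDomain_basisFun (d : ℕ) :
    volume (ZSpan.fundamentalDomain (EuclideanSpace.basisFun (Fin d) ℝ).toBasis) = 1 := by
  rw [measure_congr (ZSpan.fundamentalDomain_ae_parallelepiped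
    (EuclideanSpace.basisFun (Fin d) ℝ).toBasis volume), OrthonormalBasis.coe_toBasis]
  exact OrthonormalBasis.volume_parallelepiped _

theorem lintegral_eq_of_forall_tsum_latticeGroup_eq {f : Euc d → ℝ≥0∞} (hf : Measurable f)
    {N : ℝ≥0∞} (h : ∀ᵐ x, ∑' z : latticeGroup d, f (z + x) = N) : ∫⁻ x, f x = N := by
  rw [lintegral_eq_setLIntegral_tsum_latticeGroup hf, lintegral_congr_ae (ae_restrict_of_ae h),
    setLIntegral_const, volume_fundamentalDomain_basisFun, mul_one]

variable {S : Set (Euc d)}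

theorem finite_inter_integerLattice (hb : Bornology.IsBounded S) : (S ∩ integerLattice d).Finite :=
  (ZSpan.setFinite_inter (EuclideanSpace.basisFun (Fin d) ℝ).toBasis hb).subset fun _ hx =>
    ⟨hx.1, mem_latticeGroup.2 hx.2⟩

theorem discreteVolume_nonneg (h0 : ∀ x, 0 ≤ solidAngle S x) : 0 ≤ discreteVolume S :=
  finsum_nonneg fun x => finsum_nonneg fun _ => h0 x

theorem tsum_ofReal_solidAngle (hc : IsClosed S) (hb : Bornology.IsBounded S)
    (h0 : ∀ x, 0 ≤ solidAngle S x) :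
    ∑' z : latticeGroup d, ENNReal.ofReal (solidAngle S z) =
      ENNReal.ofReal (discreteVolume S) := by
  have hfin := finite_inter_integerLattice hb
  calc ∑' z : latticeGroup d, ENNReal.ofReal (solidAngle S z)
      = ∑' z : integerLattice d, ENNReal.ofReal (solidAngle S z) :=
        (Equiv.setCongr (Set.ext fun x => mem_latticeGroup)).tsum_eq
          fun z : integerLattice d => ENNReal.ofReal (solidAngle S z)
    _ = ∑' z, (integerLattice d).indicator (fun z => ENNReal.ofReal (solidAngle S z)) z :=
        tsum_subtype _ fun z => ENNReal.ofReal (solidAngle S z)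
    _ = ∑ z ∈ hfin.toFinset, ENNReal.ofReal (solidAngle S z) := by
        rw [tsum_eq_sum (s := hfin.toFinset)]
        · exact Finset.sum_congr rfl fun z hz =>
            Set.indicator_of_mem ((Set.Finite.mem_toFinset _).1 hz).2 _
        intro z hz
        rw [Set.indicator_apply_eq_zero]
        intro hzL
        rw [solidAngle_eq_zero_of_notMem hc fun hzS =>
          hz ((Set.Finite.mem_toFinset _).2 ⟨hzS, hzL⟩), ENNReal.ofReal_zero]
    _ = ENNReal.ofReal (discreteVolume S) := by
        rw [discreteVolume, finsum_mem_eq_finite_toFinset_sum _ hfin,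
          ENNReal.ofReal_sum_of_nonneg fun z _ => h0 z]

end Lattice

section Multitiling

variable {d : ℕ} {A : Set (Euc d)} {ι : Type*} {g : ι → Euc d ≃ᵢ Euc d} {k : ℕ}

theorem IsMultitiling.volume_ne_zero [Countable ι] (ht : IsMultitiling A g k) (hk : k ≠ 0) :
    volume A ≠ 0 := by
  intro h0
  have hnot : ∀ᵐ x : Euc d, ∀ i, x ∉ g i '' A := ae_all_iff.2 fun i => by
    rw [← measure_eq_zero_iff_ae_notMem, volume_image_isometryEquiv, h0]
  obtain ⟨x, hx, hxk⟩ := (hnot.and ht).exists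
  exact hk (by simpa [hx, eq_comm] using hxk)

theorem IsMultitiling.tsum_solidAngle_eq (ht : IsMultitiling A g k) (hm : MeasurableSet A)
    (hb : Bornology.IsBounded A) (hv : volume A ≠ 0)
    (hw : ∀ x, HasSolidAngle A x (solidAngle A x)) (x : Euc d) :
    ∑' i, ENNReal.ofReal (solidAngle A ((g i).symm x)) = k := by
  have hfin := ht.finite_setOf_meets_ball hm hb hv x 1
  have hsum := ht.sum_solidAngle_eq hm hw one_pos fun i => hfin.mem_toFinset.2
  rw [tsum_eq_sum (s := hfin.toFinset), ← ENNReal.ofReal_sum_of_nonneg fun i _ => (hw _).nonneg,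
    hsum, ENNReal.ofReal_natCast]
  intro i hi
  have hclosure : x ∉ closure (g i '' A) := fun hx => hi <| hfin.mem_toFinset.2 <| by
    obtain ⟨y, hy, hyA⟩ := mem_closure_iff.1 hx _ Metric.isOpen_ball (Metric.mem_ball_self one_pos)
    exact ⟨y, hyA, hy⟩
  rw [solidAngle_symm_eq_zero hw hclosure, ENNReal.ofReal_zero]

theorem isMultitiling_one_iff :
    IsMultitiling A g 1 ↔ ∀ᵐ x : Euc d, ∃! i, (g i).symm x ∈ A := by
  refine Filter.eventually_congr (.of_forall fun x => ?_)
  have hmem : ∀ i, x ∈ g i '' A ↔ (g i).symm x ∈ A := fun i => by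
    rw [← IsometryEquiv.coe_toEquiv, Equiv.image_eq_preimage_symm]; rfl
  simp only [hmem, Nat.cast_one, Set.encard_eq_one, Set.eq_singleton_iff_unique_mem,
    Set.mem_ofPred_eq]
  rfl

end Multitiling

section PointSymmetric

variable {d : ℕ} {A : Set (Euc d)} {K : Type*} [AddCommGroup K] {κ : Euc d}
  {φ : K →+ latticeGroup d}

/-- The isometries `x ↦ x - φ m` and `x ↦ κ - φ m - x`, which move a set to the cells of a
lattice tiling by the set and its point reflection. -/
noncomputable def tilingIsometry (κ : Euc d) (φ : K →+ latticeGroup d) (i : Bool × K) :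
    Euc d ≃ᵢ Euc d :=
  bif i.1 then IsometryEquiv.subRight (φ i.2 : Euc d) else IsometryEquiv.subLeft (κ - φ i.2)

theorem tilingIsometry_symm_true (m : K) (x : Euc d) :
    (tilingIsometry κ φ (true, m)).symm x = x + φ m := rfl

theorem tilingIsometry_symm_false (m : K) (x : Euc d) :
    (tilingIsometry κ φ (false, m)).symm x = κ - (x + φ m) := by
  rw [IsometryEquiv.symm_apply_eq]
  simp [tilingIsometry]

theorem tsum_latticeGroup_add_reflect_eq (hφ : Function.Injective φ) {F : Euc d → ℝ≥0∞}
    {x : Euc d}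
    (hF : ∀ r : latticeGroup d, ∑' i, F ((tilingIsometry κ φ i).symm (r + x)) = 1) :
    ∑' z : latticeGroup d, (F (z + x) + F (κ - (z + x))) =
      ∑' _ : latticeGroup d ⧸ φ.range, 1 := by
  refine tsum_eq_tsum_quotient hφ (h := fun z => F (z + x) + F (κ - (z + x))) fun r => ?_
  have hcomm : ∀ m, ((r + φ m : latticeGroup d) : Euc d) + x = r + x + φ m := fun m => by
    push_cast; abel
  simp only [hcomm]
  rw [← hF r, ENNReal.tsum_prod', tsum_bool, ENNReal.tsum_add, add_comm]
  simp only [tilingIsometry_symm_true, tilingIsometry_symm_false]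

theorem IsMultitiling.two_mul_volume_eq (ht : IsMultitiling A (tilingIsometry κ φ) 1)
    (hm : MeasurableSet A) (hφ : Function.Injective φ) :
    2 * volume A = ∑' _ : latticeGroup d ⧸ φ.range, 1 := by
  set F : Euc d → ℝ≥0∞ := A.indicator 1
  have hF : Measurable F := measurable_one.indicator hm
  have hvol : ∫⁻ x, F x = volume A := lintegral_indicator_one hm
  have hrefl : ∫⁻ x, F (κ - x) = volume A := (lintegral_sub_left_eq_self _ κ).trans hvol
  have hadd : 2 * volume A = ∫⁻ x, (F x + F (κ - x)) := by
    rw [lintegral_add_left hF, hvol, hrefl, two_mul]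
  rw [hadd]
  refine lintegral_eq_of_forall_tsum_latticeGroup_eq
    (hF.add (hF.comp (measurable_const_sub κ))) ?_
  have hall : ∀ᵐ x : Euc d, ∀ r : latticeGroup d,
      ∃! i, (tilingIsometry κ φ i).symm (r + x) ∈ A := ae_all_iff.2 fun r =>
    (measurePreserving_add_left volume (r : Euc d)).quasiMeasurePreserving.ae
      (isMultitiling_one_iff.1 ht)
  filter_upwards [hall] with x hx
  refine tsum_latticeGroup_add_reflect_eq hφ fun r => ?_
  obtain ⟨i, hi, hu⟩ := hx r
  rw [tsum_eq_single i fun j hj => Set.indicator_of_notMem (fun hjA => hj (hu j hjA)) _]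
  exact Set.indicator_of_mem hi _

theorem IsMultitiling.two_mul_tsum_solidAngle_eq (ht : IsMultitiling A (tilingIsometry κ φ) 1)
    (hm : MeasurableSet A) (hb : Bornology.IsBounded A) (hv : volume A ≠ 0)
    (hw : ∀ x, HasSolidAngle A x (solidAngle A x)) (hκ : κ ∈ integerLattice d)
    (hφ : Function.Injective φ) :
    2 * ∑' z : latticeGroup d, ENNReal.ofReal (solidAngle A z) =
      ∑' _ : latticeGroup d ⧸ φ.range, 1 := by
  have hrefl : ∑' z : latticeGroup d, ENNReal.ofReal (solidAngle A (κ - z)) =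
      ∑' z : latticeGroup d, ENNReal.ofReal (solidAngle A z) :=
    (Equiv.subLeft (⟨κ, mem_latticeGroup.2 hκ⟩ : latticeGroup d)).tsum_eq
      fun z : latticeGroup d => ENNReal.ofReal (solidAngle A z)
  have hsum := tsum_latticeGroup_add_reflect_eq (κ := κ) (x := 0) hφ
    (F := fun y => ENNReal.ofReal (solidAngle A y)) fun r => by
      simpa using ht.tsum_solidAngle_eq hm hb hv hw (r + 0)
  simp only [add_zero] at hsum
  rw [← hsum, ENNReal.tsum_add, hrefl, two_mul]

theorem IsMultitiling.tsum_solidAngle_eq_volume [Countable K]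
    (ht : IsMultitiling A (tilingIsometry κ φ) 1) (hm : MeasurableSet A)
    (hb : Bornology.IsBounded A) (hw : ∀ x, HasSolidAngle A x (solidAngle A x))
    (hκ : κ ∈ integerLattice d) (hφ : Function.Injective φ) :
    ∑' z : latticeGroup d, ENNReal.ofReal (solidAngle A z) = volume A := by
  have hv := ht.volume_ne_zero one_ne_zero
  exact (ENNReal.mul_right_inj two_ne_zero ENNReal.ofNat_ne_top).1
    ((ht.two_mul_tsum_solidAngle_eq hm hb hv hw hκ hφ).trans (ht.two_mul_volume_eq hm hφ).symm)

end PointSymmetric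

section Difference

variable {d : ℕ} {A B : Set (Euc d)}

theorem IsPolyhedron.hasSolidAngle_sdiff (hA : IsPolyhedron A) (hB : IsPolyhedron B) (hAB : A ⊆ B)
    (x : Euc d) : HasSolidAngle (B \ A) x (solidAngle B x - solidAngle A x) :=
  HasSolidAngle.sdiff hA.isClosed.measurableSet hAB (hA.hasSolidAngle x) (hB.hasSolidAngle x)

theorem IsPolyhedron.solidAngle_sdiff (hA : IsPolyhedron A) (hB : IsPolyhedron B) (hAB : A ⊆ B)
    (x : Euc d) : solidAngle (B \ A) x = solidAngle B x - solidAngle A x :=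
  (hA.hasSolidAngle_sdiff hB hAB x).solidAngle_eq

variable {K : Type*} [AddCommGroup K] [Countable K] {κ : Euc d} {φ : K →+ latticeGroup d}

theorem IsConcrete.of_isMultitiling_sdiff (hc : IsConcrete A) (hA : IsPolyhedron A)
    (hB : IsPolyhedron B) (hAB : A ⊆ B) (hb : Bornology.IsBounded B) (hκ : κ ∈ integerLattice d)
    (hφ : Function.Injective φ) (ht : IsMultitiling (B \ A) (tilingIsometry κ φ) 1) :
    IsConcrete B := by
  have hAm := hA.isClosed.measurableSet
  have hbD : Bornology.IsBounded (B \ A) := hb.subset Set.sdiff_subset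
  have hw := fun x => hA.solidAngle_sdiff hB hAB x ▸ hA.hasSolidAngle_sdiff hB hAB x
  have hA0 := fun x => (hA.hasSolidAngle x).nonneg
  have hB0 := fun x => (hB.hasSolidAngle x).nonneg
  have hsum : ENNReal.ofReal (discreteVolume B) =
      ENNReal.ofReal (discreteVolume A) + volume (B \ A) := by
    rw [← tsum_ofReal_solidAngle hB.isClosed hb hB0,
      ← tsum_ofReal_solidAngle hA.isClosed (hb.subset hAB) hA0,
      ← ht.tsum_solidAngle_eq_volume (hB.isClosed.measurableSet.diff hAm) hbD hw hκ hφ,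
      ← ENNReal.tsum_add]
    refine tsum_congr fun z => ?_
    rw [← ENNReal.ofReal_add (hA0 _) (hw _).nonneg, hA.solidAngle_sdiff hB hAB, add_sub_cancel]
  have hreal := congrArg ENNReal.toReal hsum
  rw [ENNReal.toReal_ofReal (discreteVolume_nonneg hB0),
    ENNReal.toReal_add ENNReal.ofReal_ne_top hbD.measure_lt_top.ne,
    ENNReal.toReal_ofReal (discreteVolume_nonneg hA0), hc] at hreal
  rw [IsConcrete, hreal, ← Measure.real,
    measureReal_sdiff hAB hAm hb.measure_lt_top.ne, add_sub_cancel]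

end Difference

theorem dehnIntegral_eq_of_isMultitiling_sdiff {A B : Set (Euc 3)} {ι : Type*} [Countable ι]
    {g : ι → Euc 3 ≃ᵢ Euc 3} (hA : IsPolyhedron A) (hB : IsPolyhedron B) (hAB : A ⊆ B)
    (hb : Bornology.IsBounded B) (ht : IsMultitiling (B \ A) g 1) {f : ℝ →ₗ[ℚ] ℝ}
    (hf : f 1 = 0) : dehnIntegral f B = dehnIntegral f A := by
  have hAint := hA.integrable (hb.subset hAB) hf
  have hBint := hB.integrable hb hf
  have hsub : ∀ x, f (solidAngle (B \ A) x) = f (solidAngle B x) - f (solidAngle A x) := fun x => by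
    rw [hA.solidAngle_sdiff hB hAB, map_sub]
  have hzero := ht.dehnIntegral_eq_zero le_rfl
    (hB.isClosed.measurableSet.diff hA.isClosed.measurableSet) (hb.subset Set.sdiff_subset)
    (ht.volume_ne_zero one_ne_zero)
    (fun x => hA.solidAngle_sdiff hB hAB x ▸ hA.hasSolidAngle_sdiff hB hAB x) hf
    (by simpa only [hsub] using! hBint.sub hAint)
  rw [dehnIntegral, integral_congr_ae (.of_forall hsub), integral_sub hBint hAint] at hzero
  exact sub_eq_zero.1 hzero

section AddSegment

variable {d : ℕ} {S : Set (Euc d)} {v : Euc d}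

theorem subset_add_segment : S ⊆ S + segment ℝ 0 v :=
  fun x hx => ⟨x, hx, 0, left_mem_segment _ _ _, add_zero x⟩

theorem isBounded_add_segment (hb : Bornology.IsBounded S) :
    Bornology.IsBounded (S + segment ℝ 0 v) := by
  rw [← convexHull_pair]
  exact hb.add (isBounded_convexHull.2 (Set.toFinite _).isBounded)

end AddSegment

section LineSection

variable {d : ℕ} {S : Set (Euc d)} {v x : Euc d}

theorem exists_forall_add_smul_mem_sdiff_iff (hc : IsClosed S) (hS : Convex ℝ S)
    (hb : Bornology.IsBounded S) (hv : v ≠ 0) (hx : ∃ t : ℝ, x + t • v ∈ S) :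
    ∃ b : ℝ, ∀ t : ℝ, x + t • v ∈ (S + segment ℝ 0 v) \ S ↔ t ∈ Set.Ioc b (b + 1) := by
  set T : Set ℝ := {t | x + t • v ∈ S} with hT
  have hTc : IsClosed T := hc.preimage (by fun_prop)
  have hTb : BddAbove T := by
    obtain ⟨R, hR⟩ := hb.subset_ball x
    refine ⟨R / ‖v‖, fun t ht => ?_⟩
    have hlt := hR ht
    rw [mem_ball_iff_norm, add_sub_cancel_left, norm_smul] at hlt
    rw [le_div_iff₀ (norm_pos_iff.2 hv)]
    exact (mul_le_mul_of_nonneg_right (le_abs_self t) (norm_nonneg v)).trans hlt.le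
  have hTconv : Convex ℝ T := by
    have hpre : T = AffineMap.lineMap x (x + v) ⁻¹' S := by
      ext t; simp [hT, AffineMap.lineMap_apply, add_comm]
    rw [hpre]
    exact hS.affine_preimage _
  have hmem : sSup T ∈ T := hTc.csSup_mem hx hTb
  have hle : ∀ t ∈ T, t ≤ sSup T := fun t ht => le_csSup hTb ht
  have hshift : ∀ t s : ℝ, x + t • v - s • v ∈ S ↔ t - s ∈ T := fun t s => by
    rw [hT, Set.mem_ofPred_eq, sub_smul, add_sub_assoc]
  refine ⟨sSup T, fun t => ?_⟩
  rw [Set.mem_sdiff, mem_add_segment_iff]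
  simp only [hshift]
  constructor
  · rintro ⟨⟨s, h0, h1, hs⟩, ht⟩
    refine ⟨not_le.1 fun hlt => ht ?_, by linarith [hle _ hs]⟩
    exact hTconv.ordConnected.out hs hmem ⟨by linarith, hlt⟩
  · rintro ⟨h1, h2⟩
    refine ⟨⟨t - sSup T, by linarith, by linarith, ?_⟩, fun h => (hle t h).not_gt h1⟩
    rwa [sub_sub_cancel]

theorem existsUnique_add_intCast_smul_mem_sdiff (hc : IsClosed S) (hS : Convex ℝ S)
    (hb : Bornology.IsBounded S) (hv : v ≠ 0) (hx : ∃ t : ℝ, x + t • v ∈ S) :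
    ∃! i : ℤ, x + (i : ℝ) • v ∈ (S + segment ℝ 0 v) \ S := by
  obtain ⟨b, hb'⟩ := exists_forall_add_smul_mem_sdiff_iff hc hS hb hv hx
  simpa only [hb', zero_add, zsmul_one] using existsUnique_add_zsmul_mem_Ioc one_pos (0 : ℝ) b

theorem exists_add_smul_mem_of_mem_add_segment (hx : x ∈ S + segment ℝ 0 v) :
    ∃ t : ℝ, x + t • v ∈ S := by
  obtain ⟨t, -, -, ht⟩ := mem_add_segment_iff.1 hx
  exact ⟨-t, by rwa [neg_smul, ← sub_eq_add_neg]⟩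

variable {K : Type*} [AddCommGroup K] {κ : Euc d} {φ : ℤ × K →+ latticeGroup d}

theorem tilingIsometry_symm_eq_add_smul (hφ : (φ (1, 0) : Euc d) = v) (s : Bool) (i : ℤ) (k : K) :
    (tilingIsometry κ φ (s, i, k)).symm x =
      (tilingIsometry κ φ (s, 0, k)).symm x + ((bif s then i else -i : ℤ) : ℝ) • v := by
  have hik : (i, k) = i • ((1, 0) : ℤ × K) + (0, k) := by ext <;> simp
  have hφi : (φ (i, k) : Euc d) = (i : ℝ) • v + φ (0, k) := by
    rw [hik, map_add, map_zsmul, AddSubgroup.coe_add, AddSubgroup.coe_zsmul, hφ,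
      Int.cast_smul_eq_zsmul]
  cases s
  · rw [tilingIsometry_symm_false, tilingIsometry_symm_false, hφi, cond_false, Int.cast_neg,
      neg_smul]
    abel
  · rw [tilingIsometry_symm_true, tilingIsometry_symm_true, hφi, cond_true]
    abel

/- Every line parallel to `v` which meets `S` meets `(S + [0, v]) \ S` in a half-open segment with
the translation length of `v`. So only the projection along `v` matters for tiling. -/
theorem isMultitiling_sdiff_of_shadow (hc : IsClosed S) (hS : Convex ℝ S)
    (hb : Bornology.IsBounded S) (hv : v ≠ 0) (hφ : (φ (1, 0) : Euc d) = v)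
    (h : ∀ᵐ x : Euc d, ∃! p : Bool × K,
      ∃ t : ℝ, (tilingIsometry κ φ (p.1, 0, p.2)).symm x + t • v ∈ S) :
    IsMultitiling ((S + segment ℝ 0 v) \ S) (tilingIsometry κ φ) 1 := by
  rw [isMultitiling_one_iff]
  filter_upwards [h] with x ⟨⟨s, k⟩, hsk, hsk_unique⟩
  obtain ⟨i, hi, hi_unique⟩ := existsUnique_add_intCast_smul_mem_sdiff hc hS hb hv hsk
  have hinv : ∀ j : ℤ, (bif s then (bif s then j else -j) else -(bif s then j else -j)) = j := by
    cases s <;> simp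
  refine ⟨(s, bif s then i else -i, k), ?_, ?_⟩
  · beta_reduce
    rwa [tilingIsometry_symm_eq_add_smul hφ, hinv]
  · rintro ⟨s', i', k'⟩ hmem
    rw [tilingIsometry_symm_eq_add_smul hφ] at hmem
    obtain ⟨t, ht⟩ := exists_add_smul_mem_of_mem_add_segment hmem.1
    rw [add_assoc, ← add_smul] at ht
    obtain ⟨rfl, rfl⟩ := Prod.mk.inj (hsk_unique (s', k') ⟨_, ht⟩)
    rw [← hi_unique _ hmem, hinv]

end LineSection

section Trapezoid

theorem existsUnique_bool_add_mul_mem {W c e l : ℝ} (hW : 0 < W) (hce : c ≤ e) (heW : e ≤ c + W)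
    (hc : ∀ j : ℤ, l + W * j ≠ c) (he : ∀ j : ℤ, l + W * j ≠ e) :
    ∃! p : Bool × ℤ, l + W * p.2 ∈ bif p.1 then Set.Icc c e else Set.Icc e (c + W) := by
  obtain ⟨j, hj, hj_unique⟩ := existsUnique_add_zsmul_mem_Ico hW l c
  simp only [zsmul_eq_mul, mul_comm _ W] at hj hj_unique
  have hcW : ∀ i : ℤ, l + W * i ≠ c + W := fun i h => hc (i - 1) (by push_cast; linarith)
  refine ⟨(decide (l + W * j < e), j), ?_, ?_⟩
  · rcases lt_or_ge (l + W * j) e with hlt | hge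
    · simpa only [hlt, decide_true, cond_true] using! ⟨hj.1, hlt.le⟩
    · simpa only [hge.not_gt, decide_false, cond_false] using! ⟨hge, hj.2.le⟩
  · rintro ⟨s, i⟩ hi
    cases s
    · obtain rfl := hj_unique i ⟨hce.trans hi.1, hi.2.lt_of_ne (hcW i)⟩
      rw [decide_eq_false hi.1.not_gt]
    · obtain rfl := hj_unique i ⟨hi.1, (hi.2.lt_of_ne (he i)).trans_le heW⟩
      rw [decide_eq_true (hi.2.lt_of_ne (he i))]

theorem existsUnique_add_intCast_mem_Icc {y : ℝ} (hy : ∀ k : ℤ, y ≠ k) :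
    ∃! k : ℤ, y + k ∈ Set.Icc (0 : ℝ) 1 := by
  obtain ⟨k, hk, hk_unique⟩ := existsUnique_add_zsmul_mem_Ico one_pos y (0 : ℝ)
  simp only [zsmul_one, zero_add] at hk hk_unique
  refine ⟨k, Set.Ico_subset_Icc_self hk, fun i hi => hk_unique i ⟨hi.1, hi.2.lt_of_ne fun h => ?_⟩⟩
  exact hy (1 - i) (by push_cast; linarith)

/-- The trapezoid with the height `1`, whose parallel sides have the lengths `a + b + m` and `m`.
It arises as the shadow of the sum of the pyramid and a zonotope along the next edge. -/
def trapezoid (a b m : ℝ) : Set (ℝ × ℝ) :=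
  {z | z.1 ∈ Set.Icc 0 1 ∧ z.2 ∈ Set.Icc (-(a * (1 - z.1)) - m) (b * (1 - z.1))}

theorem existsUnique_mem_trapezoid {a b m W y l : ℝ} (ha : 0 ≤ a) (hb : 0 ≤ b) (hm : 0 ≤ m)
    (hW : W = a + b + 2 * m) (hW0 : 0 < W) (hy : ∀ k : ℤ, y ≠ k)
    (hleft : ∀ j k : ℤ, l + W * j ≠ -(a * (1 - (y + k))) - m)
    (hright : ∀ j k : ℤ, l + W * j ≠ b * (1 - (y + k))) :
    ∃! p : Bool × ℤ × ℤ,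
      (bif p.1 then (y + p.2.2, l + W * p.2.1) else (1 - (y + p.2.2), b - (l + W * p.2.1))) ∈
        trapezoid a b m := by
  obtain ⟨k, hk, hk_unique⟩ := existsUnique_add_intCast_mem_Icc hy
  obtain ⟨hk0, hk1⟩ := hk
  have hfalse : ∀ t : ℝ, b - t ∈ Set.Icc (-(a * (1 - (1 - (y + k)))) - m) (b * (1 - (1 - (y + k))))
      ↔ t ∈ Set.Icc (b * (1 - (y + k))) (-(a * (1 - (y + k))) - m + W) := fun t => by
    rw [hW]
    constructor <;> rintro ⟨h1, h2⟩ <;> constructor <;> linarith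
  obtain ⟨⟨s, j⟩, hsj, hsj_unique⟩ := existsUnique_bool_add_mul_mem (l := l) hW0
    (c := -(a * (1 - (y + k))) - m) (e := b * (1 - (y + k)))
    (by nlinarith) (by rw [hW]; nlinarith) (hleft · k) (hright · k)
  refine ⟨(s, j, k), ?_, ?_⟩
  · cases s
    · exact ⟨⟨by simpa using hk1, by simpa using hk0⟩, (hfalse _).2 hsj⟩
    · exact ⟨⟨hk0, hk1⟩, hsj⟩
  · rintro ⟨s', j', k'⟩ ⟨hk', hj'⟩
    obtain rfl : k' = k := hk_unique k' <| by
      cases s' <;> simpa [and_comm] using hk'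
    obtain ⟨rfl, rfl⟩ := Prod.mk.inj (hsj_unique (s', j') (by
      cases s'
      · exact (hfalse _).1 hj'
      · exact hj'))
    rfl

end Trapezoid

section Coordinates

theorem isPolyhedron_of_linearMap {d : ℕ} {ι : Type} [Finite ι] (L : ι → Euc d →ₗ[ℝ] ℝ)
    (c : ι → ℝ) : IsPolyhedron {x | ∀ i, 0 ≤ L i x + c i} :=
  ⟨ι, inferInstance, fun i => (InnerProductSpace.toDual ℝ (Euc d)).symm (L i).toContinuousLinearMap,
    c, by simp [polyhedron]⟩

/-- The first coordinate with respect to the basis `(0, 0, 1)`, `(-1, 2, 1)`, `(-1, -1, 1)` of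
`ℝ³`, in which the pyramid and the zonotopes below are described. -/
noncomputable def coordP : Euc 3 →ₗ[ℝ] ℝ :=
  EuclideanSpace.projₗ 0 + EuclideanSpace.projₗ 2

/-- The second coordinate with respect to the basis `(0, 0, 1)`, `(-1, 2, 1)`, `(-1, -1, 1)`. -/
noncomputable def coordY : Euc 3 →ₗ[ℝ] ℝ :=
  (1 / 3 : ℝ) • (EuclideanSpace.projₗ 1 - EuclideanSpace.projₗ 0)

/-- The third coordinate with respect to the basis `(0, 0, 1)`, `(-1, 2, 1)`, `(-1, -1, 1)`. -/
noncomputable def coordQ : Euc 3 →ₗ[ℝ] ℝ :=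
  (-1 / 3 : ℝ) • ((2 : ℝ) • EuclideanSpace.projₗ 0 + EuclideanSpace.projₗ 1)

/-- The point with the given coordinates with respect to the basis `(0, 0, 1)`, `(-1, 2, 1)`,
`(-1, -1, 1)`. -/
noncomputable def point (p y q : ℝ) : Euc 3 := !₂[-y - q, 2 * y - q, p + y + q]

theorem coordP_apply (x : Euc 3) : coordP x = x 0 + x 2 := rfl

theorem coordY_apply (x : Euc 3) : coordY x = 1 / 3 * (x 1 - x 0) := rfl

theorem coordQ_apply (x : Euc 3) : coordQ x = -1 / 3 * (2 * x 0 + x 1) := rfl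

@[simp] theorem coordP_point (p y q : ℝ) : coordP (point p y q) = p := by
  simp [coordP_apply, point]

@[simp] theorem coordY_point (p y q : ℝ) : coordY (point p y q) = y := by
  simp only [coordY_apply, point, Matrix.cons_val]; ring

@[simp] theorem coordQ_point (p y q : ℝ) : coordQ (point p y q) = q := by
  simp only [coordQ_apply, point, Matrix.cons_val]; ring

theorem point_coord (x : Euc 3) : point (coordP x) (coordY x) (coordQ x) = x := by
  ext i
  fin_cases i <;> simp [coordP_apply, coordY_apply, coordQ_apply, point] <;> ring

theorem ext_coord {x y : Euc 3} (hp : coordP x = coordP y) (hy : coordY x = coordY y)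
    (hq : coordQ x = coordQ y) : x = y := by
  rw [← point_coord x, ← point_coord y, hp, hy, hq]

theorem point_mem_integerLattice (p y q : ℤ) : point p y q ∈ integerLattice 3 := by
  intro i
  fin_cases i
  · exact ⟨-y - q, by simp [point]⟩
  · exact ⟨2 * y - q, by simp [point]⟩
  · exact ⟨p + y + q, by simp [point]⟩

theorem isBounded_of_coord {S : Set (Euc 3)} (R : ℝ) (hp : ∀ x ∈ S, |coordP x| ≤ R)
    (hy : ∀ x ∈ S, |coordY x| ≤ R) (hq : ∀ x ∈ S, |coordQ x| ≤ R) : Bornology.IsBounded S := by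
  have hcont : Continuous fun a : ℝ × ℝ × ℝ => point a.1 a.2.1 a.2.2 := by
    unfold point
    fun_prop
  have hI : IsCompact (Set.Icc (-R) R) := isCompact_Icc
  refine ((hI.prod (hI.prod hI)).image hcont).isBounded.subset
    fun x hx => ⟨(coordP x, coordY x, coordQ x), ?_, point_coord x⟩
  exact ⟨abs_le.1 (hp x hx), abs_le.1 (hy x hx), abs_le.1 (hq x hx)⟩

end Coordinates

section Pyramid

/-- A pyramid over a quadrilateral in the plane `coordY = 0`, with the apex `(-1, 2, 1)`. -/
def pyramid : Set (Euc 3) :=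
  {x | 0 ≤ coordP x ∧ 0 ≤ coordY x ∧ 0 ≤ coordQ x ∧
    coordP x / 3 + coordY x + coordQ x / 5 ≤ 1 ∧ 1 ≤ coordP x / 2 + coordY x + coordQ x}

theorem isPolyhedron_pyramid : IsPolyhedron pyramid := by
  convert isPolyhedron_of_linearMap
    ![coordP, coordY, coordQ, -((1 / 3 : ℝ) • coordP + coordY + (1 / 5 : ℝ) • coordQ),
      (1 / 2 : ℝ) • coordP + coordY + coordQ] ![0, 0, 0, 1, -1] using 1
  ext x
  simp only [pyramid, Set.mem_ofPred_eq, Fin.forall_fin_succ, LinearMap.add_apply,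
    LinearMap.neg_apply, LinearMap.smul_apply, smul_eq_mul, add_zero, Matrix.cons_val_zero,
    Matrix.cons_val_succ, IsEmpty.forall_iff, and_true]
  refine and_congr_right fun _ => and_congr_right fun _ => and_congr_right fun _ => ?_
  constructor <;> rintro ⟨h1, h2⟩ <;> constructor <;> linarith

theorem isBounded_pyramid : Bornology.IsBounded pyramid := by
  refine isBounded_of_coord 5 ?_ ?_ ?_ <;>
  · rintro x ⟨h1, h2, h3, h4, -⟩
    rw [abs_le]
    constructor <;> linarith

/-- The generators of the zonotopes. -/
noncomputable def zoneVector (j : ℕ) : Euc 3 := point 1 0 j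

theorem zoneVector_ne_zero (j : ℕ) : zoneVector j ≠ 0 := fun h => by
  simpa [zoneVector] using congrArg coordP h

theorem sum_zoneVector (n : ℕ) :
    ∑ j ∈ Finset.range n, zoneVector j = point n 0 (n * (n - 1) / 2) := by
  induction n with
  | zero => exact ext_coord (by simp) (by simp) (by simp)
  | succ n ih =>
    rw [Finset.sum_range_succ, ih]
    refine ext_coord (by simp [zoneVector]) (by simp [zoneVector]) ?_
    simp only [zoneVector, map_add, coordQ_point]
    push_cast
    ring

/-- The lattice zonotope with the generators `zoneVector j`, `j < n`. -/
noncomputable def zonotope (n : ℕ) : Set (Euc 3) :=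
  ∑ j : Fin n, segment ℝ (0 : Euc 3) (zoneVector j)

/-- The sum of the pyramid and the zonotope with `n` generators. -/
noncomputable def pyramidSum (n : ℕ) : Set (Euc 3) := pyramid + zonotope n

theorem pyramidSum_zero : pyramidSum 0 = pyramid := by
  simp [pyramidSum, zonotope]

theorem pyramidSum_succ (n : ℕ) :
    pyramidSum (n + 1) = pyramidSum n + segment ℝ 0 (zoneVector n) := by
  rw [pyramidSum, zonotope, Fin.sum_univ_castSucc, ← add_assoc]
  rfl

theorem isPolyhedron_pyramidSum (n : ℕ) : IsPolyhedron (pyramidSum n) := by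
  induction n with
  | zero => exact pyramidSum_zero ▸ isPolyhedron_pyramid
  | succ n ih => exact pyramidSum_succ n ▸ ih.add_segment _

theorem isBounded_pyramidSum (n : ℕ) : Bornology.IsBounded (pyramidSum n) := by
  induction n with
  | zero => exact pyramidSum_zero ▸ isBounded_pyramid
  | succ n ih => exact pyramidSum_succ n ▸ isBounded_add_segment ih

theorem add_smul_sum_mem_pyramidSum {x : Euc 3} (hx : x ∈ pyramid) {t : ℝ} (h0 : 0 ≤ t)
    (h1 : t ≤ 1) (n : ℕ) : x + t • ∑ j ∈ Finset.range n, zoneVector j ∈ pyramidSum n := by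
  induction n with
  | zero => simpa [pyramidSum_zero] using hx
  | succ n ih =>
    rw [pyramidSum_succ, mem_add_segment_iff]
    refine ⟨t, h0, h1, ?_⟩
    rwa [Finset.sum_range_succ, smul_add, ← add_assoc, add_sub_cancel_right]

end Pyramid

section Tiling

/-- The projection along `zoneVector n`. -/
noncomputable def shadow (n : ℕ) (x : Euc 3) : ℝ × ℝ := (coordY x, coordQ x - n * coordP x)

theorem shadow_add_smul_zoneVector (n j : ℕ) (x : Euc 3) (t : ℝ) :
    shadow n (x + t • zoneVector j) = shadow n x - (0, t * (n - j)) := by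
  simp only [shadow, zoneVector, map_add, map_smul, coordP_point, coordY_point, coordQ_point,
    smul_eq_mul, Prod.mk_sub_mk, Prod.mk.injEq]
  constructor <;> ring

theorem shadow_mem_trapezoid_of_mem_pyramidSum {n j : ℕ} (hj : j ≤ n) {x : Euc 3}
    (hx : x ∈ pyramidSum j) : shadow n x ∈ trapezoid (3 * n) 5 (j * (2 * n - j + 1) / 2) := by
  induction j generalizing x with
  | zero =>
    rw [pyramidSum_zero] at hx
    obtain ⟨hp, hy, hq, hpq, -⟩ := hx
    refine ⟨⟨hy, by simp only [shadow]; linarith⟩, ?_, ?_⟩ <;> simp only [shadow]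
    · have : n * coordP x ≤ n * (3 * (1 - coordY x)) := by gcongr; linarith
      push_cast
      linarith
    · have : 0 ≤ n * coordP x := by positivity
      linarith
  | succ j ih =>
    rw [pyramidSum_succ, mem_add_segment_iff] at hx
    obtain ⟨t, h0, h1, ht⟩ := hx
    have hmem := ih (by lia) ht
    rw [sub_eq_add_neg x, ← neg_smul, shadow_add_smul_zoneVector] at hmem
    obtain ⟨hy, hl, hr⟩ := hmem
    simp only [Prod.fst_sub, Prod.snd_sub, sub_zero] at hy hl hr
    have hjn : (0 : ℝ) ≤ n - j := sub_nonneg.2 (by exact_mod_cast (by lia : j ≤ n))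
    have hle : t * (n - j : ℝ) ≤ n - j := mul_le_of_le_one_left hjn h1
    have hnonneg : 0 ≤ t * (n - j : ℝ) := mul_nonneg h0 hjn
    refine ⟨hy, ?_, by linarith⟩
    push_cast
    linarith

theorem exists_add_smul_mem_pyramidSum {n : ℕ} {x : Euc 3}
    (hx : shadow n x ∈ trapezoid (3 * n) 5 (n * (n + 1) / 2)) :
    ∃ t : ℝ, x + t • zoneVector n ∈ pyramidSum n := by
  obtain ⟨⟨hy0, hy1⟩, hl⟩ := hx
  simp only [shadow] at hy0 hy1 hl
  set y := coordY x with hy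
  have hy1' : 0 ≤ 1 - y := sub_nonneg.2 hy1
  rw [← segment_eq_Icc (hl.1.trans hl.2)] at hl
  obtain ⟨α, β, hα, hβ, hαβ, hl⟩ := hl
  have hbase : point (3 * (1 - y) * α) y (5 * (1 - y) * β) ∈ pyramid := by
    obtain rfl : β = 1 - α := by linarith
    have hα' := mul_nonneg hy1' hα
    have hβ' := mul_nonneg hy1' hβ
    simp only [pyramid, Set.mem_ofPred_eq, coordP_point, coordY_point, coordQ_point]
    refine ⟨by linarith, hy0, by linarith, by linarith, by linarith⟩
  refine ⟨3 * (1 - y) * α + α * n - coordP x, ?_⟩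
  convert add_smul_sum_mem_pyramidSum hbase hα (by linarith) n using 1
  rw [sum_zoneVector]
  refine ext_coord ?_ ?_ ?_ <;>
    simp only [zoneVector, map_add, map_smul, smul_eq_mul, coordP_point, coordY_point, coordQ_point]
  · ring
  · ring
  · simp only [smul_eq_mul] at hl
    linear_combination -hl

theorem exists_add_smul_mem_pyramidSum_iff (n : ℕ) (x : Euc 3) :
    (∃ t : ℝ, x + t • zoneVector n ∈ pyramidSum n) ↔
      shadow n x ∈ trapezoid (3 * n) 5 (n * (n + 1) / 2) := by
  refine ⟨?_, exists_add_smul_mem_pyramidSum⟩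
  rintro ⟨t, ht⟩
  have h := shadow_mem_trapezoid_of_mem_pyramidSum le_rfl ht
  rw [shadow_add_smul_zoneVector, sub_self, mul_zero, Prod.mk_zero_zero, sub_zero] at h
  convert h using 2
  ring

/-- The period in the second coordinate of the tiling of the strip `0 ≤ y ≤ 1` by the shadow of
`pyramidSum n` and its image under a point reflection. -/
def stripWidth (n : ℕ) : ℤ := n ^ 2 + 4 * n + 5

theorem stripWidth_pos (n : ℕ) : 0 < stripWidth n := by
  unfold stripWidth
  positivity

/-- The lattice of translations of the tiling by `pyramidSum (n + 1) \ pyramidSum n`. -/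
noncomputable def tilingHom (n : ℕ) : ℤ × ℤ × ℤ →+ latticeGroup 3 where
  toFun a := ⟨point a.1 a.2.2 (n * a.1 + stripWidth n * a.2.1), mem_latticeGroup.2 (by
    exact_mod_cast point_mem_integerLattice a.1 a.2.2 (n * a.1 + stripWidth n * a.2.1))⟩
  map_zero' := Subtype.ext (ext_coord (by simp) (by simp) (by simp))
  map_add' a b := Subtype.ext (ext_coord (by simp) (by simp) (by
    simp only [Prod.fst_add, Prod.snd_add, Int.cast_add, AddSubgroup.coe_add, map_add,
      coordQ_point]
    ring))

theorem tilingHom_apply (n : ℕ) (a : ℤ × ℤ × ℤ) :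
    (tilingHom n a : Euc 3) = point a.1 a.2.2 (n * a.1 + stripWidth n * a.2.1) := rfl

theorem tilingHom_injective (n : ℕ) : Function.Injective (tilingHom n) := by
  rintro ⟨i, j, k⟩ ⟨i', j', k'⟩ h
  have h' : (tilingHom n (i, j, k) : Euc 3) = tilingHom n (i', j', k') := congrArg Subtype.val h
  rw [tilingHom_apply, tilingHom_apply] at h'
  have hi := congrArg coordP h'
  have hk := congrArg coordY h'
  have hj := congrArg coordQ h'
  simp only [coordP_point, coordY_point, coordQ_point] at hi hj hk
  norm_cast at hi hj hk
  rw [hi, add_right_inj, mul_right_inj' (stripWidth_pos n).ne'] at hj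
  rw [hi, hj, hk]

theorem shadow_tilingIsometry_symm (n : ℕ) (s : Bool) (a : ℤ × ℤ) (x : Euc 3) :
    shadow n ((tilingIsometry (point 0 1 5) (tilingHom n) (s, 0, a)).symm x) =
      bif s then ((shadow n x).1 + a.2, (shadow n x).2 + stripWidth n * a.1)
      else (1 - ((shadow n x).1 + a.2), 5 - ((shadow n x).2 + stripWidth n * a.1)) := by
  cases s <;>
    simp only [tilingIsometry_symm_true, tilingIsometry_symm_false, tilingHom_apply, shadow,
      map_add, map_sub, coordP_point, coordY_point, coordQ_point, cond_true, cond_false,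
      Prod.mk.injEq, Int.cast_zero, true_and] <;>
    ring

theorem isMultitiling_pyramidSum_sdiff (n : ℕ) :
    IsMultitiling (pyramidSum (n + 1) \ pyramidSum n)
      (tilingIsometry (point 0 1 5) (tilingHom n)) 1 := by
  have hne : ∀ (L : Euc 3 →ₗ[ℝ] ℝ) (z : Euc 3), L z ≠ 0 → ∀ c : ℤ → ℤ → ℝ,
      ∀ᵐ x : Euc 3, ∀ j k : ℤ, L x ≠ c j k := fun L z hz c =>
    ae_all_iff.2 fun j => ae_all_iff.2 fun k =>
      ae_linearMap_ne volume (fun h => hz (by rw [h, LinearMap.zero_apply])) _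
  have hP := isPolyhedron_pyramidSum n
  rw [pyramidSum_succ]
  refine isMultitiling_sdiff_of_shadow hP.isClosed hP.convex (isBounded_pyramidSum n)
    (zoneVector_ne_zero n)
    ((tilingHom_apply n (1, 0)).trans (by simp [zoneVector])) ?_
  simp only [exists_add_smul_mem_pyramidSum_iff, shadow_tilingIsometry_symm]
  filter_upwards [hne coordY (point 0 1 0) (by simp) fun _ k => k,
    hne (coordQ - (n : ℝ) • coordP - (3 * n : ℝ) • coordY) (point 0 0 1) (by simp)
      fun j k => -(3 * n * (1 - k)) - n * (n + 1) / 2 - stripWidth n * j,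
    hne (coordQ - (n : ℝ) • coordP + (5 : ℝ) • coordY) (point 0 1 0) (by simp)
      fun j k => 5 * (1 - k) - stripWidth n * j] with x hy hleft hright
  simp only [LinearMap.add_apply, LinearMap.sub_apply, LinearMap.smul_apply, smul_eq_mul]
    at hleft hright
  refine existsUnique_mem_trapezoid (by positivity) (by positivity) (by positivity) ?_
    (by exact_mod_cast stripWidth_pos n) (hy 0) (fun j k h => hleft j k ?_)
    fun j k h => hright j k ?_
  · rw [stripWidth]
    push_cast
    ring
  all_goals
    simp only [shadow] at h
    linarith

theorem point_zero_one_five_mem_integerLattice : point 0 1 5 ∈ integerLattice 3 := by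
  exact_mod_cast point_mem_integerLattice 0 1 5

theorem pyramidSum_subset_succ (n : ℕ) : pyramidSum n ⊆ pyramidSum (n + 1) :=
  pyramidSum_succ n ▸ subset_add_segment

theorem isConcrete_pyramidSum (h : IsConcrete pyramid) (n : ℕ) : IsConcrete (pyramidSum n) := by
  induction n with
  | zero => rwa [pyramidSum_zero]
  | succ n ih =>
    exact ih.of_isMultitiling_sdiff (isPolyhedron_pyramidSum n) (isPolyhedron_pyramidSum (n + 1))
      (pyramidSum_subset_succ n) (isBounded_pyramidSum (n + 1))
      point_zero_one_five_mem_integerLattice (tilingHom_injective n)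
      (isMultitiling_pyramidSum_sdiff n)

theorem dehnIntegral_pyramidSum {f : ℝ →ₗ[ℚ] ℝ} (hf : f 1 = 0) (n : ℕ) :
    dehnIntegral f (pyramidSum n) = dehnIntegral f pyramid := by
  induction n with
  | zero => rw [pyramidSum_zero]
  | succ n ih =>
    rw [← ih]
    exact dehnIntegral_eq_of_isMultitiling_sdiff (isPolyhedron_pyramidSum n)
      (isPolyhedron_pyramidSum (n + 1)) (pyramidSum_subset_succ n)
      (isBounded_pyramidSum (n + 1)) (isMultitiling_pyramidSum_sdiff n) hf

end Tiling

section Gram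

variable {d : ℕ} {ι : Type*} (n : ι → Euc d)

theorem measurableSet_tangentCone (I : Set ι) : MeasurableSet (tangentCone n I) := by
  have hcone : tangentCone n I = polyhedron (fun i : I => n i) fun _ => 0 := by
    ext x; simp [tangentCone, polyhedron]
  exact hcone ▸ (isClosed_polyhedron _ _).measurableSet

theorem solidAngle_tangentCone_empty : solidAngle (tangentCone n ∅) 0 = 1 := by
  have huniv : tangentCone n ∅ = Set.univ := by ext; simp [tangentCone]
  rw [huniv, (hasSolidAngle_univ 0).solidAngle_eq]

variable {n} in
theorem solidAngle_tangentCone_singleton {i : ι} (hi : n i ≠ 0) :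
    solidAngle (tangentCone n {i}) 0 = 1 / 2 := by
  have hhalf : tangentCone n {i} = {x | 0 ≤ ⟪n i, x⟫} := by ext; simp [tangentCone]
  rw [hhalf, (hasSolidAngle_halfSpace hi).solidAngle_eq]

variable {n} in
theorem exists_inner_pos_of_sum_smul_eq_zero [Fintype ι] [Nonempty ι] {s : ι → ℝ}
    (hs : ∀ i, 0 < s i) (hsum : ∑ i, s i • n i = 0) {y : Euc d} (hy : ∀ i, ⟪n i, y⟫ ≠ 0) :
    ∃ i, 0 < ⟪n i, y⟫ := by
  by_contra! hle
  have hneg : ∑ i, s i * ⟪n i, y⟫ < 0 := Finset.sum_neg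
    (fun i _ => mul_neg_of_pos_of_neg (hs i) ((hle i).lt_of_ne (hy i))) Finset.univ_nonempty
  have hzero : ∑ i, s i * ⟪n i, y⟫ = 0 := by
    simpa only [sum_inner, real_inner_smul_left, inner_zero_left] using congrArg (⟪·, y⟫) hsum
  exact hneg.ne hzero

variable {n} in
theorem sum_neg_one_pow_mul_solidAngle_tangentCone [Fintype ι] [Nonempty ι] (hn : ∀ i, n i ≠ 0)
    {s : ι → ℝ} (hs : ∀ i, 0 < s i) (hsum : ∑ i, s i • n i = 0) :
    ∑ I : Finset ι, (-1) ^ I.card * solidAngle (tangentCone n I) 0 = 0 := by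
  classical
  refine sum_mul_eq_of_hasSolidAngle (x := 0) Finset.univ (fun I : Finset ι => tangentCone n I)
    (fun I => (-1) ^ I.card) (fun I => solidAngle (tangentCone n I) 0) 0 one_pos
    (fun I _ => measurableSet_tangentCone n I) (fun I _ => hasSolidAngle_tangentCone n I) ?_
  -- Almost every `y` lies in the cones of the subsets of a fixed nonempty set `M`.
  filter_upwards [ae_all_iff.2 fun i => ae_inner_ne (hn i) 0] with y hy _
  set M : Finset ι := Finset.univ.filter fun i => 0 < ⟪n i, y⟫ with hM
  have hM0 : M.Nonempty := by
    obtain ⟨i, hi⟩ := exists_inner_pos_of_sum_smul_eq_zero hs hsum hy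
    exact ⟨i, Finset.mem_filter.2 ⟨Finset.mem_univ i, hi⟩⟩
  have hmem : ∀ I : Finset ι, y ∈ tangentCone n I ↔ I ∈ M.powerset := fun I => by
    simp only [tangentCone, Set.mem_ofPred_eq, Finset.mem_coe, Finset.mem_powerset,
      Finset.subset_iff, hM, Finset.mem_filter, Finset.mem_univ, true_and]
    exact forall₂_congr fun i _ => ⟨fun h => h.lt_of_ne' (hy i), le_of_lt⟩
  simp only [Set.indicator_apply, hmem, mul_ite, mul_zero, Finset.sum_ite_mem,
    Finset.univ_inter, Pi.one_apply, mul_one]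
  exact_mod_cast Finset.sum_powerset_neg_one_pow_card_of_nonempty hM0

variable {n} in
theorem solidAngle_tangentCone_univ [Fintype ι] [Nonempty ι] (hn : ∀ i, n i ≠ 0) {s : ι → ℝ}
    (hs : ∀ i, 0 < s i) (hsum : ∑ i, s i • n i = 0) :
    solidAngle (tangentCone n Set.univ) 0 = 0 := by
  have hnull : HasSolidAngle (tangentCone n Set.univ) 0 0 := by
    refine (hasSolidAngle_of_notMem_closure (A := ∅) (by simp)).congr_ae one_pos ?_
    filter_upwards [ae_all_iff.2 fun i => ae_inner_ne (hn i) 0] with y hy _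
    obtain ⟨i, hi⟩ := exists_inner_pos_of_sum_smul_eq_zero (y := -y) hs hsum
      fun i => by simpa only [inner_neg_right, neg_ne_zero] using hy i
    rw [inner_neg_right, neg_pos] at hi
    exact ⟨False.elim, fun h => hi.not_ge (h i (Set.mem_univ i))⟩
  exact hnull.solidAngle_eq

end Gram

section EdgeAngle

open Real

/-- The fraction of a small ball which is contained in a wedge whose dihedral angle has the
cosine `r`. -/
noncomputable def wedgeFraction (r : ℝ) : ℝ := arccos r / (2 * π)

theorem wedgeFraction_zero : wedgeFraction 0 = 1 / 4 := by
  rw [wedgeFraction, arccos_zero]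
  field_simp
  norm_num

theorem wedgeFraction_half : wedgeFraction (1 / 2) = 1 / 6 := by
  rw [wedgeFraction, ← cos_pi_div_three, arccos_cos (by positivity) (by linarith [pi_pos])]
  field_simp
  norm_num

theorem wedgeFraction_neg (r : ℝ) : wedgeFraction (-r) = 1 / 2 - wedgeFraction r := by
  rw [wedgeFraction, wedgeFraction, arccos_neg]
  field_simp

theorem solidAngle_tangentCone_pair {ι : Type*} {n : ι → Euc 3} {i j : ι}
    (h : |⟪n i, n j⟫| < ‖n i‖ * ‖n j‖) :
    solidAngle (tangentCone n {i, j}) 0 = wedgeFraction (-(⟪n i, n j⟫ / (‖n i‖ * ‖n j‖))) := by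
  have hpos : 0 < ‖n i‖ * ‖n j‖ := (abs_nonneg _).trans_lt h
  obtain ⟨hlow, hhigh⟩ := abs_lt.1 h
  have hi : n i ≠ 0 := norm_ne_zero_iff.1 (left_ne_zero_of_mul hpos.ne')
  have hj : n j ≠ 0 := norm_ne_zero_iff.1 (right_ne_zero_of_mul hpos.ne')
  have hangle_pos : 0 < InnerProductGeometry.angle (n i) (n j) :=
    arccos_pos.2 ((div_lt_one hpos).2 hhigh)
  have hangle_lt : InnerProductGeometry.angle (n i) (n j) < π :=
    (arccos_le_pi _).lt_of_ne fun hπ => by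
      rw [arccos_eq_pi, div_le_iff₀ hpos] at hπ
      linarith
  have hwedge : tangentCone n {i, j} = {x | 0 ≤ ⟪n i, x⟫ ∧ 0 ≤ ⟪n j, x⟫} := by
    ext; simp [tangentCone]
  rw [hwedge, (hasSolidAngle_wedge hi hj hangle_pos hangle_lt).solidAngle_eq, wedgeFraction,
    arccos_neg, InnerProductGeometry.angle]

theorem irrational_wedgeFraction {x : ℝ} {r : ℚ} (hx : |x| ≤ 1) (hr : 2 * x ^ 2 - 1 = r)
    (hniven : (r : ℝ) ∉ ({-1, -1 / 2, 0, 1 / 2, 1} : Set ℝ)) : Irrational (wedgeFraction x) := by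
  rintro ⟨q, hq⟩
  have hcos : cos (2 * arccos x) = r := by
    rw [cos_two_mul, cos_arccos (abs_le.1 hx).1 (abs_le.1 hx).2, hr]
  have hangle : 2 * arccos x = (4 * q : ℚ) * π := by
    rw [wedgeFraction, eq_div_iff (by positivity)] at hq
    push_cast
    linarith
  exact hniven (hcos ▸ niven ⟨4 * q, hangle⟩ ⟨r, hcos⟩)

theorem exists_linearMap_ne_zero_of_irrational {x : ℝ} (hx : Irrational x) :
    ∃ f : ℝ →ₗ[ℚ] ℝ, f 1 = 0 ∧ f x ≠ 0 ∧ ∀ y, ∃ q : ℚ, f y = q := by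
  have hspan : x ∉ Submodule.span ℚ {(1 : ℝ)} := by
    rw [Submodule.mem_span_singleton]
    rintro ⟨q, hq⟩
    exact hx ⟨q, by rw [← hq, Rat.smul_def, mul_one]⟩
  obtain ⟨g, hgx, hg⟩ := Submodule.exists_dual_map_eq_bot_of_notMem hspan inferInstance
  have hg1 : g 1 = 0 := by
    have hmem := Submodule.mem_map_of_mem (f := g) (Submodule.mem_span_singleton_self (R := ℚ) 1)
    rwa [hg, Submodule.mem_bot] at hmem
  refine ⟨Algebra.linearMap ℚ ℝ ∘ₗ g, ?_, ?_, fun y => ⟨g y, rfl⟩⟩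
  · rw [LinearMap.comp_apply, hg1, map_zero]
  · simpa using hgx

end EdgeAngle

section Simplex

variable {d : ℕ} {n : Fin (d + 1) → Euc d} {c : Fin (d + 1) → ℝ} {v : Fin (d + 1) → Euc d}
  {r : Fin (d + 1) → ℝ}

/-- The inequalities `0 ≤ ⟪n i, x⟫ + c i` cut out the simplex with the vertices `v i`, and the
`i`-th one takes the value `r i` at the vertex opposite to its facet. -/
structure IsSimplexPresentation (n : Fin (d + 1) → Euc d) (c : Fin (d + 1) → ℝ)
    (v : Fin (d + 1) → Euc d) (r : Fin (d + 1) → ℝ) : Prop where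
  height_pos : ∀ i, 0 < r i
  inner_vertex_add : ∀ i j, ⟪n i, v j⟫ + c i = if i = j then r i else 0

namespace IsSimplexPresentation

theorem inner_sum_smul_add (h : IsSimplexPresentation n c v r) {w : Fin (d + 1) → ℝ}
    (hw : ∑ j, w j = 1) (i : Fin (d + 1)) : ⟪n i, ∑ j, w j • v j⟫ + c i = w i * r i := by
  calc ⟪n i, ∑ j, w j • v j⟫ + c i = ∑ j, w j * (⟪n i, v j⟫ + c i) := by
        simp only [inner_sum, real_inner_smul_right, mul_add, Finset.sum_add_distrib,
          ← Finset.sum_mul, hw, one_mul]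
    _ = w i * r i := by simp [h.inner_vertex_add]

theorem affineIndependent (h : IsSimplexPresentation n c v r) : AffineIndependent ℝ v := by
  rw [affineIndependent_iff_of_fintype]
  intro w hw hvw i
  rw [Finset.weightedVSub_eq_linear_combination _ hw] at hvw
  have hi : w i * r i = ∑ j, w j * (⟪n i, v j⟫ + c i) := by simp [h.inner_vertex_add]
  have hzero : ∑ j, w j * (⟪n i, v j⟫ + c i) = 0 := by
    simpa only [inner_sum, real_inner_smul_right, inner_zero_right, mul_add,
      Finset.sum_add_distrib, ← Finset.sum_mul, hw, zero_mul, add_zero]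
      using congrArg (⟪n i, ·⟫) hvw
  exact (mul_eq_zero.1 (hi.trans hzero)).resolve_right (h.height_pos i).ne'

theorem exists_barycentric (h : IsSimplexPresentation n c v r) (x : Euc d) :
    ∃ w : Fin (d + 1) → ℝ, ∑ i, w i = 1 ∧ ∑ i, w i • v i = x ∧
      ∀ i, ⟪n i, x⟫ + c i = w i * r i := by
  let b : AffineBasis (Fin (d + 1)) ℝ (Euc d) :=
    ⟨v, h.affineIndependent, (h.affineIndependent.affineSpan_eq_top_iff_card_eq_finrank_add_one).2
      (by simp)⟩
  have hsum := b.sum_coord_apply_eq_one x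
  have hx : ∑ i, b.coord i x • v i = x := b.linear_combination_coord_eq_self x
  exact ⟨fun i => b.coord i x, hsum, hx, fun i => by
    simpa only [hx] using h.inner_sum_smul_add hsum i⟩

theorem sum_inv_smul_eq_zero (h : IsSimplexPresentation n c v r) :
    ∑ i, (r i)⁻¹ • n i = 0 := by
  have hsum : ∀ x, ∑ i, (r i)⁻¹ * (⟪n i, x⟫ + c i) = 1 := fun x => by
    obtain ⟨w, hw, -, hx⟩ := h.exists_barycentric x
    rw [← hw]
    refine Finset.sum_congr rfl fun i _ => ?_
    rw [hx, mul_comm (w i), inv_mul_cancel_left₀ (h.height_pos i).ne']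
  refine ext_inner_right ℝ fun x => ?_
  have hx := (hsum x).trans (hsum 0).symm
  simpa only [mul_add, Finset.sum_add_distrib, add_left_inj, sum_inner, real_inner_smul_left,
    inner_zero_right, inner_zero_left, mul_zero, Finset.sum_const_zero] using hx

theorem normal_ne_zero [NeZero d] (h : IsSimplexPresentation n c v r) (i : Fin (d + 1)) :
    n i ≠ 0 := by
  intro hi
  have : Nontrivial (Fin (d + 1)) := Fin.nontrivial_iff_two_le.2 (by have := NeZero.pos d; omega)
  obtain ⟨j, hj⟩ := exists_ne i
  have hii := h.inner_vertex_add i i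
  have hij := h.inner_vertex_add i j
  rw [hi, inner_zero_left, zero_add] at hii hij
  rw [hij, if_neg hj.symm, if_pos rfl] at hii
  exact (h.height_pos i).ne hii

theorem exists_barycentric_of_mem_polyhedronFace (h : IsSimplexPresentation n c v r)
    {I : Set (Fin (d + 1))} {x : Euc d} (hx : x ∈ polyhedronFace n c I) :
    ∃ w : Fin (d + 1) → ℝ, ∑ i, w i = 1 ∧ ∑ i, w i • v i = x ∧ (∀ i ∈ I, w i = 0) ∧
      ∀ i ∉ I, 0 < w i := by
  obtain ⟨w, hw, hwx, hslack⟩ := h.exists_barycentric x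
  refine ⟨w, hw, hwx, fun i hi => ?_, fun i hi => ?_⟩
  · have hi0 := (hslack i).symm.trans ((hx.2 i).2 hi)
    exact (mul_eq_zero.1 hi0).resolve_right (h.height_pos i).ne'
  · have hi0 := (hx.1 i).lt_of_ne' (mt (hx.2 i).1 hi)
    exact pos_of_mul_pos_left (hslack i ▸ hi0) (h.height_pos i).le

theorem polyhedronFace_subset_singleton (h : IsSimplexPresentation n c v r)
    {I : Set (Fin (d + 1))} {k : Fin (d + 1)} (hI : ∀ i, i ≠ k → i ∈ I) :
    polyhedronFace n c I ⊆ {v k} := by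
  intro x hx
  obtain ⟨w, hw, rfl, hw0, -⟩ := h.exists_barycentric_of_mem_polyhedronFace hx
  rw [Finset.sum_eq_single k (fun i _ hi => hw0 i (hI i hi)) (by simp)] at hw
  rw [Finset.sum_eq_single k (fun i _ hi => by rw [hw0 i (hI i hi), zero_smul]) (by simp), hw,
    one_smul]
  rfl

theorem polyhedronFace_eq_openSegment (h : IsSimplexPresentation n c v r)
    {I : Set (Fin (d + 1))} {k l : Fin (d + 1)} (hkl : k ≠ l)
    (hI : ∀ i, i ∈ I ↔ i ≠ k ∧ i ≠ l) : polyhedronFace n c I = openSegment ℝ (v k) (v l) := by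
  have hkI : k ∉ I := fun hk => ((hI k).1 hk).1 rfl
  have hlI : l ∉ I := fun hl => ((hI l).1 hl).2 rfl
  apply Set.Subset.antisymm
  · intro x hx
    obtain ⟨w, hw, rfl, hzero, hpos⟩ := h.exists_barycentric_of_mem_polyhedronFace hx
    rw [Fintype.sum_eq_add k l hkl fun i hi => hzero i ((hI i).2 hi)] at hw
    rw [Fintype.sum_eq_add k l hkl fun i hi => by rw [hzero i ((hI i).2 hi), zero_smul]]
    exact ⟨w k, w l, hpos k hkI, hpos l hlI, hw, rfl⟩
  · rintro _ ⟨s, t, hs, ht, hst, rfl⟩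
    have hslack : ∀ i, ⟪n i, s • v k + t • v l⟫ + c i =
        s * (if i = k then r i else 0) + t * (if i = l then r i else 0) := fun i => by
      rw [← h.inner_vertex_add i k, ← h.inner_vertex_add i l, inner_add_right,
        real_inner_smul_right, real_inner_smul_right]
      linear_combination -(c i) * hst
    have hr := h.height_pos
    refine ⟨fun i => ?_, fun i => ?_⟩ <;> rw [hslack]
    · have := (hr i).le
      positivity
    · rw [hI]
      rcases eq_or_ne i k with rfl | hik
      · simp [hkl, hs.ne', (hr i).ne']
      · rcases eq_or_ne i l with rfl | hil
        · simp [hik, ht.ne', (hr i).ne']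
        · simp [hik, hil]

end IsSimplexPresentation

end Simplex

section SimplexDehn

variable {n : Fin 4 → Euc 3} {c : Fin 4 → ℝ} {v : Fin 4 → Euc 3} {r : Fin 4 → ℝ}

theorem hausdorffMeasure_openSegment {E : Type*} [NormedAddCommGroup E] [NormedSpace ℝ E]
    [MeasurableSpace E] [BorelSpace E] (x y : E) : μH[1] (openSegment ℝ x y) = edist x y := by
  have := Measure.nullSingletonClass_hausdorff E one_pos
  rw [← hausdorffMeasure_segment, ← insert_endpoints_openSegment,
    measure_congr ((insert_ae_eq_self x _).trans (insert_ae_eq_self y _))]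

theorem map_solidAngle_tangentCone_eq_zero_of_card_lt_two {d : ℕ} {ι : Type*} (n : ι → Euc d)
    {I : Finset ι} (hI : I.card < 2) {f : ℝ →ₗ[ℚ] ℝ} (hf : f 1 = 0) :
    f (solidAngle (tangentCone n I) 0) = 0 := by
  rcases I.eq_empty_or_nonempty with rfl | ⟨j, hj⟩
  · rw [Finset.coe_empty, solidAngle_tangentCone_empty, hf]
  · refine map_solidAngle_tangentCone_eq_zero (m := n j) (fun i hi => ⟨1, ?_⟩) hf
    rw [Finset.card_le_one.1 (Nat.le_of_lt_succ hI) i hi j hj, one_smul]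

namespace IsSimplexPresentation

theorem measureReal_polyhedronFace_pair (h : IsSimplexPresentation n c v r) {i j : Fin 4}
    {k l : Fin 4} (hkl : k ≠ l) (hij : ∀ m, m = i ∨ m = j ↔ m ≠ k ∧ m ≠ l) :
    μH[1].real (polyhedronFace n c {i, j}) = dist (v k) (v l) := by
  rw [h.polyhedronFace_eq_openSegment (I := {i, j}) hkl hij, Measure.real,
    hausdorffMeasure_openSegment, edist_dist, ENNReal.toReal_ofReal dist_nonneg]

theorem hausdorffMeasure_polyhedronFace_lt_top (h : IsSimplexPresentation n c v r)
    {I : Finset (Fin 4)} (hI : I.card = 2) : μH[1] (polyhedronFace n c I) < ⊤ := by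
  obtain ⟨k, l, hkl, hIc⟩ := Finset.card_eq_two.1
    (by rw [Finset.card_compl, Fintype.card_fin, hI] : (Iᶜ).card = 2)
  have hmem : ∀ i, i ∈ I ↔ i ≠ k ∧ i ≠ l := fun i => by
    rw [← Finset.notMem_compl, hIc, Finset.mem_insert, Finset.mem_singleton, not_or]
  rw [h.polyhedronFace_eq_openSegment hkl hmem, hausdorffMeasure_openSegment]
  exact edist_lt_top _ _

theorem hausdorffMeasure_polyhedronFace_eq_zero (h : IsSimplexPresentation n c v r)
    {I : Finset (Fin 4)} (hI : 2 < I.card) : μH[1] (polyhedronFace n c I) = 0 := by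
  have := Measure.nullSingletonClass_hausdorff (Euc 3) one_pos
  obtain ⟨k, hk⟩ := Finset.card_le_one_iff_subset_singleton.1
    (by rw [Finset.card_compl, Fintype.card_fin]; omega : (Iᶜ).card ≤ 1)
  refine measure_mono_null (h.polyhedronFace_subset_singleton fun i hi => ?_)
    (measure_singleton (v k))
  by_contra hiI
  exact hi (Finset.mem_singleton.1 (hk (Finset.mem_compl.2 hiI)))

theorem dehnIntegral_polyhedron_eq_sum (h : IsSimplexPresentation n c v r) {f : ℝ →ₗ[ℚ] ℝ}
    (hf : f 1 = 0) : dehnIntegral f (polyhedron n c) = ∑ I ∈ Finset.univ.powersetCard 2,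
      μH[1].real (polyhedronFace n c (I : Finset (Fin 4))) *
        f (solidAngle (tangentCone n (I : Finset (Fin 4))) 0) := by
  set g : Finset (Fin 4) → Euc 3 → ℝ := fun I =>
    (polyhedronFace n c I).indicator fun _ => f (solidAngle (tangentCone n I) 0) with hg
  have hsum : ∀ x, f (solidAngle (polyhedron n c) x) = ∑ I, g I x := fun x => by
    rw [map_solidAngle_polyhedron_eq_sum, finsum_eq_sum_of_fintype]
    exact (Fintype.finsetEquivSet.sum_comp fun I : Set (Fin 4) => (polyhedronFace n c I).indicator
      (fun _ => f (solidAngle (tangentCone n I) 0)) x).symm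
  have hcases : ∀ I : Finset (Fin 4), I.card ≠ 2 →
      f (solidAngle (tangentCone n I) 0) = 0 ∨ μH[1] (polyhedronFace n c I) = 0 := fun I hI =>
    (lt_or_gt_of_ne hI).imp (map_solidAngle_tangentCone_eq_zero_of_card_lt_two n · hf)
      h.hausdorffMeasure_polyhedronFace_eq_zero
  have hInt : ∀ I, Integrable (g I) μH[1] := fun I => by
    rw [integrable_indicator_iff (measurableSet_polyhedronFace n c I), integrableOn_const_iff,
      enorm_eq_zero]
    by_cases hI : I.card = 2
    · exact Or.inr (h.hausdorffMeasure_polyhedronFace_lt_top hI)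
    · exact (hcases I hI).imp_right fun h0 => h0.trans_lt ENNReal.zero_lt_top
  simp only [dehnIntegral, hsum]
  rw [integral_finsetSum _ fun I _ => hInt I]
  simp only [hg, integral_indicator_const _ (measurableSet_polyhedronFace n c _), smul_eq_mul]
  refine (Finset.sum_subset (Finset.subset_univ _) fun I _ hI => ?_).symm
  rw [Finset.mem_powersetCard_univ] at hI
  rcases hcases I hI with h0 | h0 <;> simp [h0, Measure.real]

theorem dehnIntegral_polyhedron (h : IsSimplexPresentation n c v r) {f : ℝ →ₗ[ℚ] ℝ}
    (hf : f 1 = 0) : dehnIntegral f (polyhedron n c) =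
      dist (v 2) (v 3) * f (solidAngle (tangentCone n {0, 1}) 0) +
      dist (v 1) (v 3) * f (solidAngle (tangentCone n {0, 2}) 0) +
      dist (v 1) (v 2) * f (solidAngle (tangentCone n {0, 3}) 0) +
      dist (v 0) (v 3) * f (solidAngle (tangentCone n {1, 2}) 0) +
      dist (v 0) (v 2) * f (solidAngle (tangentCone n {1, 3}) 0) +
      dist (v 0) (v 1) * f (solidAngle (tangentCone n {2, 3}) 0) := by
  have hpairs : (Finset.univ : Finset (Fin 4)).powersetCard 2 =
      {{0, 1}, {0, 2}, {0, 3}, {1, 2}, {1, 3}, {2, 3}} := by decide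
  rw [h.dehnIntegral_polyhedron_eq_sum hf, hpairs]
  iterate 5 rw [Finset.sum_insert (by decide)]
  simp only [Finset.sum_singleton, Finset.coe_pair]
  rw [h.measureReal_polyhedronFace_pair (k := 2) (l := 3),
    h.measureReal_polyhedronFace_pair (k := 1) (l := 3),
    h.measureReal_polyhedronFace_pair (k := 1) (l := 2),
    h.measureReal_polyhedronFace_pair (k := 0) (l := 3),
    h.measureReal_polyhedronFace_pair (k := 0) (l := 2),
    h.measureReal_polyhedronFace_pair (k := 0) (l := 1)]
  · ring
  all_goals decide

theorem sum_solidAngle_tangentCone_triple (h : IsSimplexPresentation n c v r) :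
    solidAngle (tangentCone n {0, 1, 2}) 0 + solidAngle (tangentCone n {0, 1, 3}) 0 +
      solidAngle (tangentCone n {0, 2, 3}) 0 + solidAngle (tangentCone n {1, 2, 3}) 0 =
    solidAngle (tangentCone n {0, 1}) 0 + solidAngle (tangentCone n {0, 2}) 0 +
      solidAngle (tangentCone n {0, 3}) 0 + solidAngle (tangentCone n {1, 2}) 0 +
      solidAngle (tangentCone n {1, 3}) 0 + solidAngle (tangentCone n {2, 3}) 0 - 1 := by
  have hpos : ∀ i, 0 < (r i)⁻¹ := fun i => inv_pos.2 (h.height_pos i)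
  have hgram := sum_neg_one_pow_mul_solidAngle_tangentCone h.normal_ne_zero hpos
    h.sum_inv_smul_eq_zero
  have hall := solidAngle_tangentCone_univ h.normal_ne_zero hpos h.sum_inv_smul_eq_zero
  have hsubsets : (Finset.univ : Finset (Finset (Fin 4))) = {∅, {0}, {1}, {2}, {3}, {0, 1},
      {0, 2}, {0, 3}, {1, 2}, {1, 3}, {2, 3}, {0, 1, 2}, {0, 1, 3}, {0, 2, 3}, {1, 2, 3},
      Finset.univ} := by decide
  rw [hsubsets] at hgram
  iterate 15 rw [Finset.sum_insert (by decide)] at hgram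
  simp only [Finset.sum_singleton, Finset.coe_empty, Finset.coe_singleton, Finset.coe_insert,
    Finset.coe_univ, solidAngle_tangentCone_empty, hall,
    solidAngle_tangentCone_singleton (h.normal_ne_zero _)] at hgram
  norm_num +decide [Finset.card_insert_of_notMem] at hgram
  linarith

end IsSimplexPresentation

end SimplexDehn

section SimplexVolume

/-- The simplex with the vertices `0` and `t • eᵢ`. -/
def cornerSimplex (d : ℕ) (t : ℝ) : Set (Fin d → ℝ) := {x | (∀ i, 0 ≤ x i) ∧ ∑ i, x i ≤ t}

theorem measurableSet_cornerSimplex (d : ℕ) (t : ℝ) : MeasurableSet (cornerSimplex d t) := by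
  refine IsClosed.measurableSet (IsClosed.and ?_ (isClosed_le (by fun_prop) continuous_const))
  simp only [Set.ofPred_forall]
  exact isClosed_iInter fun i => isClosed_le continuous_const (continuous_apply i)

theorem cons_mem_cornerSimplex {d : ℕ} {t u : ℝ} {x : Fin d → ℝ} :
    (Fin.cons u x : Fin (d + 1) → ℝ) ∈ cornerSimplex (d + 1) t ↔
      0 ≤ u ∧ x ∈ cornerSimplex d (t - u) := by
  simp [cornerSimplex, Fin.forall_fin_succ, Fin.sum_univ_succ, le_sub_iff_add_le', and_assoc]

theorem cornerSimplex_eq_empty (d : ℕ) {t : ℝ} (ht : t < 0) : cornerSimplex d t = ∅ :=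
  Set.eq_empty_of_forall_notMem fun _ hx =>
    ht.not_ge ((Finset.sum_nonneg fun i _ => hx.1 i).trans hx.2)

theorem integral_sub_pow_div_factorial (d : ℕ) (t : ℝ) :
    ∫ u in (0 : ℝ)..t, (t - u) ^ d / d.factorial = t ^ (d + 1) / (d + 1).factorial := by
  rw [intervalIntegral.integral_comp_sub_left (fun x => x ^ d / (d.factorial : ℝ)), sub_self,
    sub_zero, intervalIntegral.integral_div, integral_pow, zero_pow d.succ_ne_zero, sub_zero,
    div_div, Nat.factorial_succ]
  push_cast
  rfl

theorem lintegral_ofReal_sub_pow_div_factorial (d : ℕ) {t : ℝ} (ht : 0 ≤ t) :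
    ∫⁻ u in Set.Icc 0 t, ENNReal.ofReal ((t - u) ^ d / d.factorial) =
      ENNReal.ofReal (t ^ (d + 1) / (d + 1).factorial) := by
  have hcont : Continuous fun u : ℝ => (t - u) ^ d / d.factorial := by fun_prop
  have hnonneg : ∀ᵐ u ∂volume.restrict (Set.Icc 0 t), 0 ≤ (t - u) ^ d / d.factorial :=
    (ae_restrict_iff' measurableSet_Icc).2 (Eventually.of_forall fun u hu => by
      have := sub_nonneg.2 hu.2
      positivity)
  rw [← ofReal_integral_eq_lintegral_ofReal hcont.integrableOn_Icc hnonneg,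
    integral_Icc_eq_integral_Ioc, ← intervalIntegral.integral_of_le ht,
    integral_sub_pow_div_factorial]

theorem volume_cornerSimplex (d : ℕ) {t : ℝ} (ht : 0 ≤ t) :
    volume (cornerSimplex d t) = ENNReal.ofReal (t ^ d / d.factorial) := by
  induction d generalizing t with
  | zero =>
    have huniv : cornerSimplex 0 t = Set.univ := by ext; simp [cornerSimplex, ht]
    simp [huniv, volume_pi]
  | succ d ih =>
    have hpres := (volume_preserving_piFinSuccAbove (fun _ : Fin (d + 1) => ℝ) 0).symm
    have hslice : ∀ u, volume {x : Fin d → ℝ | 0 ≤ u ∧ x ∈ cornerSimplex d (t - u)} =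
        (Set.Icc 0 t).indicator (fun u => ENNReal.ofReal ((t - u) ^ d / d.factorial)) u := by
      intro u
      by_cases hu : u ∈ Set.Icc 0 t
      · simp [hu, hu.1, ← ih (sub_nonneg.2 hu.2)]
      · rw [Set.indicator_of_notMem hu]
        by_cases hu0 : 0 ≤ u
        · simp [cornerSimplex_eq_empty d (sub_neg.2 (not_le.1 fun h => hu ⟨hu0, h⟩))]
        · simp [hu0]
    rw [← hpres.measure_preimage_equiv, Measure.volume_eq_prod, Measure.prod_apply
      (hpres.measurable (measurableSet_cornerSimplex (d + 1) t)),
      ← lintegral_ofReal_sub_pow_div_factorial d ht, ← lintegral_indicator measurableSet_Icc]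
    refine lintegral_congr fun u => (congrArg volume ?_).trans (hslice u)
    ext x
    simp [MeasurableEquiv.piFinSuccAbove, Fin.consEquiv, cons_mem_cornerSimplex]

theorem volume_simplex {d : ℕ} (M : Matrix (Fin d) (Fin d) ℝ) (hM : M.det ≠ 0) {t : ℝ}
    (ht : 0 ≤ t) : volume {x : Euc d | M.mulVec x.ofLp ∈ cornerSimplex d t} =
      ENNReal.ofReal |M.det⁻¹| * ENNReal.ofReal (t ^ d / d.factorial) := by
  have hpres := EuclideanSpace.volume_preserving_symm_measurableEquiv_toLp (Fin d)
  rw [← volume_cornerSimplex d ht, ← LinearMap.det_toLin',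
    ← Measure.addHaar_preimage_linearMap volume (by rwa [LinearMap.det_toLin']),
    ← hpres.measure_preimage_equiv]
  rfl

end SimplexVolume

section IntegerPoints

variable {d : ℕ} {ι : Type*}

/-- The point of `ℝᵈ` with the given integer coordinates. -/
noncomputable def intPoint (z : Fin d → ℤ) : Euc d := WithLp.toLp 2 fun i => (z i : ℝ)

theorem inner_intPoint (y z : Fin d → ℤ) : ⟪intPoint y, intPoint z⟫ = (y ⬝ᵥ z : ℤ) := by
  simp [intPoint, PiLp.inner_apply, dotProduct, mul_comm]

theorem norm_intPoint (z : Fin d → ℤ) : ‖intPoint z‖ = √(z ⬝ᵥ z : ℤ) := by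
  rw [← inner_intPoint, real_inner_self_eq_norm_sq, Real.sqrt_sq (norm_nonneg _)]

theorem dist_intPoint (y z : Fin d → ℤ) :
    dist (intPoint y) (intPoint z) = √((y - z) ⬝ᵥ (y - z) : ℤ) := by
  rw [← norm_intPoint, dist_eq_norm]
  congr 1
  ext i
  simp [intPoint]

theorem intPoint_injective : Function.Injective (intPoint : (Fin d → ℤ) → Euc d) :=
  fun _ _ h => funext fun i => Int.cast_injective (congrArg (· i) h)

theorem range_intPoint : Set.range intPoint = integerLattice d := by
  ext x
  constructor
  · rintro ⟨z, rfl⟩ i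
    exact ⟨z i, rfl⟩
  · intro hx
    choose z hz using hx
    exact ⟨z, PiLp.ext fun i => (hz i).symm⟩

/-- For each point `z` of `B` at which all the inequalities `0 ≤ n i ⬝ᵥ z + c i` hold, the set of
those which are tight at `z`. -/
def tightSets [Fintype ι] [DecidableEq ι] (n : ι → Fin d → ℤ) (c : ι → ℤ)
    (B : Finset (Fin d → ℤ)) : Multiset (Finset ι) :=
  (B.filter fun z => ∀ i, 0 ≤ n i ⬝ᵥ z + c i).val.map
    fun z => Finset.univ.filter fun i => n i ⬝ᵥ z + c i = 0

theorem inner_intPoint_add (y z : Fin d → ℤ) (a : ℤ) :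
    ⟪intPoint y, intPoint z⟫ + (a : ℝ) = (y ⬝ᵥ z + a : ℤ) := by
  rw [inner_intPoint, Int.cast_add]

theorem intPoint_mem_polyhedron {n : ι → Fin d → ℤ} {c : ι → ℤ} {z : Fin d → ℤ} :
    intPoint z ∈ polyhedron (fun i => intPoint (n i)) (fun i => (c i : ℝ)) ↔
      ∀ i, 0 ≤ n i ⬝ᵥ z + c i :=
  forall_congr' fun i => by rw [inner_intPoint_add, Int.cast_nonneg_iff]

theorem discreteVolume_polyhedron [Fintype ι] [DecidableEq ι] {n : ι → Fin d → ℤ} {c : ι → ℤ}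
    {B : Finset (Fin d → ℤ)} (hB : ∀ z, (∀ i, 0 ≤ n i ⬝ᵥ z + c i) → z ∈ B) :
    discreteVolume (polyhedron (fun i => intPoint (n i)) fun i => (c i : ℝ)) =
      ((tightSets n c B).map fun I : Finset ι =>
        solidAngle (tangentCone (fun i => intPoint (n i)) I) 0).sum := by
  set F := B.filter fun z => ∀ i, 0 ≤ n i ⬝ᵥ z + c i
  have hpoints : polyhedron (fun i => intPoint (n i)) (fun i => (c i : ℝ)) ∩ integerLattice d =
      F.map ⟨intPoint, intPoint_injective⟩ := by
    ext x
    simp only [← range_intPoint, Set.mem_inter_iff, Set.mem_range, Finset.coe_map, Set.mem_image,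
      Finset.mem_coe, F, Finset.mem_filter, Function.Embedding.coeFn_mk]
    constructor
    · rintro ⟨hx, z, rfl⟩
      exact ⟨z, ⟨hB z (intPoint_mem_polyhedron.1 hx), intPoint_mem_polyhedron.1 hx⟩, rfl⟩
    · rintro ⟨z, ⟨-, hz⟩, rfl⟩
      exact ⟨intPoint_mem_polyhedron.2 hz, z, rfl⟩
  rw [discreteVolume, hpoints, finsum_mem_coe_finset, Finset.sum_map, tightSets, Multiset.map_map]
  refine Finset.sum_congr rfl fun z hz => solidAngle_polyhedron _ _
    ⟨intPoint_mem_polyhedron.2 (Finset.mem_filter.1 hz).2, fun i => ?_⟩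
  rw [Function.Embedding.coeFn_mk, inner_intPoint_add, Int.cast_eq_zero]
  simp

theorem solidAngle_tangentCone_intPoint_pair (n : ι → Fin 3 → ℤ) {i j : ι} {k s t : ℤ}
    (hk : 0 < k) (hst : s ^ 2 < t) (hij : n i ⬝ᵥ n j = k * s)
    (hn : (n i ⬝ᵥ n i) * (n j ⬝ᵥ n j) = k ^ 2 * t) :
    solidAngle (tangentCone (fun i => intPoint (n i)) {i, j}) 0 = wedgeFraction (-s / √t) := by
  have hinner : ⟪intPoint (n i), intPoint (n j)⟫ = k * s := by
    rw [inner_intPoint, hij, Int.cast_mul]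
  have hk' : (0 : ℝ) < k := Int.cast_pos.2 hk
  have hnorm : ‖intPoint (n i)‖ * ‖intPoint (n j)‖ = k * √t := by
    rw [norm_intPoint, norm_intPoint, ← Real.sqrt_mul (by
      rw [← inner_intPoint]; exact real_inner_self_nonneg), ← Int.cast_mul, hn,
      Int.cast_mul, Int.cast_pow, Real.sqrt_mul (by positivity), Real.sqrt_sq hk'.le]
  have hs : |(s : ℝ)| < √t := Real.lt_sqrt_of_sq_lt (by rw [sq_abs]; exact_mod_cast hst)
  rw [solidAngle_tangentCone_pair, hinner, hnorm, mul_div_mul_left _ _ hk'.ne', neg_div]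
  rw [hinner, hnorm, abs_mul, abs_of_pos hk']
  gcongr

end IntegerPoints

section Tetrahedra

/-- Integral inward normals to the faces of `tetrahedron a b`, obtained by clearing denominators
in the linear parts of `P`, `Y`, `Q` and `1 - P / a - Y - Q / b`, where `P`, `Y` and `Q` are the
coordinates `coordP`, `coordY` and `coordQ`. -/
def tetraNormal (a b : ℤ) : Fin 4 → Fin 3 → ℤ :=
  ![![1, 0, 1], ![-1, 1, 0], ![-2, -1, 0], ![a * b + 2 * a - 3 * b, a - a * b, -3 * b]]

/-- The constant terms that go with `tetraNormal a b`. -/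
def tetraConst (a b : ℤ) : Fin 4 → ℤ := ![0, 0, 0, 3 * a * b]

/-- The tetrahedron with vertices at the origin and at the points `P = a`, `Y = 1` and `Q = b` of
the three coordinate axes of `coordP`, `coordY` and `coordQ`. -/
noncomputable def tetrahedron (a b : ℤ) : Set (Euc 3) :=
  polyhedron (fun i => intPoint (tetraNormal a b i)) fun i => (tetraConst a b i : ℝ)

/-- The vertices of `tetrahedron a b`, each opposite to the face of the same index. -/
def tetraVertex (a b : ℤ) : Fin 4 → Fin 3 → ℤ := ![![0, 0, a], ![-1, 2, 1], ![-b, -b, b], 0]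

/-- The values of the inequalities of `tetrahedron a b` at the opposite vertices. -/
def tetraHeight (a b : ℤ) : Fin 4 → ℤ := ![a, 3, 3 * b, 3 * a * b]

/-- The solid angle of `tetrahedron a b` along its face of codimension `#I` indexed by `I`. -/
noncomputable def tetraAngle (a b : ℤ) (I : Set (Fin 4)) : ℝ :=
  solidAngle (tangentCone (fun i => intPoint (tetraNormal a b i)) I) 0

variable {a b : ℤ}

theorem isPolyhedron_tetrahedron (a b : ℤ) : IsPolyhedron (tetrahedron a b) :=
  ⟨Fin 4, inferInstance, _, _, rfl⟩

theorem mem_tetrahedron (ha : 0 < a) (hb : 0 < b) {x : Euc 3} : x ∈ tetrahedron a b ↔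
    0 ≤ coordP x ∧ 0 ≤ coordY x ∧ 0 ≤ coordQ x ∧ coordP x / a + coordY x + coordQ x / b ≤ 1 := by
  have ha' : (0 : ℝ) < a := by exact_mod_cast ha
  have hb' : (0 : ℝ) < b := by exact_mod_cast hb
  have hvalues : ∀ i, ⟪intPoint (tetraNormal a b i), x⟫ + tetraConst a b i =
      ![coordP x, 3 * coordY x, 3 * coordQ x,
        3 * a * b * (1 - (coordP x / a + coordY x + coordQ x / b))] i := by
    intro i
    fin_cases i <;>
      simp [intPoint, PiLp.inner_apply, Fin.sum_univ_three, tetraNormal, tetraConst, coordP_apply,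
        coordY_apply, coordQ_apply] <;> field_simp <;> ring
  change (∀ i, 0 ≤ ⟪intPoint (tetraNormal a b i), x⟫ + (tetraConst a b i : ℝ)) ↔ _
  simp only [hvalues]
  simp [Fin.forall_fin_succ, ha', hb']

theorem tetrahedron_subset_tetrahedron {a' b' : ℤ} (ha : 0 < a) (hb : 0 < b) (haa' : a ≤ a')
    (hbb' : b ≤ b') : tetrahedron a b ⊆ tetrahedron a' b' := by
  intro x hx
  obtain ⟨hp, hy, hq, h⟩ := (mem_tetrahedron ha hb).1 hx
  refine (mem_tetrahedron (ha.trans_le haa') (hb.trans_le hbb')).2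
    ⟨hp, hy, hq, le_trans (by gcongr) h⟩

theorem isBounded_tetrahedron (ha : 0 < a) (hb : 0 < b) :
    Bornology.IsBounded (tetrahedron a b) := by
  have ha' : (0 : ℝ) < a := by exact_mod_cast ha
  have hb' : (0 : ℝ) < b := by exact_mod_cast hb
  have hcoord : ∀ x ∈ tetrahedron a b, (0 ≤ coordP x ∧ coordP x ≤ a) ∧
      (0 ≤ coordY x ∧ coordY x ≤ 1) ∧ 0 ≤ coordQ x ∧ coordQ x ≤ b := by
    intro x hx
    obtain ⟨hp, hy, hq, h⟩ := (mem_tetrahedron ha hb).1 hx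
    have hpa := div_nonneg hp ha'.le
    have hqb := div_nonneg hq hb'.le
    exact ⟨⟨hp, (div_le_one ha').1 (by linarith)⟩, ⟨hy, by linarith⟩, hq,
      (div_le_one hb').1 (by linarith)⟩
  refine isBounded_of_coord (a + 1 + b) (fun x hx => ?_) (fun x hx => ?_) (fun x hx => ?_) <;>
  · obtain ⟨⟨hp, hp'⟩, ⟨hy, hy'⟩, hq, hq'⟩ := hcoord x hx
    rw [abs_le]
    constructor <;> linarith

theorem isSimplexPresentation_tetrahedron (ha : 0 < a) (hb : 0 < b) :
    IsSimplexPresentation (fun i => intPoint (tetraNormal a b i)) (fun i => (tetraConst a b i : ℝ))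
      (fun i => intPoint (tetraVertex a b i)) (fun i => (tetraHeight a b i : ℝ)) where
  height_pos i := by
    rw [Int.cast_pos]
    fin_cases i <;> simp [tetraHeight, ha, hb]
  inner_vertex_add i j := by
    rw [inner_intPoint_add, ← Int.cast_zero, ← Int.cast_ite, Int.cast_inj]
    fin_cases i <;> fin_cases j <;>
      simp [tetraNormal, tetraConst, tetraVertex, tetraHeight, dotProduct, Fin.sum_univ_three] <;>
      ring

theorem volume_tetrahedron (ha : 0 < a) (hb : 0 < b) :
    volume (tetrahedron a b) = ENNReal.ofReal (a * b / 2) := by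
  set M : Matrix (Fin 3) (Fin 3) ℝ :=
    !![1 / (a : ℝ), 0, 1 / (a : ℝ); -1 / 3, 1 / 3, 0; -2 / (3 * b), -1 / (3 * b), 0]
  have ha' : (0 : ℝ) < a := by exact_mod_cast ha
  have hb' : (0 : ℝ) < b := by exact_mod_cast hb
  have hdet : M.det = 1 / (3 * a * b) := by
    simp only [M, Matrix.det_fin_three]
    simp
    field_simp
    norm_num
  have hmem : tetrahedron a b = {x : Euc 3 | M.mulVec x.ofLp ∈ cornerSimplex 3 1} := by
    ext x
    have hcoord : M.mulVec x.ofLp = ![coordP x / a, coordY x, coordQ x / b] := by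
      ext i
      fin_cases i <;>
        simp [M, Matrix.mulVec, dotProduct, Fin.sum_univ_three, coordP_apply, coordY_apply,
          coordQ_apply] <;> ring
    rw [mem_tetrahedron ha hb, Set.mem_ofPred_eq, hcoord]
    simp [cornerSimplex, Fin.forall_fin_succ, Fin.sum_univ_three, le_div_iff₀ ha',
      le_div_iff₀ hb', and_assoc]
  rw [hmem, volume_simplex M (by rw [hdet]; positivity) zero_le_one,
    ← ENNReal.ofReal_mul (abs_nonneg _), hdet, abs_of_pos (by positivity)]
  congr 1
  norm_num [Nat.factorial]
  ring

end Tetrahedra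

section TetrahedronInvariants

variable {a b : ℤ}

theorem tetraAngle_zero_one (a b : ℤ) : tetraAngle a b {0, 1} = 1 / 6 := by
  rw [tetraAngle, solidAngle_tangentCone_intPoint_pair _ one_pos (s := -1) (t := 4) (by norm_num)
    (by simp [tetraNormal]) (by simp [tetraNormal]), ← wedgeFraction_half]
  norm_num

theorem tetraAngle_zero_two (a b : ℤ) : tetraAngle a b {0, 2} = wedgeFraction (2 / √10) := by
  rw [tetraAngle, solidAngle_tangentCone_intPoint_pair _ one_pos (s := -2) (t := 10) (by norm_num)
    (by simp [tetraNormal]) (by simp [tetraNormal])]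
  norm_num

theorem tetraAngle_one_two (a b : ℤ) :
    tetraAngle a b {1, 2} = 1 / 2 - wedgeFraction (1 / √10) := by
  rw [tetraAngle, solidAngle_tangentCone_intPoint_pair _ one_pos (s := 1) (t := 10) (by norm_num)
    (by simp [tetraNormal]) (by simp [tetraNormal]), ← wedgeFraction_neg]
  norm_num [neg_div]

theorem tetraAngle_two_one_zero_three : tetraAngle 2 1 {0, 3} = 1 / 4 := by
  rw [tetraAngle, solidAngle_tangentCone_intPoint_pair _ one_pos (s := 0) (t := 36) (by norm_num)
    (by decide) (by decide), ← wedgeFraction_zero]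
  norm_num

theorem tetraAngle_two_one_one_three : tetraAngle 2 1 {1, 3} = 1 / 6 := by
  rw [tetraAngle, solidAngle_tangentCone_intPoint_pair _ (k := 3) (by norm_num) (s := -1) (t := 4)
    (by norm_num) (by decide) (by decide), ← wedgeFraction_half]
  norm_num

theorem tetraAngle_two_one_two_three : tetraAngle 2 1 {2, 3} = wedgeFraction (2 / √10) := by
  rw [tetraAngle, solidAngle_tangentCone_intPoint_pair _ (k := 3) (by norm_num) (s := -2) (t := 10)
    (by norm_num) (by decide) (by decide)]
  norm_num

theorem tetraAngle_three_five_zero_three : tetraAngle 3 5 {0, 3} = wedgeFraction (1 / √10) := by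
  rw [tetraAngle, solidAngle_tangentCone_intPoint_pair _ (k := 9) (by norm_num) (s := -1) (t := 10)
    (by norm_num) (by decide) (by decide)]
  norm_num

theorem tetraAngle_three_five_one_three : tetraAngle 3 5 {1, 3} = wedgeFraction (2 / √10) := by
  rw [tetraAngle, solidAngle_tangentCone_intPoint_pair _ (k := 9) (by norm_num) (s := -2) (t := 10)
    (by norm_num) (by decide) (by decide)]
  norm_num

theorem tetraAngle_three_five_two_three : tetraAngle 3 5 {2, 3} = 1 / 4 := by
  rw [tetraAngle, solidAngle_tangentCone_intPoint_pair _ one_pos (s := 0) (t := 2025) (by norm_num)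
    (by decide) (by decide), ← wedgeFraction_zero]
  norm_num

theorem tetraAngle_empty (a b : ℤ) : tetraAngle a b ∅ = 1 := solidAngle_tangentCone_empty _

theorem tetraAngle_singleton (ha : 0 < a) (hb : 0 < b) (i : Fin 4) : tetraAngle a b {i} = 1 / 2 :=
  solidAngle_tangentCone_singleton ((isSimplexPresentation_tetrahedron ha hb).normal_ne_zero i)

theorem sum_tetraAngle_triple (ha : 0 < a) (hb : 0 < b) :
    tetraAngle a b {0, 1, 2} + tetraAngle a b {0, 1, 3} + tetraAngle a b {0, 2, 3} +
      tetraAngle a b {1, 2, 3} =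
    tetraAngle a b {0, 1} + tetraAngle a b {0, 2} + tetraAngle a b {0, 3} + tetraAngle a b {1, 2} +
      tetraAngle a b {1, 3} + tetraAngle a b {2, 3} - 1 :=
  (isSimplexPresentation_tetrahedron ha hb).sum_solidAngle_tangentCone_triple

/-- A box of integer points which contains those of `tetrahedron 3 5`. -/
noncomputable def tetraBox : Finset (Fin 3 → ℤ) := Finset.Icc ![-5, -5, 0] ![0, 2, 5]

theorem mem_tetraBox {z : Fin 3 → ℤ} (hz : intPoint z ∈ tetrahedron 3 5) : z ∈ tetraBox := by
  have h := intPoint_mem_polyhedron.1 hz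
  have h0 := h 0
  have h1 := h 1
  have h2 := h 2
  have h3 := h 3
  simp only [tetraNormal, tetraConst, dotProduct, Fin.sum_univ_three, Matrix.cons_val]
    at h0 h1 h2 h3
  have hbox : (-5 ≤ z 0 ∧ -5 ≤ z 1 ∧ 0 ≤ z 2) ∧ z 0 ≤ 0 ∧ z 1 ≤ 2 ∧ z 2 ≤ 5 := by omega
  simpa [tetraBox, Pi.le_def, Fin.forall_fin_succ] using hbox

theorem discreteVolume_tetrahedron (h : tetrahedron a b ⊆ tetrahedron 3 5) :
    discreteVolume (tetrahedron a b) =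
      ((tightSets (tetraNormal a b) (tetraConst a b) tetraBox).map
        fun I : Finset (Fin 4) => tetraAngle a b I).sum :=
  discreteVolume_polyhedron fun _ hz => mem_tetraBox (h (intPoint_mem_polyhedron.2 hz))

theorem discreteVolume_tetrahedron_two_one : discreteVolume (tetrahedron 2 1) =
    2 * wedgeFraction (2 / √10) - 2 * wedgeFraction (1 / √10) + 13 / 12 := by
  have htight : tightSets (tetraNormal 2 1) (tetraConst 2 1) tetraBox =
      {{0, 1, 2}, {0, 1, 3}, {0, 2, 3}, {1, 2, 3}, {1, 2}, {0, 3}, {0, 3}} := by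
    decide +kernel
  have htriple := sum_tetraAngle_triple (a := 2) (b := 1) two_pos one_pos
  rw [tetraAngle_zero_one, tetraAngle_zero_two, tetraAngle_two_one_zero_three, tetraAngle_one_two,
    tetraAngle_two_one_one_three, tetraAngle_two_one_two_three] at htriple
  rw [discreteVolume_tetrahedron (tetrahedron_subset_tetrahedron (by decide) (by decide)
    (by decide) (by decide)), htight]
  simp only [Multiset.insert_eq_cons, Multiset.map_cons, Multiset.map_singleton,
    Multiset.sum_cons, Multiset.sum_singleton, Finset.coe_insert, Finset.coe_singleton,
    tetraAngle_one_two, tetraAngle_two_one_zero_three]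
  linarith

theorem discreteVolume_tetrahedron_three_five : discreteVolume (tetrahedron 3 5) =
    2 * wedgeFraction (2 / √10) - 2 * wedgeFraction (1 / √10) + 91 / 12 := by
  have htight : tightSets (tetraNormal 3 5) (tetraConst 3 5) tetraBox =
      {{0, 1, 2}, {0, 1, 3}, {0, 2, 3}, {1, 2, 3}, {1, 2}, {1, 2}, {0, 1}, {0, 1}, {0, 1}, {0, 1},
        {0}, {0}, {0}, {0}, {0}, {1}, {1}, {1}, {1}, {3}, ∅} := by
    decide +kernel
  have hsingle (i : Fin 4) : tetraAngle 3 5 {i} = 1 / 2 :=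
    tetraAngle_singleton (by decide) (by decide) i
  have htriple := sum_tetraAngle_triple (a := 3) (b := 5) (by decide) (by decide)
  rw [tetraAngle_zero_one, tetraAngle_zero_two, tetraAngle_three_five_zero_three,
    tetraAngle_one_two, tetraAngle_three_five_one_three, tetraAngle_three_five_two_three] at htriple
  rw [discreteVolume_tetrahedron subset_rfl, htight]
  simp only [Multiset.insert_eq_cons, Multiset.map_cons, Multiset.map_singleton,
    Multiset.sum_cons, Multiset.sum_singleton, Finset.coe_insert, Finset.coe_singleton,
    Finset.coe_empty, tetraAngle_zero_one, tetraAngle_one_two, hsingle, tetraAngle_empty]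
  linarith

variable {f : ℝ →ₗ[ℚ] ℝ}

theorem dehnIntegral_tetrahedron (ha : 0 < a) (hb : 0 < b) (hf : f 1 = 0) :
    dehnIntegral f (tetrahedron a b) =
      √6 * f (wedgeFraction (2 / √10)) - a * f (wedgeFraction (1 / √10)) +
      √(3 * b ^ 2 + 6) * f (tetraAngle a b {0, 3}) +
      √((a - b) ^ 2 + 2 * b ^ 2) * f (tetraAngle a b {1, 3}) +
      √((a - 1) ^ 2 + 5) * f (tetraAngle a b {2, 3}) := by
  have h01 : f (tetraAngle a b {0, 1}) = 0 := by
    rw [tetraAngle_zero_one]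
    simpa using map_ratCast_eq_zero hf (1 / 6)
  have h02 : tetraAngle a b {0, 2} = wedgeFraction (2 / √10) := tetraAngle_zero_two a b
  have h12 : f (tetraAngle a b {1, 2}) = -f (wedgeFraction (1 / √10)) := by
    rw [tetraAngle_one_two, map_sub, sub_eq_neg_self]
    simpa using map_ratCast_eq_zero hf (1 / 2)
  have hedge (i j : Fin 4) {m : ℤ}
      (h : (tetraVertex a b i - tetraVertex a b j) ⬝ᵥ (tetraVertex a b i - tetraVertex a b j) = m) :
      dist (intPoint (tetraVertex a b i)) (intPoint (tetraVertex a b j)) = √(m : ℝ) := by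
    rw [dist_intPoint, h]
  unfold tetraAngle at h01 h02 h12 ⊢
  rw [tetrahedron, (isSimplexPresentation_tetrahedron ha hb).dehnIntegral_polyhedron hf, h01, h02,
    h12, hedge 0 3 (m := a ^ 2) (by simp [tetraVertex]; ring),
    hedge 1 3 (m := 6) (by simp [tetraVertex]),
    hedge 1 2 (m := 3 * b ^ 2 + 6) (by simp [tetraVertex]; ring),
    hedge 0 2 (m := (a - b) ^ 2 + 2 * b ^ 2) (by simp [tetraVertex]; ring),
    hedge 0 1 (m := (a - 1) ^ 2 + 5) (by simp [tetraVertex]; ring), Int.cast_pow,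
    Real.sqrt_sq (Int.cast_nonneg ha.le)]
  push_cast
  ring

theorem dehnIntegral_tetrahedron_two_one (hf : f 1 = 0) : dehnIntegral f (tetrahedron 2 1) =
    2 * √6 * f (wedgeFraction (2 / √10)) - 2 * f (wedgeFraction (1 / √10)) := by
  have h03 : f (tetraAngle 2 1 {0, 3}) = 0 := by
    rw [tetraAngle_two_one_zero_three]
    simpa using map_ratCast_eq_zero hf (1 / 4)
  have h13 : f (tetraAngle 2 1 {1, 3}) = 0 := by
    rw [tetraAngle_two_one_one_three]
    simpa using map_ratCast_eq_zero hf (1 / 6)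
  rw [dehnIntegral_tetrahedron two_pos one_pos hf, h03, h13, tetraAngle_two_one_two_three]
  norm_num
  ring

theorem dehnIntegral_tetrahedron_three_five (hf : f 1 = 0) : dehnIntegral f (tetrahedron 3 5) =
    4 * √6 * f (wedgeFraction (2 / √10)) + 6 * f (wedgeFraction (1 / √10)) := by
  have h23 : f (tetraAngle 3 5 {2, 3}) = 0 := by
    rw [tetraAngle_three_five_two_three]
    simpa using map_ratCast_eq_zero hf (1 / 4)
  have hsqrt54 : √54 = 3 * √6 := by
    rw [show (54 : ℝ) = 3 ^ 2 * 6 by norm_num, Real.sqrt_mul (by positivity),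
      Real.sqrt_sq (by positivity)]
  have hsqrt81 : √81 = 9 := by
    rw [show (81 : ℝ) = 9 ^ 2 by norm_num, Real.sqrt_sq (by positivity)]
  rw [dehnIntegral_tetrahedron (by decide) (by decide) hf, h23, tetraAngle_three_five_zero_three,
    tetraAngle_three_five_one_three]
  norm_num [hsqrt54, hsqrt81]
  ring

end TetrahedronInvariants

section PyramidInvariants

theorem tetrahedron_two_one_subset : tetrahedron 2 1 ⊆ tetrahedron 3 5 :=
  tetrahedron_subset_tetrahedron (by decide) (by decide) (by decide) (by decide)

theorem isBounded_tetrahedron_three_five : Bornology.IsBounded (tetrahedron 3 5) :=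
  isBounded_tetrahedron (by decide) (by decide)

theorem ae_mem_sdiff_tetrahedron_iff :
    ∀ᵐ x : Euc 3, x ∈ tetrahedron 3 5 \ tetrahedron 2 1 ↔ x ∈ pyramid := by
  set L : Euc 3 →ₗ[ℝ] ℝ := (1 / 2 : ℝ) • coordP + coordY + coordQ
  have hL : L ≠ 0 := fun h => by simpa [L] using congrArg (· (point 0 1 0)) h
  filter_upwards [ae_linearMap_ne volume hL 1] with x hx
  simp only [L, LinearMap.add_apply, LinearMap.smul_apply, smul_eq_mul] at hx
  rw [Set.mem_sdiff, mem_tetrahedron (by decide) (by decide),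
    mem_tetrahedron (by decide) (by decide)]
  push_cast
  constructor
  · rintro ⟨⟨hp, hy, hq, hlarge⟩, hsmall⟩
    refine ⟨hp, hy, hq, hlarge, ?_⟩
    by_contra! hlt
    exact hsmall ⟨hp, hy, hq, by linarith⟩
  · rintro ⟨hp, hy, hq, hlarge, hsmall⟩
    exact ⟨⟨hp, hy, hq, hlarge⟩, fun h => hx (by linarith [h.2.2.2])⟩

theorem solidAngle_pyramid (x : Euc 3) :
    solidAngle pyramid x = solidAngle (tetrahedron 3 5) x - solidAngle (tetrahedron 2 1) x :=
  (((isPolyhedron_tetrahedron 2 1).hasSolidAngle_sdiff (isPolyhedron_tetrahedron 3 5)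
    tetrahedron_two_one_subset x).congr_ae one_pos
    (ae_mem_sdiff_tetrahedron_iff.mono fun _ h _ => h)).solidAngle_eq

theorem volume_real_pyramid : volume.real pyramid = 13 / 2 := by
  have hae : (tetrahedron 3 5 \ tetrahedron 2 1 : Set (Euc 3)) =ᵐ[volume] pyramid := by
    filter_upwards [ae_mem_sdiff_tetrahedron_iff] with x hx using propext hx
  rw [← measureReal_congr hae, measureReal_sdiff tetrahedron_two_one_subset
    (isPolyhedron_tetrahedron 2 1).isClosed.measurableSet
    isBounded_tetrahedron_three_five.measure_lt_top.ne, Measure.real, Measure.real,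
    volume_tetrahedron (by decide) (by decide), volume_tetrahedron (by decide) (by decide),
    ENNReal.toReal_ofReal (by norm_num), ENNReal.toReal_ofReal (by norm_num)]
  norm_num

theorem discreteVolume_pyramid : discreteVolume pyramid =
    discreteVolume (tetrahedron 3 5) - discreteVolume (tetrahedron 2 1) := by
  have hnonneg {S : Set (Euc 3)} (hS : IsPolyhedron S) (x) := (hS.hasSolidAngle x).nonneg
  have hsmall := hnonneg (isPolyhedron_tetrahedron 2 1)
  have hlarge := hnonneg (isPolyhedron_tetrahedron 3 5)
  have hpyramid := hnonneg isPolyhedron_pyramid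
  have hsum : ENNReal.ofReal (discreteVolume (tetrahedron 3 5)) =
      ENNReal.ofReal (discreteVolume pyramid) +
        ENNReal.ofReal (discreteVolume (tetrahedron 2 1)) := by
    rw [← tsum_ofReal_solidAngle (isPolyhedron_tetrahedron 2 1).isClosed
        (isBounded_tetrahedron_three_five.subset tetrahedron_two_one_subset) hsmall,
      ← tsum_ofReal_solidAngle (isPolyhedron_tetrahedron 3 5).isClosed
        isBounded_tetrahedron_three_five hlarge,
      ← tsum_ofReal_solidAngle isPolyhedron_pyramid.isClosed isBounded_pyramid hpyramid,
      ← ENNReal.tsum_add]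
    refine tsum_congr fun z => ?_
    rw [← ENNReal.ofReal_add (hpyramid _) (hsmall _), solidAngle_pyramid, sub_add_cancel]
  rw [← ENNReal.ofReal_add (discreteVolume_nonneg hpyramid) (discreteVolume_nonneg hsmall),
    ENNReal.ofReal_eq_ofReal_iff (discreteVolume_nonneg hlarge)
      (add_nonneg (discreteVolume_nonneg hpyramid) (discreteVolume_nonneg hsmall))] at hsum
  rw [hsum, add_sub_cancel_right]

theorem isConcrete_pyramid : IsConcrete pyramid := by
  rw [IsConcrete, discreteVolume_pyramid, discreteVolume_tetrahedron_three_five,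
    discreteVolume_tetrahedron_two_one, volume_real_pyramid]
  norm_num

theorem dehnIntegral_pyramid {f : ℝ →ₗ[ℚ] ℝ} (hf : f 1 = 0) : dehnIntegral f pyramid =
    2 * √6 * f (wedgeFraction (2 / √10)) + 8 * f (wedgeFraction (1 / √10)) := by
  have hsmall := (isPolyhedron_tetrahedron 2 1).integrable
    (isBounded_tetrahedron_three_five.subset tetrahedron_two_one_subset) hf
  have hlarge := (isPolyhedron_tetrahedron 3 5).integrable isBounded_tetrahedron_three_five hf
  simp only [dehnIntegral, solidAngle_pyramid, map_sub]
  rw [integral_sub hlarge hsmall, ← dehnIntegral, ← dehnIntegral,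
    dehnIntegral_tetrahedron_two_one hf, dehnIntegral_tetrahedron_three_five hf]
  ring

theorem irrational_wedgeFraction_one_div_sqrt_ten : Irrational (wedgeFraction (1 / √10)) := by
  have hsq : (1 / √10) ^ 2 = 1 / 10 := by rw [div_pow, Real.sq_sqrt (by norm_num), one_pow]
  refine irrational_wedgeFraction (r := -4 / 5) ?_ (by rw [hsq]; norm_num) (by norm_num)
  rw [← sq_le_one_iff_abs_le_one, hsq]
  norm_num

theorem exists_dehnIntegral_pyramid_ne_zero :
    ∃ f : ℝ →ₗ[ℚ] ℝ, f 1 = 0 ∧ dehnIntegral f pyramid ≠ 0 := by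
  obtain ⟨f, hf, hne, hrat⟩ :=
    exists_linearMap_ne_zero_of_irrational irrational_wedgeFraction_one_div_sqrt_ten
  obtain ⟨p, hp⟩ := hrat (wedgeFraction (1 / √10))
  obtain ⟨q, hq⟩ := hrat (wedgeFraction (2 / √10))
  refine ⟨f, hf, fun hzero => ?_⟩
  rw [dehnIntegral_pyramid hf, hp, hq] at hzero
  have hp0 : (p : ℝ) ≠ 0 := hp ▸ hne
  have hq0 : q ≠ 0 := by
    rintro rfl
    exact hp0 (by simpa using hzero)
  have hsqrt : Irrational √6 := irrational_sqrt_ofNat_iff.2 (by decide +kernel)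
  refine (hsqrt.mul_ratCast hq0).ne_rat (-4 * p) ?_
  push_cast
  linarith

theorem not_multitiles_of_dehnIntegral_ne_zero {S : Set (Euc 3)} (hS : IsPolyhedron S)
    (hb : Bornology.IsBounded S) (hv : volume S ≠ 0) {f : ℝ →ₗ[ℚ] ℝ} (hf : f 1 = 0)
    (h : dehnIntegral f S ≠ 0) : ¬Multitiles S := by
  rintro ⟨k, hk, ι, F, -, hF, hae⟩
  choose g hg using hF
  have htiling : IsMultitiling S g k := by simpa only [IsMultitiling, ← hg] using hae
  exact h (htiling.dehnIntegral_eq_zero hk hS.isClosed.measurableSet hb hv hS.hasSolidAngle hf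
    (hS.integrable hb hf))

end PyramidInvariants

section LatticePolytopes

/-- The convex hull of finitely many integer points. Unlike `IsLatticePolytope`, the definition
is visibly stable under Minkowski sums. -/
def IsLatticeHull {d : ℕ} (S : Set (Euc d)) : Prop :=
  ∃ s : Set (Euc d), s.Finite ∧ s ⊆ integerLattice d ∧ S = convexHull ℝ s

variable {d : ℕ} {S T : Set (Euc d)}

theorem IsLatticeHull.isLatticePolytope (h : IsLatticeHull S) : IsLatticePolytope S := by
  obtain ⟨s, hs, hl, rfl⟩ := h
  exact ⟨⟨s, hs, rfl⟩, extremePoints_convexHull_subset.trans hl⟩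

theorem IsLatticeHull.finite_polytopeVertices (h : IsLatticeHull S) :
    (polytopeVertices S).Finite := by
  obtain ⟨s, hs, -, rfl⟩ := h
  exact hs.subset extremePoints_convexHull_subset

theorem zero_mem_integerLattice : (0 : Euc d) ∈ integerLattice d := fun _ => ⟨0, by simp⟩

theorem add_mem_integerLattice {x y : Euc d} (hx : x ∈ integerLattice d)
    (hy : y ∈ integerLattice d) : x + y ∈ integerLattice d := fun i => by
  obtain ⟨a, ha⟩ := hx i
  obtain ⟨b, hb⟩ := hy i
  exact ⟨a + b, by simp [ha, hb]⟩

theorem IsLatticeHull.add (hS : IsLatticeHull S) (hT : IsLatticeHull T) :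
    IsLatticeHull (S + T) := by
  obtain ⟨s, hs, hsl, rfl⟩ := hS
  obtain ⟨t, ht, htl, rfl⟩ := hT
  refine ⟨s + t, hs.add ht, ?_, (convexHull_add s t).symm⟩
  exact Set.add_subset_iff.2 fun x hx y hy => add_mem_integerLattice (hsl hx) (htl hy)

theorem isLatticeHull_segment {v : Euc d} (hv : v ∈ integerLattice d) :
    IsLatticeHull (segment ℝ 0 v) :=
  ⟨{0, v}, Set.toFinite _, Set.pair_subset zero_mem_integerLattice hv, (convexHull_pair _ _).symm⟩

theorem isLatticeHull_sum_segment {n : ℕ} {v : Fin n → Euc d}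
    (hv : ∀ i, v i ∈ integerLattice d) : IsLatticeHull (∑ i, segment ℝ (0 : Euc d) (v i)) :=
  Finset.sum_induction _ _ (fun _ _ => IsLatticeHull.add)
    ⟨{0}, Set.finite_singleton _, Set.singleton_subset_iff.2 zero_mem_integerLattice,
      (convexHull_singleton _).symm⟩
    fun i _ => isLatticeHull_segment (hv i)

theorem IsPolyhedron.interior_nonempty (hS : IsPolyhedron S) (hv : volume S ≠ 0) :
    (interior S).Nonempty := by
  by_contra h
  have hfrontier := hS.convex.addHaar_frontier (volume : Measure (Euc d))
  rw [hS.isClosed.frontier_eq, Set.not_nonempty_iff_eq_empty.1 h, Set.sdiff_empty] at hfrontier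
  exact hv hfrontier

end LatticePolytopes

section PyramidSumIsLatticePolytope

/-- The vertices of the pyramid. -/
noncomputable def pyramidVertex : Fin 5 → Euc 3 :=
  ![point 2 0 0, point 0 0 1, point 3 0 0, point 0 0 5, point 0 1 0]

theorem pyramid_subset_convexHull : pyramid ⊆ convexHull ℝ (Set.range pyramidVertex) := by
  rintro x ⟨hp, hy, hq, hle, hge⟩
  obtain ⟨a, b, ha, hb, hab, h⟩ : 1 - coordY x ∈
      segment ℝ (coordP x / 3 + coordQ x / 5) (coordP x / 2 + coordQ x) :=
    Icc_subset_segment ⟨by linarith, by linarith⟩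
  simp only [smul_eq_mul] at h
  -- The vertices of one sloped edge of the base combine to `(p, q)` with the total weight
  -- `p / 2 + q`, those of the other with `p / 3 + q / 5`; interpolation gives the weight `1 - y`.
  have hx : ∑ i, ![coordP x * b / 2, coordQ x * b, coordP x * a / 3, coordQ x * a / 5,
      coordY x] i • pyramidVertex i = x := by
    refine ext_coord ?_ ?_ ?_ <;>
      simp only [Fin.sum_univ_five, pyramidVertex, Matrix.cons_val, map_add, map_smul,
        coordP_point, coordY_point, coordQ_point, smul_eq_mul]
    · linear_combination coordP x * hab
    · ring
    · linear_combination coordQ x * hab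
  rw [← hx]
  refine (convex_convexHull ℝ _).sum_mem (fun i _ => ?_) ?_
    fun i _ => subset_convexHull ℝ _ ⟨i, rfl⟩
  · fin_cases i <;> simp only [Fin.reduceFinMk, Fin.zero_eta, Fin.mk_one, Matrix.cons_val] <;>
      positivity
  · simp only [Fin.sum_univ_five, Matrix.cons_val]
    linear_combination h

theorem isLatticeHull_pyramid : IsLatticeHull pyramid := by
  refine ⟨_, Set.finite_range pyramidVertex, ?_, pyramid_subset_convexHull.antisymm
    (convexHull_min ?_ isPolyhedron_pyramid.convex)⟩
  · rintro _ ⟨i, rfl⟩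
    fin_cases i
    · exact_mod_cast point_mem_integerLattice 2 0 0
    · exact_mod_cast point_mem_integerLattice 0 0 1
    · exact_mod_cast point_mem_integerLattice 3 0 0
    · exact_mod_cast point_mem_integerLattice 0 0 5
    · exact_mod_cast point_mem_integerLattice 0 1 0
  · rintro _ ⟨i, rfl⟩
    fin_cases i <;> norm_num [pyramidVertex, pyramid]

theorem isLatticeHull_zonotope (n : ℕ) : IsLatticeHull (zonotope n) :=
  isLatticeHull_sum_segment fun j => by exact_mod_cast point_mem_integerLattice 1 0 j

theorem isLatticeHull_pyramidSum (n : ℕ) : IsLatticeHull (pyramidSum n) :=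
  isLatticeHull_pyramid.add (isLatticeHull_zonotope n)

theorem isLatticeZonotope_zonotope (n : ℕ) : IsLatticeZonotope (zonotope n) :=
  ⟨⟨n, 0, fun j => zoneVector j, by rw [Set.singleton_zero, zero_add, zonotope]⟩,
    (isLatticeHull_zonotope n).isLatticePolytope⟩

theorem volume_pyramidSum_ne_zero (n : ℕ) : volume (pyramidSum n) ≠ 0 := by
  intro h
  have hsub : pyramid ⊆ pyramidSum n := by
    rw [← pyramidSum_zero]
    exact monotone_nat_of_le_succ pyramidSum_subset_succ n.zero_le
  have hv := volume_real_pyramid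
  rw [Measure.real, measure_mono_null hsub h] at hv
  norm_num at hv

theorem isConcreteNonMultitiler_pyramidSum (n : ℕ) : IsConcreteNonMultitiler (pyramidSum n) := by
  obtain ⟨f, hf, hne⟩ := exists_dehnIntegral_pyramid_ne_zero
  rw [← dehnIntegral_pyramidSum hf n] at hne
  exact ⟨(isLatticeHull_pyramidSum n).isLatticePolytope,
    (isPolyhedron_pyramidSum n).interior_nonempty (volume_pyramidSum_ne_zero n),
    isConcrete_pyramidSum isConcrete_pyramid n,
    not_multitiles_of_dehnIntegral_ne_zero (isPolyhedron_pyramidSum n) (isBounded_pyramidSum n)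
      (volume_pyramidSum_ne_zero n) hf hne⟩

end PyramidSumIsLatticePolytope

section Vertices

/-- The point `x` is the only point of `S` at which `L` is maximal on `S`. -/
def IsUniqueMaxOn {d : ℕ} (L : Euc d →ₗ[ℝ] ℝ) (S : Set (Euc d)) (x : Euc d) : Prop :=
  x ∈ S ∧ ∀ y ∈ S, L x ≤ L y → y = x

namespace IsUniqueMaxOn

variable {d : ℕ} {L : Euc d →ₗ[ℝ] ℝ} {S : Set (Euc d)} {x v : Euc d}

theorem mem_polytopeVertices (h : IsUniqueMaxOn L S x) : x ∈ polytopeVertices S :=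
  exposedPoints_subset_extremePoints ⟨h.1, L.toContinuousLinearMap, fun y hy =>
    ⟨le_of_not_gt fun hlt => hlt.ne (h.2 y hy hlt.le ▸ rfl), h.2 y hy⟩⟩

theorem add_segment_of_pos (h : IsUniqueMaxOn L S x) (hv : 0 < L v) :
    IsUniqueMaxOn L (S + segment ℝ 0 v) (x + v) := by
  refine ⟨Set.add_mem_add h.1 (right_mem_segment _ _ _), fun y hy hle => ?_⟩
  obtain ⟨t, -, h1, hz⟩ := mem_add_segment_iff.1 hy
  have hLz : L x + (1 - t) * L v ≤ L (y - t • v) := by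
    rw [map_sub, map_smul, smul_eq_mul]
    linarith [map_add L x v]
  have hzx : y - t • v = x := h.2 _ hz (by nlinarith)
  have ht : t = 1 := by rw [hzx] at hLz; nlinarith
  rw [← hzx, ht, one_smul, sub_add_cancel]

theorem add_segment_of_neg (h : IsUniqueMaxOn L S x) (hv : L v < 0) :
    IsUniqueMaxOn L (S + segment ℝ 0 v) x := by
  refine ⟨subset_add_segment h.1, fun y hy hle => ?_⟩
  obtain ⟨t, h0, -, hz⟩ := mem_add_segment_iff.1 hy
  have hLz : L x + t * -L v ≤ L (y - t • v) := by
    rw [map_sub, map_smul, smul_eq_mul]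
    linarith
  have hzx : y - t • v = x := h.2 _ hz (by nlinarith)
  have ht : t = 0 := by rw [hzx] at hLz; nlinarith
  rw [← hzx, ht, zero_smul, sub_zero]

end IsUniqueMaxOn

/-- A linear function which is positive on `zoneVector j` for `j ≤ k` and negative on
`zoneVector j` for `k < j`. -/
noncomputable def separator (k : ℕ) : Euc 3 →ₗ[ℝ] ℝ := ((k : ℝ) + 1 / 2) • coordP - coordQ

theorem separator_apply (k : ℕ) (x : Euc 3) :
    separator k x = (k + 1 / 2) * coordP x - coordQ x := rfl

theorem separator_zoneVector (k j : ℕ) : separator k (zoneVector j) = k + 1 / 2 - j := by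
  simp [separator_apply, zoneVector]

theorem isUniqueMaxOn_pyramid (k : ℕ) : IsUniqueMaxOn (separator k) pyramid (point 3 0 0) := by
  refine ⟨by norm_num [pyramid], ?_⟩
  rintro x ⟨-, hy, hq, hle, -⟩ h
  rw [separator_apply, separator_apply, coordP_point, coordQ_point] at h
  have hk : (0 : ℝ) < k + 1 / 2 := by positivity
  have hle' : (k + 1 / 2) * coordP x ≤ (k + 1 / 2) * (3 - 3 * coordY x - 3 / 5 * coordQ x) :=
    mul_le_mul_of_nonneg_left (by linarith) hk.le
  have hky := mul_nonneg hk.le hy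
  have hkq := mul_nonneg hk.le hq
  have hq0 : coordQ x = 0 := by linarith
  have hy0 : coordY x = 0 := by nlinarith
  have hp0 : coordP x = 3 := by nlinarith
  rw [← point_coord x, hp0, hy0, hq0]

/-- The vertex of the sums `pyramidSum n`, `k < n`, at which `separator k` is maximal. -/
noncomputable def sumVertex (k : ℕ) : Euc 3 :=
  point 3 0 0 + ∑ j ∈ Finset.range (k + 1), zoneVector j

theorem isUniqueMaxOn_pyramidSum_of_le {k n : ℕ} (hn : n ≤ k + 1) :
    IsUniqueMaxOn (separator k) (pyramidSum n)
      (point 3 0 0 + ∑ j ∈ Finset.range n, zoneVector j) := by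
  induction n with
  | zero => simpa [pyramidSum_zero] using isUniqueMaxOn_pyramid k
  | succ n ih =>
    rw [pyramidSum_succ, Finset.sum_range_succ, ← add_assoc]
    refine (ih (by omega)).add_segment_of_pos ?_
    have hnk : (n : ℝ) ≤ k := by exact_mod_cast Nat.le_of_succ_le_succ hn
    rw [separator_zoneVector]
    linarith

theorem isUniqueMaxOn_pyramidSum {k n : ℕ} (hn : k < n) :
    IsUniqueMaxOn (separator k) (pyramidSum n) (sumVertex k) := by
  induction n, hn using Nat.le_induction with
  | base => exact isUniqueMaxOn_pyramidSum_of_le le_rfl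
  | succ n hn ih =>
    rw [pyramidSum_succ]
    refine ih.add_segment_of_neg ?_
    have hkn : (k : ℝ) + 1 ≤ n := by exact_mod_cast hn
    rw [separator_zoneVector]
    linarith

theorem sumVertex_injective : Function.Injective sumVertex := fun k l h => by
  have hP := congrArg coordP h
  simpa [sumVertex, sum_zoneVector] using hP

theorem le_ncard_polytopeVertices_pyramidSum (n : ℕ) :
    n ≤ (polytopeVertices (pyramidSum n)).ncard :=
  calc n = (sumVertex '' (Finset.range n : Set ℕ)).ncard := by
        rw [Set.ncard_image_of_injective _ sumVertex_injective, Set.ncard_coe_finset,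
          Finset.card_range]
    _ ≤ (polytopeVertices (pyramidSum n)).ncard := by
        refine Set.ncard_le_ncard ?_ (isLatticeHull_pyramidSum n).finite_polytopeVertices
        rintro _ ⟨k, hk, rfl⟩
        exact (isUniqueMaxOn_pyramidSum (Finset.mem_range.1 hk)).mem_polytopeVertices

end Vertices

theorem theorem1p2 :
    ∃ P : Set (Euc 3), IsConcreteNonMultitiler P ∧
      ∀ N : ℕ, ∃ Q : Set (Euc 3), IsLatticeZonotope Q ∧
        IsConcreteNonMultitiler (P + Q) ∧ N < (polytopeVertices (P + Q)).ncard := by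
  refine ⟨pyramid, ?_, fun N => ⟨zonotope (N + 1), isLatticeZonotope_zonotope (N + 1), ?_, ?_⟩⟩
  · exact pyramidSum_zero ▸ isConcreteNonMultitiler_pyramidSum 0
  · exact isConcreteNonMultitiler_pyramidSum (N + 1)
  · exact le_ncard_polytopeVertices_pyramidSum (N + 1)
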